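/- Let $K$ be a commutative field of any characteristic. **Bidendriform bialgebras.** A bidendriform bialgebra is a $K$-vector space $A$ with linear maps $\prec,\succ:A\otimes A\to A$ and $\Delta_\prec,\Delta_\succ:A\to A\otimes A$ such that, writing $ab=a\prec b+a\succ b$, $\tilde\Delta=\Delta_\prec+\Delta_\succ$, $\tilde\Delta(a)=a'\otimes a''$, $\Delta_\prec(a)=a'_\prec\otimes a''_\prec$, $\Delta_\succ(a)=a'_\succ\otimes a''_\succ$, for all $a,b,c\in A$: 1. $(a\prec b)\prec c=a\prec(bc)$, $(a\succ b)\prec c=a\succ(b\prec c)$, $(ab)\succ c=a\succ(b\succ c)$; 2. $(\Delta_\prec\otimes Id)\Delta_\prec=(Id\otimes\tilde\Delta)\Delta_\prec$, $(\Delta_\succ\otimes Id)\Delta_\prec=(Id\otimes\Delta_\prec)\Delta_\succ$, $(\tilde\Delta\otimes Id)\Delta_\succ=(Id\otimes\Delta_\succ)\Delta_\succ$; 3. $\Delta_\succ(a\succ b)=a'b'_\succ\otimes a''\succ b''_\succ+a'\otimes a''\succ b+b'_\succ\otimes a\succ b''_\succ+ab'_\succ\otimes b''_\succ+a\otimes b$,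 $\Delta_\succ(a\prec b)=a'b'_\succ\otimes a''\prec b''_\succ+a'\otimes a''\prec b+b'_\succ\otimes a\prec b''_\succ$, $\Delta_\prec(a\succ b)=a'b'_\prec\otimes a''\succ b''_\prec+ab'_\prec\otimes b''_\prec+b'_\prec\otimes a\succ b''_\prec$, $\Delta_\prec(a\prec b)=a'b'_\prec\otimes a''\prec b''_\prec+a'b\otimes a''+b'_\prec\otimes a\prec b''_\prec+b\otimes a$. It is graded if $A=\bigoplus_{n\in\mathbb N}A_n$ and the four maps are homogeneous of degree $0$. An isomorphism of graded bidendriform bialgebras (resp. of graded Hopf algebras) is a linear bijection that respects the four maps (resp. product, unit, coproduct and counit) and maps each homogeneous part onto the homogeneous part of the same degree. **The Hopf algebra $\mathbf{FQSym}$** has basis $\mathbf F_u$, $u\in\bigsqcup_{n\ge0}S_n$, with $\mathbf F_u$ of degree $n$ for $u\in S_n$. For $u=(u_1\ldots u_n)\in S_n$ and $v\in S_m$, $$\mathbf F_u\mathbf F_v=\sum_{\zeta\in sh(n,m)}\mathbf F_{(u\times v)\zeta^{-1}},\qquad \Delta(\mathbf F_u)=\sum_{i=0}^n\mathbf F_{st(u_1\ldots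 u_i)}\otimes\mathbf F_{st(u_{i+1}\ldots u_n)},$$ where $sh(n,m)$ is the set of $\zeta\in S_{n+m}$ that are increasing on $\{1,\ldots,n\}$ and on $\{n+1,\ldots,n+m\}$, and $st$ is standardisation; the unit is $\mathbf F_\emptyset$, and $\varepsilon(\mathbf F_u)=1$ if $n=0$, $\varepsilon(\mathbf F_u)=0$ otherwise. On its augmentation ideal $(\mathbf{FQSym})_+=Vect(\mathbf F_u\mid u\in S_n,\ n\ge1)$, $\mathbf F_u\prec\mathbf F_v$ (resp. $\mathbf F_u\succ\mathbf F_v$) is the sum of the terms of $\mathbf F_u\mathbf F_v$ with $\zeta^{-1}(n+m)=n$ (resp. $\zeta^{-1}(n+m)=n+m$), and $\Delta_\prec(\mathbf F_u)$ (resp. $\Delta_\succ(\mathbf F_u)$) is the sum of the terms of $\Delta(\mathbf F_u)$ with $u^{-1}(n)\le i\le n-1$ (resp. $1\le i\le u^{-1}(n)-1$). **The Hopf algebra $\mathcal H^{\mathcal D}$.** For a set $\mathcal D$, $\mathcal H^{\mathcal D}$ is the free associative $K$-algebra generated by the planar rooted trees with vertices decorated by $\mathcal D$; its basis is the set of planar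 decorated forests. An admissible cut of a tree is either the total cut or a (possibly empty) set of edges of which each path from the root to a leaf contains at most one; an admissible cut $c$ of a forest $F$ is a choice of an admissible cut of each of its trees. It gives the forest $R^c(F)$ of the components that contain the roots of the trees that are not totally cut, and the forest $P^c(F)$ of the other components, in the same order. The coproduct is $\Delta(F)=\sum_cP^c(F)\otimes R^c(F)$, over all admissible cuts, and $\varepsilon(F)=\delta_{F,1}$. Let $\mathcal A^{\mathcal D}$ be the augmentation ideal of $\mathcal H^{\mathcal D}$, with basis the forests $F\ne1$. On it, $\prec$ and $\succ$ are determined by the axioms 1, by $x\prec y+x\succ y=xy$ and by $\bullet_d\prec x=B_d^+(x)$, where $\bullet_d$ is the one-vertex tree decorated by $d$ and $B_d^+$ grafts the trees of a forest on a common root decorated by $d$. Moreover $\Delta_\prec(F)=\sum_cP^c(F)\otimes R^c(F)$, over the admissible cuts $c$ of $F$, other than the one that is total on each tree, which cut totally the last tree of $F$ or cut an edge on the path from the root of the last tree to the rightmost leaf of $F$, and $\Delta_\succ(F)$ is the sum over all the other cuts that are neither the empty one nor the one that is total on each tree. (In particular $\Delta_\prec(\bullet_d)=\Delta_\succ(\bullet_d)=0$.)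 If $\mathcal D$ is graded by a map $|\cdot|:\mathcal D\to\mathbb N$, a forest has as its degree the sum of the degrees of the decorations of its vertices. **Theorem.** Let $R(X)=\sum_{n\ge1}n!\,X^n$ and define $(p_n)_{n\ge1}$ by $\sum_{n\ge1}p_nX^n=\dfrac{R(X)}{(1+R(X))^2}$. Let $\mathcal D$ be a graded set such that $\mathcal D_0=\emptyset$ and, for all $n\ge1$, the set $\mathcal D_n$ of its elements of degree $n$ is finite with $card(\mathcal D_n)=p_n$. Then $(\mathbf{FQSym})_+$ and $\mathcal A^{\mathcal D}$, with the structures above, are graded bidendriform bialgebras and are isomorphic as such. Hence $\mathbf{FQSym}$ and $\mathcal H^{\mathcal D}$ are graded Hopf algebras and are isomorphic as such. -/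

import Mathlib

open scoped TensorProduct

noncomputable section

namespace Bidend

universe u v w

/-! ## Bidendriform bialgebras -/

section General

variable (K : Type u) [Field K]

/-- The operations `≺`, `≻`, `Δ_≺`, `Δ_≻` of a (candidate) bidendriform bialgebra. -/
structure BidendOps (A : Type v) [AddCommGroup A] [Module K A] where
  prec : A →ₗ[K] A →ₗ[K] A
  succ : A →ₗ[K] A →ₗ[K] A
  dprec : A →ₗ[K] A ⊗[K] A
  dsucc : A →ₗ[K] A ⊗[K] A

/-- The operations of a (candidate) Hopf algebra, except for the antipode, which is determined
by the others. -/
structure HopfOps (A : Type v) [AddCommGroup A] [Module K A] where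
  mul : A →ₗ[K] A →ₗ[K] A
  one : A
  comul : A →ₗ[K] A ⊗[K] A
  counit : A →ₗ[K] K

variable {K}
variable {A : Type v} [AddCommGroup A] [Module K A]
variable {B : Type w} [AddCommGroup B] [Module K B]

/-- The associative product `ab = a ≺ b + a ≻ b`. -/
def BidendOps.mul (S : BidendOps K A) : A →ₗ[K] A →ₗ[K] A := S.prec + S.succ

/-- The coassociative reduced coproduct `Δ_≺ + Δ_≻`. -/
def BidendOps.dred (S : BidendOps K A) : A →ₗ[K] A ⊗[K] A := S.dprec + S.dsucc

/-- `(A, ≺, ≻)` is a dendriform algebra. -/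
structure BidendOps.IsDendriformAlgebra (S : BidendOps K A) : Prop where
  prec_prec : ∀ a b c, S.prec (S.prec a b) c = S.prec a (S.prec b c + S.succ b c)
  succ_prec : ∀ a b c, S.prec (S.succ a b) c = S.succ a (S.prec b c)
  succ_succ : ∀ a b c, S.succ (S.prec a b + S.succ a b) c = S.succ a (S.succ b c)

/-- `(A, Δ_≺, Δ_≻)` is a dendriform coalgebra. -/
structure BidendOps.IsDendriformCoalgebra (S : BidendOps K A) : Prop where
  dprec_dprec : ∀ a, TensorProduct.assoc K A A A (S.dprec.rTensor A (S.dprec a)) =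
    (S.dprec + S.dsucc).lTensor A (S.dprec a)
  dsucc_dprec : ∀ a, TensorProduct.assoc K A A A (S.dsucc.rTensor A (S.dprec a)) =
    S.dprec.lTensor A (S.dsucc a)
  dsucc_dsucc : ∀ a,
    TensorProduct.assoc K A A A ((S.dprec + S.dsucc).rTensor A (S.dsucc a)) =
      S.dsucc.lTensor A (S.dsucc a)

/-- `(A, ≺, ≻, Δ_≺, Δ_≻)` is a bidendriform bialgebra. With `a' ⊗ a''` for `S.dred a`,
`b'_≺ ⊗ b''_≺` for `S.dprec b` and `b'_≻ ⊗ b''_≻` for `S.dsucc b`, the last four fields are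

* `Δ_≻(a ≻ b) = a'b'_≻ ⊗ a''≻b''_≻ + a' ⊗ a''≻b + b'_≻ ⊗ a≻b''_≻ + ab'_≻ ⊗ b''_≻ + a ⊗ b`;
* `Δ_≻(a ≺ b) = a'b'_≻ ⊗ a''≺b''_≻ + a' ⊗ a''≺b + b'_≻ ⊗ a≺b''_≻`;
* `Δ_≺(a ≻ b) = a'b'_≺ ⊗ a''≻b''_≺ + ab'_≺ ⊗ b''_≺ + b'_≺ ⊗ a≻b''_≺`;
* `Δ_≺(a ≺ b) = a'b'_≺ ⊗ a''≺b''_≺ + a'b ⊗ a'' + b'_≺ ⊗ a≺b''_≺ + b ⊗ a`. -/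
structure BidendOps.IsBidendriformBialgebra (S : BidendOps K A) : Prop where
  algebra : S.IsDendriformAlgebra
  coalgebra : S.IsDendriformCoalgebra
  dsucc_succ : ∀ a b, S.dsucc (S.succ a b) =
    TensorProduct.map₂ S.mul S.succ (S.dred a) (S.dsucc b)
      + (S.succ.flip b).lTensor A (S.dred a)
      + (S.succ a).lTensor A (S.dsucc b)
      + (S.mul a).rTensor A (S.dsucc b)
      + a ⊗ₜ[K] b
  dsucc_prec : ∀ a b, S.dsucc (S.prec a b) =
    TensorProduct.map₂ S.mul S.prec (S.dred a) (S.dsucc b)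
      + (S.prec.flip b).lTensor A (S.dred a)
      + (S.prec a).lTensor A (S.dsucc b)
  dprec_succ : ∀ a b, S.dprec (S.succ a b) =
    TensorProduct.map₂ S.mul S.succ (S.dred a) (S.dprec b)
      + (S.mul a).rTensor A (S.dprec b)
      + (S.succ a).lTensor A (S.dprec b)
  dprec_prec : ∀ a b, S.dprec (S.prec a b) =
    TensorProduct.map₂ S.mul S.prec (S.dred a) (S.dprec b)
      + (S.mul.flip b).rTensor A (S.dred a)
      + (S.prec a).lTensor A (S.dprec b)
      + b ⊗ₜ[K] a

/-- The homogeneous part `⨁_{i+j=n} A_i ⊗ A_j` of degree `n` of `A ⊗ A`. -/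
def tensorDegree (𝒜 : ℕ → Submodule K A) (n : ℕ) : Submodule K (A ⊗[K] A) :=
  ⨆ p ∈ Finset.HasAntidiagonal.antidiagonal n,
    LinearMap.range (TensorProduct.map (𝒜 p.1).subtype (𝒜 p.2).subtype)

/-- A bidendriform bialgebra that is `ℕ`-graded by `𝒜`. -/
structure BidendOps.IsGradedBidendriformBialgebra (S : BidendOps K A)
    (𝒜 : ℕ → Submodule K A) : Prop where
  bidendriform : S.IsBidendriformBialgebra
  isInternal : DirectSum.IsInternal 𝒜
  prec_mem : ∀ i j, ∀ a ∈ 𝒜 i, ∀ b ∈ 𝒜 j, S.prec a b ∈ 𝒜 (i + j)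
  succ_mem : ∀ i j, ∀ a ∈ 𝒜 i, ∀ b ∈ 𝒜 j, S.succ a b ∈ 𝒜 (i + j)
  dprec_mem : ∀ n, ∀ a ∈ 𝒜 n, S.dprec a ∈ tensorDegree 𝒜 n
  dsucc_mem : ∀ n, ∀ a ∈ 𝒜 n, S.dsucc a ∈ tensorDegree 𝒜 n

/-- `e` is an isomorphism of graded bidendriform bialgebras. -/
structure IsGradedBidendIso (S : BidendOps K A) (𝒜 : ℕ → Submodule K A)
    (T : BidendOps K B) (ℬ : ℕ → Submodule K B) (e : A ≃ₗ[K] B) : Prop where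
  map_prec : ∀ a b, e (S.prec a b) = T.prec (e a) (e b)
  map_succ : ∀ a b, e (S.succ a b) = T.succ (e a) (e b)
  map_dprec : ∀ a,
    T.dprec (e a) = TensorProduct.map (e : A →ₗ[K] B) (e : A →ₗ[K] B) (S.dprec a)
  map_dsucc : ∀ a,
    T.dsucc (e a) = TensorProduct.map (e : A →ₗ[K] B) (e : A →ₗ[K] B) (S.dsucc a)
  map_degree : ∀ n, (𝒜 n).map (e : A →ₗ[K] B) = ℬ n

/-! ## Graded Hopf algebras -/

/-- The operations `S` make the vector space `A` a Hopf algebra which is `ℕ`-graded by `𝒜`.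
That they make `A` a Hopf algebra is expressed by Mathlib's `HopfAlgebra`: some linear
isomorphism of `A` onto a Hopf algebra `H` carries the operations of `S` to those of `H`. -/
def HopfOps.IsGradedHopfAlgebra (S : HopfOps K A) (𝒜 : ℕ → Submodule K A) : Prop :=
  (∃ (H : Type v) (_ : Ring H) (_ : HopfAlgebra K H) (e : A ≃ₗ[K] H),
    (∀ a b, e (S.mul a b) = e a * e b) ∧
    e S.one = 1 ∧
    (∀ a, Coalgebra.comul (R := K) (e a) =
      TensorProduct.map (e : A →ₗ[K] H) (e : A →ₗ[K] H) (S.comul a)) ∧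
    (∀ a, Coalgebra.counit (R := K) (e a) = S.counit a) ∧
    (∀ n, ∀ a ∈ 𝒜 n, e.symm (HopfAlgebra.antipode K (e a)) ∈ 𝒜 n)) ∧
  DirectSum.IsInternal 𝒜 ∧
  S.one ∈ 𝒜 0 ∧
  (∀ i j, ∀ a ∈ 𝒜 i, ∀ b ∈ 𝒜 j, S.mul a b ∈ 𝒜 (i + j)) ∧
  (∀ n, ∀ a ∈ 𝒜 n, S.comul a ∈ tensorDegree 𝒜 n) ∧
  (∀ n, n ≠ 0 → ∀ a ∈ 𝒜 n, S.counit a = 0)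

/-- `e` is an isomorphism of graded Hopf algebras. -/
structure IsGradedHopfIso (S : HopfOps K A) (𝒜 : ℕ → Submodule K A)
    (T : HopfOps K B) (ℬ : ℕ → Submodule K B) (e : A ≃ₗ[K] B) : Prop where
  map_mul : ∀ a b, e (S.mul a b) = T.mul (e a) (e b)
  map_one : e S.one = T.one
  map_comul : ∀ a,
    T.comul (e a) = TensorProduct.map (e : A →ₗ[K] B) (e : A →ₗ[K] B) (S.comul a)
  map_counit : ∀ a, T.counit (e a) = S.counit a
  map_degree : ∀ n, (𝒜 n).map (e : A →ₗ[K] B) = ℬ n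

end General

/-- Bilinear extension of a map given on basis elements. -/
def bilin (K : Type u) [Field K] {X : Type v} {M : Type w} [AddCommGroup M] [Module K M]
    (f : X → X → M) : (X →₀ K) →ₗ[K] (X →₀ K) →ₗ[K] M :=
  Finsupp.linearCombination K fun x => Finsupp.linearCombination K (f x)

/-! ## The Hopf algebra `FQSym` -/

/-- The disjoint union of the symmetric groups `S_n`, `n ≥ 0`, where `S_n` acts on
`Fin n = {0, …, n-1}`, so that letters and positions are shifted by one. -/
abbrev AllPerm : Type := Σ n : ℕ, Equiv.Perm (Fin n)

/-- The vector space with basis `F_u`, `u ∈ ⨆ S_n`; the basis element `F_u` is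
`Finsupp.single u 1`. -/
abbrev FQSym (K : Type u) [Field K] : Type u := AllPerm →₀ K

/-- The set of the `u ∈ S_n` with `n ≥ 1`. -/
def posPerm : Set AllPerm := {u | 1 ≤ u.1}

/-- The augmentation ideal of `FQSym`, with basis `F_u`, `u ∈ S_n`, `n ≥ 1`. -/
abbrev FQSymPlus (K : Type u) [Field K] : Type u := posPerm →₀ K

/-- The standardisation of a word `w` of length `k` with distinct letters: the permutation
`st w` with `st w i < st w j ↔ w i < w j`. -/
def st {k : ℕ} {α : Type v} [LinearOrder α] (w : Fin k → α) : Equiv.Perm (Fin k) :=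
  (Tuple.sort w)⁻¹

/-- `st (u_1 … u_i)`, where `u = (u_1 … u_n)`. -/
def stLeft (u : AllPerm) (i : Fin (u.1 + 1)) : AllPerm :=
  ⟨i, st fun j : Fin i => u.2 ⟨j, by omega⟩⟩

/-- `st (u_{i+1} … u_n)`, where `u = (u_1 … u_n)`. -/
def stRight (u : AllPerm) (i : Fin (u.1 + 1)) : AllPerm :=
  ⟨u.1 - i, st fun j : Fin (u.1 - i) => u.2 ⟨i + j, by omega⟩⟩

/-- The permutation `u × v` of `Fin (n + m)`: `u` on the first `n` points, `v` on the last `m`. -/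
def block {n m : ℕ} (u : Equiv.Perm (Fin n)) (v : Equiv.Perm (Fin m)) :
    Equiv.Perm (Fin (n + m)) :=
  finSumFinEquiv.permCongr (Equiv.Perm.sumCongr u v)

open scoped Classical in
/-- The set of `(n, m)`-shuffles. -/
def shuffles (n m : ℕ) : Finset (Equiv.Perm (Fin (n + m))) :=
  {ζ | StrictMono (fun i : Fin n => ζ (Fin.castAdd m i)) ∧
    StrictMono (fun j : Fin m => ζ (Fin.natAdd n j))}

/-- The element `(u × v) ∘ ζ⁻¹` of `S_{n+m}`. -/
def shufflePerm (u v : AllPerm) (ζ : Equiv.Perm (Fin (u.1 + v.1))) : AllPerm :=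
  ⟨u.1 + v.1, block u.2 v.2 * ζ⁻¹⟩

open scoped Classical in
/-- The Hopf algebra operations of `FQSym`. -/
def fqsymHopf (K : Type u) [Field K] : HopfOps K (FQSym K) where
  mul := bilin K fun u v =>
    ∑ ζ ∈ shuffles u.1 v.1, Finsupp.single (shufflePerm u v ζ) 1
  one := Finsupp.single ⟨0, 1⟩ 1
  comul := Finsupp.linearCombination K fun u =>
    ∑ i : Fin (u.1 + 1), Finsupp.single (stLeft u i) 1 ⊗ₜ[K] Finsupp.single (stRight u i) 1
  counit := Finsupp.linearCombination K fun u => if u.1 = 0 then 1 else 0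

/-- The linear projection of `FQSym` onto its augmentation ideal that kills `1`. -/
def fqsymProj (K : Type u) [Field K] : FQSym K →ₗ[K] FQSymPlus K :=
  Finsupp.lsubtypeDomain posPerm

open scoped Classical in
/-- The bidendriform operations of the augmentation ideal of `FQSym`. In `prec` (`succ`) the sum
runs over the shuffles `ζ ∈ sh(n, m)` with `ζ⁻¹(n+m) = n` (with `ζ⁻¹(n+m) = n+m`); in `dprec`
(`dsucc`) it runs over the `i` with `u⁻¹(n) ≤ i ≤ n-1` (with `1 ≤ i ≤ u⁻¹(n) - 1`), and `k` is
the position of the letter `n` of `u`. Elements of `Fin` are one less than those they stand for.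
All the basis elements of `FQSym` that occur are `F_w` with `w ∈ S_k`, `k ≥ 1`, so that
`fqsymProj` only serves to see them in the augmentation ideal. -/
def fqsymBidend (K : Type u) [Field K] : BidendOps K (FQSymPlus K) where
  prec := bilin K fun u v =>
    ∑ ζ ∈ (shuffles u.1.1 v.1.1).filter fun ζ =>
        ∀ l : Fin (u.1.1 + v.1.1), (l : ℕ) + 1 = u.1.1 + v.1.1 →
          (ζ⁻¹ l : ℕ) + 1 = u.1.1,
      fqsymProj K (Finsupp.single (shufflePerm u.1 v.1 ζ) 1)
  succ := bilin K fun u v =>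
    ∑ ζ ∈ (shuffles u.1.1 v.1.1).filter fun ζ =>
        ∀ l : Fin (u.1.1 + v.1.1), (l : ℕ) + 1 = u.1.1 + v.1.1 →
          (ζ⁻¹ l : ℕ) + 1 = u.1.1 + v.1.1,
      fqsymProj K (Finsupp.single (shufflePerm u.1 v.1 ζ) 1)
  dprec := Finsupp.linearCombination K fun u =>
    ∑ i ∈ Finset.univ.filter fun i : Fin (u.1.1 + 1) => (i : ℕ) < u.1.1 ∧
        ∀ k : Fin u.1.1, (u.1.2 k : ℕ) + 1 = u.1.1 → (k : ℕ) + 1 ≤ i,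
      fqsymProj K (Finsupp.single (stLeft u.1 i) 1) ⊗ₜ[K]
        fqsymProj K (Finsupp.single (stRight u.1 i) 1)
  dsucc := Finsupp.linearCombination K fun u =>
    ∑ i ∈ Finset.univ.filter fun i : Fin (u.1.1 + 1) => 1 ≤ (i : ℕ) ∧
        ∀ k : Fin u.1.1, (u.1.2 k : ℕ) + 1 = u.1.1 → (i : ℕ) < (k : ℕ) + 1,
      fqsymProj K (Finsupp.single (stLeft u.1 i) 1) ⊗ₜ[K]
        fqsymProj K (Finsupp.single (stRight u.1 i) 1)

/-- `FQSym_n`, spanned by the `F_u` with `u ∈ S_n`. -/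
def fqsymDegree (K : Type u) [Field K] (n : ℕ) : Submodule K (FQSym K) :=
  Submodule.span K {x | ∃ u : AllPerm, u.1 = n ∧ x = Finsupp.single u 1}

/-- The homogeneous part of degree `n` of the augmentation ideal of `FQSym`. -/
def fqsymPlusDegree (K : Type u) [Field K] (n : ℕ) : Submodule K (FQSymPlus K) :=
  Submodule.span K {x | ∃ u : posPerm, u.1.1 = n ∧ x = Finsupp.single u 1}

/-! ## The Hopf algebra of planar decorated rooted trees -/

/-- Planar rooted trees with vertices decorated by `D`: a root decorated by `d`, on which the
trees of a planar forest (a finite sequence of trees) are grafted from left to right. -/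
inductive PTree (D : Type v) : Type v
  | node : D → List (PTree D) → PTree D

/-- Planar rooted forests decorated by `D`, that is, monomials in planar rooted trees. -/
abbrev Forest (D : Type v) : Type v := List (PTree D)

/-- The result of an admissible cut: the pruned part `P`, the part `R` that contains the roots,
and whether the cut meets the rightmost path (see `treeCuts`). -/
structure CutResult (D : Type v) where
  P : Forest D
  R : Forest D
  right : Bool

/- The lists of the admissible cuts of a tree and of a forest, the empty and the total ones
included. A cut of a tree is the total one, or it cuts some of the edges of the tree, at most one
on each path from the root to a leaf; the latter cuts correspond to cuts of the forest of the
subtrees at the root, where the total cut of a subtree stands for the cut of the edge that joins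
it to the root. A cut of a forest is a cut of each of its trees.

The field `right` records if the last tree is totally cut, or if one of the edges is cut that lie
on the path from the root of the last tree to the rightmost leaf of the forest. -/
mutual

def treeCuts {D : Type v} : PTree D → List (CutResult D)
  | .node d F => ⟨[.node d F], [], true⟩ ::
      (forestCuts F).map fun c => ⟨c.P, [.node d c.R], c.right⟩

def forestCuts {D : Type v} : List (PTree D) → List (CutResult D)
  | [] => [⟨[], [], false⟩]
  | t :: F => (treeCuts t).flatMap fun c => (forestCuts F).map fun c' =>
      ⟨c.P ++ c'.P, c.R ++ c'.R, if F.isEmpty then c.right else c'.right⟩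

end

mutual

/-- The degree of a tree: the sum of the degrees of the decorations of its vertices. -/
def treeDegree {D : Type v} (deg : D → ℕ) : PTree D → ℕ
  | .node d F => deg d + forestDegree deg F

/-- The degree of a forest: the sum of the degrees of the decorations of its vertices. -/
def forestDegree {D : Type v} (deg : D → ℕ) : List (PTree D) → ℕ
  | [] => 0
  | t :: F => treeDegree deg t + forestDegree deg F

end

/-- The free associative algebra generated by the planar rooted trees decorated by `D`, as the
vector space with basis the planar forests `F`, which are identified with `Finsupp.single F 1`. -/
abbrev HTree (K : Type u) [Field K] (D : Type v) : Type (max v u) := Forest D →₀ K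

/-- The set of nonempty planar forests. -/
def posForest (D : Type v) : Set (Forest D) := {F | F ≠ []}

/-- The augmentation ideal of `HTree K D`, with basis the nonempty planar forests. -/
abbrev ATree (K : Type u) [Field K] (D : Type v) : Type (max v u) := posForest D →₀ K

/-- The Hopf algebra operations of `HTree K D`: the product is the concatenation of forests, the
coproduct is `F ↦ ∑_c P^c(F) ⊗ R^c(F)` over all admissible cuts. -/
def htreeHopf (K : Type u) [Field K] (D : Type v) : HopfOps K (HTree K D) where
  mul := bilin K fun F G => Finsupp.single (F ++ G) 1
  one := Finsupp.single [] 1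
  comul := Finsupp.linearCombination K fun F =>
    ((forestCuts F).map fun c => Finsupp.single c.P 1 ⊗ₜ[K] Finsupp.single c.R 1).sum
  counit := Finsupp.linearCombination K fun F => if F.isEmpty then 1 else 0

/-- The linear projection of `HTree K D` onto its augmentation ideal that kills `1`. -/
def htreeProj (K : Type u) [Field K] (D : Type v) : HTree K D →ₗ[K] ATree K D :=
  Finsupp.lsubtypeDomain (posForest D)

/-- The half product `F ≺ G` of two planar forests, `G ≠ 1`. It is the one determined by the
axioms of a dendriform algebra, by `F ≺ G + F ≻ G = FG`, and by `d ≺ X = B_d(X)` for a single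
vertex `d`, where `B_d` grafts the trees of a forest on a common root decorated by `d`.
Indeed, for a tree `t = B_d(H)` this gives `t ≺ X = B_d(HX)` and `t ≻ X = tX - B_d(HX)`, so that
`(tF) ≺ G = t ≺ (FG) + t ≻ (F ≺ G) = B_d(HFG) + t(F ≺ G) - B_d(H(F ≺ G))` if `F ≠ 1`; with
`1 ≺ G = 0` this also holds if `F = 1`. -/
def forestPrec (K : Type u) [Field K] {D : Type v} : Forest D → Forest D → HTree K D
  | [], _ => 0
  | .node d H :: F, G =>
      Finsupp.single [.node d (H ++ F ++ G)] 1
        + Finsupp.mapDomain (fun X => .node d H :: X) (forestPrec K F G)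
        - Finsupp.mapDomain (fun X => [.node d (H ++ X)]) (forestPrec K F G)

/-- The bidendriform operations of the augmentation ideal of `HTree K D`. The half coproduct
`Δ_≺(F)` is the sum of the `P^c(F) ⊗ R^c(F)` over those admissible cuts `c` of `F`, neither empty
nor total, which cut totally the last tree of `F` or cut an edge on the path from the root of the
last tree to the rightmost leaf of `F`; `Δ_≻(F)` is the sum over the other ones.
(The empty cut has `P^c(F) = 1` and the total cut has `R^c(F) = 1`, and both are killed by
`htreeProj`.) -/
def atreeBidend (K : Type u) [Field K] (D : Type v) : BidendOps K (ATree K D) where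
  prec := bilin K fun F G => htreeProj K D (forestPrec K F.1 G.1)
  succ := bilin K fun F G =>
    htreeProj K D (Finsupp.single (F.1 ++ G.1) 1 - forestPrec K F.1 G.1)
  dprec := Finsupp.linearCombination K fun F =>
    (((forestCuts F.1).filter fun c => c.right).map fun c =>
      htreeProj K D (Finsupp.single c.P 1) ⊗ₜ[K] htreeProj K D (Finsupp.single c.R 1)).sum
  dsucc := Finsupp.linearCombination K fun F =>
    (((forestCuts F.1).filter fun c => !c.right).map fun c =>
      htreeProj K D (Finsupp.single c.P 1) ⊗ₜ[K] htreeProj K D (Finsupp.single c.R 1)).sum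

/-- The tree with a single vertex, decorated by `d`, as an element of the augmentation ideal. -/
def vertex (K : Type u) [Field K] {D : Type v} (d : D) : ATree K D :=
  Finsupp.single ⟨[.node d []], List.cons_ne_nil _ _⟩ 1

theorem htreeProj_nil (K : Type u) [Field K] (D : Type v) :
    htreeProj K D (Finsupp.single [] 1) = 0 := by
  classical
  ext F
  change (Finsupp.single ([] : Forest D) (1 : K)) F.1 = 0
  exact Finsupp.single_eq_of_ne F.2

theorem htreeProj_single (K : Type u) [Field K] {D : Type v} (F : posForest D) :
    htreeProj K D (Finsupp.single F.1 1) = Finsupp.single F 1 := by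
  classical
  ext G
  change (Finsupp.single F.1 (1 : K)) G.1 = _
  simp [Finsupp.single_apply, Subtype.ext_iff]

/-- `d ≺ F = B_d(F)`. -/
theorem vertex_prec (K : Type u) [Field K] {D : Type v} (d : D) (F : posForest D) :
    (atreeBidend K D).prec (vertex K d) (Finsupp.single F 1) =
      Finsupp.single ⟨[.node d F.1], List.cons_ne_nil _ _⟩ 1 := by
  rw [← htreeProj_single K ⟨[.node d F.1], List.cons_ne_nil _ _⟩]
  simp [atreeBidend, vertex, bilin, forestPrec]

/-- `F ≺ G + F ≻ G = FG`. -/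
theorem atree_mul (K : Type u) [Field K] {D : Type v} (F G : posForest D) :
    (atreeBidend K D).mul (Finsupp.single F 1) (Finsupp.single G 1) =
      htreeProj K D (Finsupp.single (F.1 ++ G.1) 1) := by
  simp [BidendOps.mul, atreeBidend, bilin]

/-- The trees with a single vertex are totally primitive. -/
theorem vertex_primitive (K : Type u) [Field K] {D : Type v} (d : D) :
    (atreeBidend K D).dprec (vertex K d) = 0 ∧ (atreeBidend K D).dsucc (vertex K d) = 0 := by
  constructor <;>
    simp [atreeBidend, vertex, forestCuts, treeCuts, htreeProj_nil]

/-- The homogeneous part of degree `n` of `HTree K D`, for a grading `deg` of `D`. -/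
def htreeDegree (K : Type u) [Field K] {D : Type v} (deg : D → ℕ) (n : ℕ) :
    Submodule K (HTree K D) :=
  Submodule.span K {x | ∃ F : Forest D, forestDegree deg F = n ∧ x = Finsupp.single F 1}

/-- The homogeneous part of degree `n` of `ATree K D`, for a grading `deg` of `D`. -/
def atreeDegree (K : Type u) [Field K] {D : Type v} (deg : D → ℕ) (n : ℕ) :
    Submodule K (ATree K D) :=
  Submodule.span K {x | ∃ F : posForest D, forestDegree deg F.1 = n ∧ x = Finsupp.single F 1}

/-! ## The numbers `p_n` -/

/-- The formal series `R(X) = ∑_{n ≥ 1} n! X^n`. -/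
def factSeries : PowerSeries ℚ :=
  PowerSeries.mk fun n => if n = 0 then 0 else (n.factorial : ℚ)

/-- The formal series `R / (1 + R)^2 = ∑_{n ≥ 1} p_n X^n`; the series `1 + R` is invertible. -/
def pSeries : PowerSeries ℚ := factSeries * ((1 + factSeries) ^ 2)⁻¹

end Bidend

end

/-!
The isomorphism comes from a description of both sides by the totally primitive elements, those
killed by `Δ_≺` and `Δ_≻`.

*Hopf algebra and augmentation ideal together.* It is convenient to extend `≺` and `Δ_≺` to the
whole Hopf algebra by `a ≺ 1 = a`, `1 ≺ a = 0` and by adding `a ⊗ 1` to `Δ_≺(a)`. The axioms then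
lose most of their boundary terms (`UnitalOps.IsBidendriform`), and the bidendriform bialgebra is
recovered by restriction (`UnitalOps.IsBidendriform.isBidendriformBialgebra`). For `FQSym` these
axioms are checked on permutations seen as words, where the product is a sum over shuffles and the
coproduct cuts a word in two (`fqsymUnital_isBidendriform`).

*Rigidity.* In a bidendriform bialgebra, `Δ_≺` makes the whole space a comodule and the product
makes it a module; these are compatible in such a way that, as in the Hopf module theorem, the
module is free over the kernel of `Δ_≺`. In the same way that kernel, with `≻` and `Δ_≻`, is free
over the totally primitive elements. Both facts are instances of `IsRigid`. Hence a graded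
connected bidendriform bialgebra is generated by its totally primitive elements
(`eq_top_of_primTot_le`), and its Hilbert series `R` and the series `V` of its totally primitive
elements satisfy `R = (1 + R)² V` (`hilbertSeries_primTot`). For `FQSym` this gives
`V = ∑ p_n X^n`.

*The isomorphism.* By the universal property of planar trees, any family of totally primitive
elements `q d` defines a morphism from `HTree K D` that maps the vertex decorated by `d` to `q d`
(`UnitalOps.hom`): it respects the products because a tree is `d ≺ F`, and the coproducts because
the recursive description of the admissible cuts is that of the coproduct of `q d ≺ x`. Since there
are `p_n` elements of `D` of degree `n`, the `q d` can be chosen as bases of the spaces of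
homogeneous totally primitive elements of `FQSym`, and the morphism is surjective. A forest is
empty or made of a root and two forests, so the series `F` of the numbers of forests satisfies
`F = 1 + V F²`, which `1 + R` also solves: there are `n!` forests of degree `n`, and the morphism
is bijective (`exists_isIso`). The axioms for trees are transported along this isomorphism. The
antipodes exist because both sides are connected.
-/

noncomputable section

namespace Bidend

universe u v w

/-! ### Graded vector spaces with a homogeneous basis -/

section Graded

variable {K : Type u} [Field K] {X : Type v}

/-- The span of the basis elements of degree `n` of the vector space with basis `X`. -/
def gradedPart (K : Type u) [Field K] {X : Type v} (deg : X → ℕ) (n : ℕ) :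
    Submodule K (X →₀ K) :=
  Submodule.span K {x | ∃ u : X, deg u = n ∧ x = Finsupp.single u 1}

theorem gradedPart_eq_supported (deg : X → ℕ) (n : ℕ) :
    gradedPart K deg n = Finsupp.supported K K {x | deg x = n} := by
  rw [Finsupp.supported_eq_span_single, gradedPart]
  congr 1
  ext x
  simp only [Set.mem_image, Set.mem_ofPred_eq]
  constructor
  · rintro ⟨u, h, rfl⟩
    exact ⟨u, h, rfl⟩
  · rintro ⟨u, h, rfl⟩
    exact ⟨u, h, rfl⟩

theorem single_mem_gradedPart (deg : X → ℕ) (x : X) :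
    Finsupp.single x (1 : K) ∈ gradedPart K deg (deg x) :=
  Submodule.subset_span ⟨x, rfl, rfl⟩

theorem apply_eq_zero_of_mem_gradedPart {deg : X → ℕ} {n : ℕ} {f : X →₀ K}
    (hf : f ∈ gradedPart K deg n) {x : X} (hx : deg x ≠ n) : f x = 0 := by
  rw [gradedPart_eq_supported, Finsupp.mem_supported] at hf
  by_contra h
  exact hx (hf (Finsupp.mem_support_iff.2 h))

theorem iSup_gradedPart (deg : X → ℕ) : ⨆ n, gradedPart K deg n = ⊤ := by
  rw [eq_top_iff, ← Finsupp.supported_univ, Finsupp.supported_eq_span_single, Submodule.span_le]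
  rintro _ ⟨x, -, rfl⟩
  exact Submodule.mem_iSup_of_mem (deg x) (single_mem_gradedPart deg x)

theorem isInternal_gradedPart [DecidableEq ℕ] (deg : X → ℕ) :
    DirectSum.IsInternal (gradedPart K deg) := by
  refine DirectSum.isInternal_submodule_of_iSupIndep_of_iSup_eq_top ?_ (iSup_gradedPart deg)
  intro n
  have h : ⨆ (j : ℕ) (_ : j ≠ n), gradedPart K deg j ≤ Finsupp.supported K K {x | deg x ≠ n} := by
    refine iSup₂_le fun j hj => ?_
    rw [gradedPart_eq_supported]
    refine Finsupp.supported_mono ?_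
    rintro x rfl
    exact hj
  refine Disjoint.mono_right h ?_
  rw [gradedPart_eq_supported]
  refine Finsupp.disjoint_supported_supported ?_
  rw [Set.disjoint_left]
  intro x hx hx'
  exact hx' hx

theorem linearMap_ext_gradedPart {N : Type w} [AddCommMonoid N] [Module K N] {deg : X → ℕ}
    {f g : (X →₀ K) →ₗ[K] N} (h : ∀ n, ∀ x ∈ gradedPart K deg n, f x = g x) : f = g := by
  ext x
  simpa using h _ _ (single_mem_gradedPart deg x)

theorem linearMap_eqOn_gradedPart {N : Type w} [AddCommMonoid N] [Module K N] {deg : X → ℕ} {n : ℕ}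
    {f g : (X →₀ K) →ₗ[K] N}
    (h : ∀ x, deg x = n → f (Finsupp.single x 1) = g (Finsupp.single x 1)) :
    ∀ x ∈ gradedPart K deg n, f x = g x := by
  intro x hx
  refine LinearMap.eqOn_span (s := {x | ∃ u : X, deg u = n ∧ x = Finsupp.single u 1}) ?_ hx
  rintro _ ⟨u, hu, rfl⟩
  exact h u hu

/-- A transformation `Φ` of linear maps such that the values of `Φ f` in degree `n` depend only on
those of `f` in degrees less than `n` has a fixed point. -/
theorem exists_fixedPoint {N : Type w} [AddCommMonoid N] [Module K N] (deg : X → ℕ)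
    (Φ : ((X →₀ K) →ₗ[K] N) → ((X →₀ K) →ₗ[K] N))
    (hΦ : ∀ n f g, (∀ j < n, ∀ x ∈ gradedPart K deg j, f x = g x) →
      ∀ x ∈ gradedPart K deg n, Φ f x = Φ g x) :
    ∃ P, P = Φ P := by
  -- The iterates of `Φ` stabilise in each degree.
  have stable : ∀ k l n, n < k → n < l →
      ∀ x ∈ gradedPart K deg n, (Φ^[k] 0) x = (Φ^[l] 0) x := by
    intro k
    induction k with
    | zero => intro l n h; omega
    | succ k ih =>
      intro l n hk hl
      obtain ⟨l, rfl⟩ : ∃ m, l = m + 1 := ⟨l - 1, by omega⟩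
      rw [Function.iterate_succ_apply', Function.iterate_succ_apply']
      exact hΦ n _ _ fun j hj => ih l j (by omega) (by omega)
  let P : (X →₀ K) →ₗ[K] N :=
    Finsupp.linearCombination K fun x => (Φ^[deg x + 1] 0) (Finsupp.single x 1)
  have hP : ∀ n, ∀ x ∈ gradedPart K deg n, P x = (Φ^[n + 1] 0) x := by
    intro n
    apply linearMap_eqOn_gradedPart
    rintro x rfl
    simp [P]
  refine ⟨P, linearMap_ext_gradedPart (deg := deg) fun n x hx => ?_⟩
  rw [hP n x hx, Function.iterate_succ_apply']
  refine hΦ n _ _ (fun j hj y hy => ?_) x hx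
  rw [hP j y hy]
  exact stable _ _ _ (by omega) (by omega) y hy

end Graded

section TensorDegree

variable {K : Type u} [Field K] {A : Type v} [AddCommGroup A] [Module K A]
  {B : Type w} [AddCommGroup B] [Module K B]

theorem tmul_mem_tensorDegree {𝒜 : ℕ → Submodule K A} {i j n : ℕ} (hn : i + j = n) {a b : A}
    (ha : a ∈ 𝒜 i) (hb : b ∈ 𝒜 j) : a ⊗ₜ[K] b ∈ tensorDegree 𝒜 n := by
  refine Submodule.mem_iSup_of_mem (i, j) (Submodule.mem_iSup_of_mem (by simpa using hn) ?_)
  exact ⟨(⟨a, ha⟩ : 𝒜 i) ⊗ₜ (⟨b, hb⟩ : 𝒜 j), rfl⟩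

theorem tensorDegree_le {𝒜 : ℕ → Submodule K A} {n : ℕ} {S : Submodule K (A ⊗[K] A)}
    (h : ∀ i j, i + j = n → ∀ a ∈ 𝒜 i, ∀ b ∈ 𝒜 j, a ⊗ₜ[K] b ∈ S) : tensorDegree 𝒜 n ≤ S := by
  refine iSup₂_le fun p hp => ?_
  rintro _ ⟨z, rfl⟩
  induction z with
  | zero => simp
  | tmul a b => exact h p.1 p.2 (by simpa using hp) _ a.2 _ b.2
  | add x y hx hy => rw [map_add]; exact S.add_mem hx hy

theorem eqOn_tensorDegree {N : Type*} [AddCommGroup N] [Module K N] {𝒜 : ℕ → Submodule K A} {n : ℕ}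
    {f g : A ⊗[K] A →ₗ[K] N}
    (h : ∀ i j, i + j = n → ∀ a ∈ 𝒜 i, ∀ b ∈ 𝒜 j, f (a ⊗ₜ[K] b) = g (a ⊗ₜ[K] b)) :
    ∀ z ∈ tensorDegree 𝒜 n, f z = g z := by
  intro z hz
  exact (tensorDegree_le (S := LinearMap.eqLocus f g) h) hz

theorem map_mem_tensorDegree {𝒜 : ℕ → Submodule K A} {ℬ : ℕ → Submodule K B} {f : A →ₗ[K] B}
    (hf : ∀ n, ∀ a ∈ 𝒜 n, f a ∈ ℬ n) {n : ℕ} {z : A ⊗[K] A} (hz : z ∈ tensorDegree 𝒜 n) :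
    TensorProduct.map f f z ∈ tensorDegree ℬ n := by
  refine (tensorDegree_le (S := (tensorDegree ℬ n).comap (TensorProduct.map f f)) ?_) hz
  intro i j hij a ha b hb
  exact tmul_mem_tensorDegree hij (hf _ _ ha) (hf _ _ hb)

end TensorDegree

/-! ### Graded connected bialgebras and their antipode -/

section Hopf

variable {K : Type u} [Field K] {A : Type v} [AddCommGroup A] [Module K A]

/-- The operations `S` make `A` a bialgebra. -/
structure HopfOps.IsBialgebra (S : HopfOps K A) : Prop where
  one_mul : ∀ a, S.mul S.one a = a
  mul_one : ∀ a, S.mul a S.one = a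
  mul_assoc : ∀ a b c, S.mul (S.mul a b) c = S.mul a (S.mul b c)
  coassoc : ∀ a, TensorProduct.assoc K A A A (S.comul.rTensor A (S.comul a)) =
    S.comul.lTensor A (S.comul a)
  rTensor_counit_comul : ∀ a, S.counit.rTensor A (S.comul a) = 1 ⊗ₜ[K] a
  lTensor_counit_comul : ∀ a, S.counit.lTensor A (S.comul a) = a ⊗ₜ[K] 1
  comul_one : S.comul S.one = S.one ⊗ₜ[K] S.one
  comul_mul : ∀ a b, S.comul (S.mul a b) = TensorProduct.map₂ S.mul S.mul (S.comul a) (S.comul b)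
  counit_one : S.counit S.one = 1
  counit_mul : ∀ a b, S.counit (S.mul a b) = S.counit a * S.counit b

/-- The operations of `S` are homogeneous of degree `0`, and the homogeneous part of degree `0`
consists of the scalars. -/
structure HopfOps.IsConnectedGraded (S : HopfOps K A) (𝒜 : ℕ → Submodule K A) : Prop where
  one_mem : S.one ∈ 𝒜 0
  mul_mem : ∀ i j, ∀ a ∈ 𝒜 i, ∀ b ∈ 𝒜 j, S.mul a b ∈ 𝒜 (i + j)
  comul_mem : ∀ n, ∀ a ∈ 𝒜 n, S.comul a ∈ tensorDegree 𝒜 n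
  counit_eq_zero : ∀ n, n ≠ 0 → ∀ a ∈ 𝒜 n, S.counit a = 0
  eq_counit_smul : ∀ a ∈ 𝒜 0, a = S.counit a • S.one

/-- The bialgebra structure given by `S` on `A` itself, with a two-sided inverse `s` of the identity
for convolution as its antipode. -/
theorem HopfOps.IsBialgebra.isGradedHopfAlgebra {S : HopfOps K A} (hS : S.IsBialgebra)
    {𝒜 : ℕ → Submodule K A} (hint : DirectSum.IsInternal 𝒜) (hgr : S.IsConnectedGraded 𝒜)
    (s : A →ₗ[K] A)
    (hl : ∀ a, TensorProduct.lift S.mul (s.rTensor A (S.comul a)) = S.counit a • S.one)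
    (hr : ∀ a, TensorProduct.lift S.mul (s.lTensor A (S.comul a)) = S.counit a • S.one)
    (hs : ∀ n, ∀ a ∈ 𝒜 n, s a ∈ 𝒜 n) : S.IsGradedHopfAlgebra 𝒜 := by
  refine ⟨?_, hint, hgr.one_mem, hgr.mul_mem, hgr.comul_mem, hgr.counit_eq_zero⟩
  let R : Ring A :=
    { (inferInstance : AddCommGroup A) with
      mul := fun a b => S.mul a b
      one := S.one
      mul_assoc := hS.mul_assoc
      one_mul := hS.one_mul
      mul_one := hS.mul_one
      left_distrib := fun a b c => map_add _ _ _
      right_distrib := fun a b c => LinearMap.map_add₂ _ _ _ _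
      zero_mul := fun a => LinearMap.map_zero₂ _ _
      mul_zero := fun a => map_zero _ }
  have mul_def : ∀ a b : A, a * b = S.mul a b := fun _ _ => rfl
  let : Algebra K A := Algebra.ofModule
    (fun r x y => by rw [mul_def, mul_def, LinearMap.map_smul₂])
    (fun r x y => by rw [mul_def, mul_def, map_smul])
  let : Coalgebra K A :=
    { comul := S.comul
      counit := S.counit
      coassoc := LinearMap.ext hS.coassoc
      rTensor_counit_comp_comul := LinearMap.ext hS.rTensor_counit_comul
      lTensor_counit_comp_comul := LinearMap.ext hS.lTensor_counit_comul }
  have mul₂ : ∀ x y : A ⊗[K] A, x * y = TensorProduct.map₂ S.mul S.mul x y := by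
    intro x y
    induction x with
    | zero => simp
    | add x x' hx hx' => rw [add_mul, hx, hx', map_add, LinearMap.add_apply]
    | tmul a b =>
      induction y with
      | zero => simp
      | add x x' hx hx' => rw [mul_add, hx, hx', map_add]
      | tmul c d =>
        rw [Algebra.TensorProduct.tmul_mul_tmul]
        rfl
  let : Bialgebra K A := Bialgebra.mk' K A hS.counit_one (fun {a b} => hS.counit_mul a b)
    hS.comul_one (fun {a b} => (hS.comul_mul a b).trans (mul₂ _ _).symm)
  have mul'_eq : LinearMap.mul' K A = TensorProduct.lift S.mul := by
    ext a b
    rfl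
  let : HopfAlgebra K A :=
    { antipode := s
      mul_antipode_rTensor_comul := by
        ext a
        rw [mul'_eq]
        exact (hl a).trans (Algebra.smul_def _ _ |>.trans (_root_.mul_one _))
      mul_antipode_lTensor_comul := by
        ext a
        rw [mul'_eq]
        exact (hr a).trans (Algebra.smul_def _ _ |>.trans (_root_.mul_one _)) }
  refine ⟨A, R, inferInstance, LinearEquiv.refl K A, fun _ _ => rfl, rfl, fun a => ?_,
    fun _ => rfl, hs⟩
  change S.comul a = TensorProduct.map LinearMap.id LinearMap.id (S.comul a)
  rw [TensorProduct.map_id, LinearMap.id_apply]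

end Hopf

section Antipode

variable {K : Type u} [Field K] {X : Type v} {deg : X → ℕ} {S : HopfOps K (X →₀ K)}

/-- The projection `x ↦ x - ε(x) 1` onto the augmentation ideal. -/
def HopfOps.augProj {A : Type v} [AddCommGroup A] [Module K A] (S : HopfOps K A) : A →ₗ[K] A :=
  LinearMap.id - S.counit.smulRight S.one

theorem HopfOps.IsConnectedGraded.augProj_eq_zero (hgr : S.IsConnectedGraded (gradedPart K deg))
    {a : X →₀ K} (ha : a ∈ gradedPart K deg 0) : S.augProj a = 0 := by
  simp only [HopfOps.augProj, LinearMap.sub_apply, LinearMap.id_apply, LinearMap.smulRight_apply]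
  rw [sub_eq_zero]
  exact hgr.eq_counit_smul a ha

theorem HopfOps.IsConnectedGraded.augProj_mem (hgr : S.IsConnectedGraded (gradedPart K deg))
    {n : ℕ} {a : X →₀ K} (ha : a ∈ gradedPart K deg n) : S.augProj a ∈ gradedPart K deg n := by
  by_cases hn : n = 0
  · subst hn
    rw [hgr.augProj_eq_zero ha]
    exact Submodule.zero_mem _
  · simpa [HopfOps.augProj, hgr.counit_eq_zero n hn a ha] using ha

theorem HopfOps.IsConnectedGraded.counit_smul_one_mem
    (hgr : S.IsConnectedGraded (gradedPart K deg))
    {n : ℕ} {a : X →₀ K} (ha : a ∈ gradedPart K deg n) :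
    S.counit a • S.one ∈ gradedPart K deg n := by
  by_cases hn : n = 0
  · subst hn
    exact Submodule.smul_mem _ _ hgr.one_mem
  · simp [hgr.counit_eq_zero n hn a ha]

/-- The left inverse of the identity for convolution solves `s = ε 1 - s * (id - ε 1)`, which
determines it degree by degree. -/
theorem exists_left_antipode (hS : S.IsBialgebra) (hgr : S.IsConnectedGraded (gradedPart K deg)) :
    ∃ s : (X →₀ K) →ₗ[K] (X →₀ K),
      (∀ a, TensorProduct.lift S.mul (s.rTensor _ (S.comul a)) = S.counit a • S.one) ∧
      ∀ n, ∀ a ∈ gradedPart K deg n, s a ∈ gradedPart K deg n := by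
  obtain ⟨s, hs⟩ := exists_fixedPoint (K := K) deg
    (fun s : (X →₀ K) →ₗ[K] (X →₀ K) => S.counit.smulRight S.one -
      TensorProduct.lift S.mul ∘ₗ TensorProduct.map s S.augProj ∘ₗ S.comul) (by
    intro n f g hfg x hx
    simp only [LinearMap.sub_apply, LinearMap.comp_apply]
    congr 1
    refine eqOn_tensorDegree (f := TensorProduct.lift S.mul ∘ₗ TensorProduct.map f S.augProj)
      (g := TensorProduct.lift S.mul ∘ₗ TensorProduct.map g S.augProj) ?_ _ (hgr.comul_mem n x hx)
    intro i j hij a ha b hb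
    simp only [LinearMap.comp_apply, TensorProduct.map_tmul, TensorProduct.lift.tmul]
    by_cases hj : j = 0
    · subst hj
      simp [hgr.augProj_eq_zero hb]
    · rw [hfg i (by omega) a ha])
  have hs' : ∀ a, s a = S.counit a • S.one -
      TensorProduct.lift S.mul (TensorProduct.map s S.augProj (S.comul a)) :=
    fun a => LinearMap.congr_fun hs a
  refine ⟨s, fun a => ?_, ?_⟩
  · have h1 : ∀ z, TensorProduct.lift S.mul (s.rTensor _ z) =
        TensorProduct.lift S.mul (TensorProduct.map s S.augProj z) +
          TensorProduct.rid K _ (TensorProduct.map s LinearMap.id (S.counit.lTensor _ z)) := by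
      intro z
      induction z with
      | zero => simp
      | add x y hx hy => simp only [map_add, hx, hy]; abel
      | tmul x y => simp [HopfOps.augProj, hS.mul_one]
    rw [h1, hS.lTensor_counit_comul]
    simp [hs' a]
  · intro n
    induction n using Nat.strong_induction_on with
    | _ n ih =>
      intro a ha
      rw [hs']
      refine Submodule.sub_mem _ (hgr.counit_smul_one_mem ha) ?_
      refine (tensorDegree_le (S := (gradedPart K deg n).comap
        (TensorProduct.lift S.mul ∘ₗ TensorProduct.map s S.augProj)) ?_) (hgr.comul_mem n a ha)
      intro i j hij b hb c hc
      simp only [Submodule.mem_comap, LinearMap.comp_apply, TensorProduct.map_tmul,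
        TensorProduct.lift.tmul]
      by_cases hj : j = 0
      · subst hj
        simp [hgr.augProj_eq_zero hc]
      · rw [← hij]
        exact hgr.mul_mem _ _ _ (ih i (by omega) b hb) _ (hgr.augProj_mem hc)

theorem exists_right_antipode (hS : S.IsBialgebra) (hgr : S.IsConnectedGraded (gradedPart K deg)) :
    ∃ s : (X →₀ K) →ₗ[K] (X →₀ K),
      ∀ a, TensorProduct.lift S.mul (s.lTensor _ (S.comul a)) = S.counit a • S.one := by
  obtain ⟨s, hs⟩ := exists_fixedPoint (K := K) deg
    (fun s : (X →₀ K) →ₗ[K] (X →₀ K) => S.counit.smulRight S.one -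
      TensorProduct.lift S.mul ∘ₗ TensorProduct.map S.augProj s ∘ₗ S.comul) (by
    intro n f g hfg x hx
    simp only [LinearMap.sub_apply, LinearMap.comp_apply]
    congr 1
    refine eqOn_tensorDegree (f := TensorProduct.lift S.mul ∘ₗ TensorProduct.map S.augProj f)
      (g := TensorProduct.lift S.mul ∘ₗ TensorProduct.map S.augProj g) ?_ _ (hgr.comul_mem n x hx)
    intro i j hij a ha b hb
    simp only [LinearMap.comp_apply, TensorProduct.map_tmul, TensorProduct.lift.tmul]
    by_cases hi : i = 0
    · subst hi
      simp [hgr.augProj_eq_zero ha]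
    · rw [hfg j (by omega) b hb])
  have hs' : ∀ a, s a = S.counit a • S.one -
      TensorProduct.lift S.mul (TensorProduct.map S.augProj s (S.comul a)) :=
    fun a => LinearMap.congr_fun hs a
  refine ⟨s, fun a => ?_⟩
  have h1 : ∀ z, TensorProduct.lift S.mul (s.lTensor _ z) =
      TensorProduct.lift S.mul (TensorProduct.map S.augProj s z) +
        TensorProduct.lid K _ (TensorProduct.map LinearMap.id s (S.counit.rTensor _ z)) := by
    intro z
    induction z with
    | zero => simp
    | add x y hx hy => simp only [map_add, hx, hy]; abel
    | tmul x y => simp [HopfOps.augProj, hS.one_mul]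
  rw [h1, hS.rTensor_counit_comul]
  simp [hs' a]

/-- A connected graded bialgebra is a graded Hopf algebra. -/
theorem HopfOps.IsBialgebra.isGradedHopfAlgebra_of_connected (hS : S.IsBialgebra)
    (hgr : S.IsConnectedGraded (gradedPart K deg)) :
    S.IsGradedHopfAlgebra (gradedPart K deg) := by
  obtain ⟨s, hl, hs⟩ := exists_left_antipode hS hgr
  obtain ⟨t, hr⟩ := exists_right_antipode hS hgr
  -- A left and a right inverse of the identity for convolution coincide.
  have hst : s = t := by
    ext1 x
    refine LinearMap.ext_ring ?_
    set a : X →₀ K := Finsupp.single x 1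
    let G : (X →₀ K) ⊗[K] ((X →₀ K) ⊗[K] (X →₀ K)) →ₗ[K] (X →₀ K) :=
      TensorProduct.lift S.mul ∘ₗ TensorProduct.map s (TensorProduct.lift S.mul ∘ₗ t.lTensor _)
    have h1 : ∀ z, G (S.comul.lTensor _ z) =
        s (TensorProduct.rid K _ (S.counit.lTensor _ z)) := by
      intro z
      induction z with
      | zero => simp
      | add x y hx hy => simp only [map_add, hx, hy]
      | tmul x y => simp [G, hr, hS.mul_one]
    have h2' : ∀ z y, G (TensorProduct.assoc K _ _ _ (z ⊗ₜ[K] y)) =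
        S.mul (TensorProduct.lift S.mul (s.rTensor _ z)) (t y) := by
      intro z y
      induction z with
      | zero => simp
      | add x y hx hy => simp only [map_add, hx, hy, TensorProduct.add_tmul, LinearMap.add_apply]
      | tmul x y => simp [G, hS.mul_assoc]
    have h2 : ∀ z, G (TensorProduct.assoc K _ _ _ (S.comul.rTensor _ z)) =
        t (TensorProduct.lid K _ (S.counit.rTensor _ z)) := by
      intro z
      induction z with
      | zero => simp
      | add x y hx hy => simp only [map_add, hx, hy]
      | tmul x y => simp [h2', hl, hS.one_mul]
    have h3 := h1 (S.comul a)
    rw [← hS.coassoc, h2, hS.rTensor_counit_comul, hS.lTensor_counit_comul] at h3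
    simpa using h3.symm
  subst hst
  exact hS.isGradedHopfAlgebra (isInternal_gradedPart deg) hgr s hl hr hs

end Antipode

/-! ### Bidendriform bialgebras with a unit -/

section Unital

variable {K : Type u} [Field K] {H : Type v} [AddCommGroup H] [Module K H]
  {A : Type w} [AddCommGroup A] [Module K A]

/-- Hopf algebra operations together with extensions of `≺` and `Δ_≺` from the augmentation ideal
to the whole algebra. The extensions of `≻` and `Δ_≻` are the differences `mul - prec` and
`comul - dprec`. -/
structure UnitalOps (K : Type u) [Field K] (H : Type v) [AddCommGroup H] [Module K H] extends
    HopfOps K H where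
  prec : H →ₗ[K] H →ₗ[K] H
  dprec : H →ₗ[K] H ⊗[K] H

/-- The axioms of a bidendriform bialgebra in terms of the extensions
`a ≺ 1 = a`, `1 ≺ a = 1 ≺ 1 = 0`, `1 ≻ 1 = 1` and `Δ_≺(a) + a ⊗ 1`, `Δ_≻(a) + 1 ⊗ a`,
where `a` is in the augmentation ideal. In this form no axiom has boundary terms, except for the
terms `(a ≺ b) ⊗ 1`. -/
structure UnitalOps.IsBidendriform (T : UnitalOps K H) : Prop extends
    T.toHopfOps.IsBialgebra where
  prec_one : ∀ a, T.prec a T.one = a - T.counit a • T.one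
  one_prec : ∀ a, T.prec T.one a = 0
  counit_prec : ∀ a b, T.counit (T.prec a b) = 0
  prec_prec : ∀ a b c, T.prec (T.prec a b) c = T.prec a (T.mul b c)
  mul_prec : ∀ a b c, T.prec (T.mul a b) c =
    T.prec a (T.mul b c) - T.prec a (T.prec b c) + T.mul a (T.prec b c)
  dprec_one : T.dprec T.one = 0
  rTensor_counit_dprec : ∀ a, T.counit.rTensor H (T.dprec a) = 0
  lTensor_counit_dprec : ∀ a,
    T.counit.lTensor H (T.dprec a) = (a - T.counit a • T.one) ⊗ₜ[K] 1
  dprec_dprec : ∀ a, TensorProduct.assoc K H H H (T.dprec.rTensor H (T.dprec a)) =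
    T.comul.lTensor H (T.dprec a)
  dsucc_dprec : ∀ a, TensorProduct.assoc K H H H ((T.comul - T.dprec).rTensor H (T.dprec a)) =
    T.dprec.lTensor H (T.comul a - T.dprec a)
  dprec_mul : ∀ a b, T.counit b = 0 →
    T.dprec (T.mul a b) = TensorProduct.map₂ T.mul T.mul (T.comul a) (T.dprec b)
  comul_prec : ∀ a b, T.comul (T.prec a b) =
    TensorProduct.map₂ T.mul T.prec (T.comul a) (T.comul b) + T.prec a b ⊗ₜ[K] T.one
  dprec_prec : ∀ a b, T.counit b = 0 → T.dprec (T.prec a b) =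
    TensorProduct.map₂ T.mul T.prec (T.comul a) (T.dprec b) + T.prec a b ⊗ₜ[K] T.one

/-- The maps `i` and `p` are the inclusion of the augmentation ideal and the projection onto it
along the unit. -/
structure HopfOps.IsAugmentation (S : HopfOps K H) (i : A →ₗ[K] H) (p : H →ₗ[K] A) : Prop where
  proj_incl : ∀ a, p (i a) = a
  incl_proj : ∀ x, i (p x) = x - S.counit x • S.one
  counit_incl : ∀ a, S.counit (i a) = 0
  proj_one : p S.one = 0

/-- The bidendriform operations on the augmentation ideal. -/
def UnitalOps.restrict (T : UnitalOps K H) (i : A →ₗ[K] H) (p : H →ₗ[K] A) : BidendOps K A where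
  prec := (T.prec.compl₁₂ i i).compr₂ p
  succ := ((T.mul - T.prec).compl₁₂ i i).compr₂ p
  dprec := TensorProduct.map p p ∘ₗ T.dprec ∘ₗ i
  dsucc := TensorProduct.map p p ∘ₗ (T.comul - T.dprec) ∘ₗ i

variable {T : UnitalOps K H} {i : A →ₗ[K] H} {p : H →ₗ[K] A}

theorem UnitalOps.restrict_mul (a b : A) :
    (T.restrict i p).mul a b = p (T.mul (i a) (i b)) := by
  simp [BidendOps.mul, UnitalOps.restrict]

theorem UnitalOps.restrict_dred (a : A) :
    (T.restrict i p).dred a = TensorProduct.map p p (T.comul (i a)) := by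
  simp [BidendOps.dred, UnitalOps.restrict]

/-- The projection `(id - ε 1) ⊗ (id - ε 1)` onto the tensor square of the augmentation ideal. -/
theorem HopfOps.IsAugmentation.map_incl_map_proj {S : HopfOps K H} (h : S.IsAugmentation i p)
    (z : H ⊗[K] H) : TensorProduct.map i i (TensorProduct.map p p z) =
      z - S.one ⊗ₜ[K] TensorProduct.lid K H (S.counit.rTensor H z)
        - TensorProduct.rid K H (S.counit.lTensor H z) ⊗ₜ[K] S.one
        + TensorProduct.lid K K (TensorProduct.map S.counit S.counit z) • (S.one ⊗ₜ[K] S.one) := by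
  induction z with
  | zero => simp
  | add x y hx hy =>
    simp only [map_add, hx, hy, TensorProduct.tmul_add, TensorProduct.add_tmul, add_smul]
    abel
  | tmul x y =>
    simp [h.incl_proj, TensorProduct.sub_tmul, TensorProduct.tmul_sub, TensorProduct.smul_tmul,
      TensorProduct.tmul_smul]
    simp only [smul_sub, smul_smul, mul_comm]
    abel

theorem HopfOps.counit_counit_eq (S : HopfOps K H) (z : H ⊗[K] H) :
    TensorProduct.lid K K (TensorProduct.map S.counit S.counit z) =
      S.counit (TensorProduct.lid K H (S.counit.rTensor H z)) := by
  induction z with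
  | zero => simp
  | add x y hx hy => simp only [map_add, hx, hy]
  | tmul x y => simp

theorem UnitalOps.IsBidendriform.comul_incl (hT : T.IsBidendriform)
    (h : T.toHopfOps.IsAugmentation i p) (a : A) :
    T.comul (i a) = TensorProduct.map i i ((T.restrict i p).dred a) + i a ⊗ₜ[K] T.one
      + T.one ⊗ₜ[K] i a := by
  rw [UnitalOps.restrict_dred, h.map_incl_map_proj, HopfOps.counit_counit_eq,
    hT.rTensor_counit_comul, hT.lTensor_counit_comul]
  simp [h.counit_incl]

theorem UnitalOps.IsBidendriform.dprec_incl (hT : T.IsBidendriform)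
    (h : T.toHopfOps.IsAugmentation i p) (a : A) :
    T.dprec (i a) = TensorProduct.map i i ((T.restrict i p).dprec a) + i a ⊗ₜ[K] T.one := by
  simp only [UnitalOps.restrict, LinearMap.comp_apply]
  rw [h.map_incl_map_proj, HopfOps.counit_counit_eq,
    hT.rTensor_counit_dprec, hT.lTensor_counit_dprec]
  simp [h.counit_incl]

theorem UnitalOps.IsBidendriform.dsucc_incl (hT : T.IsBidendriform)
    (h : T.toHopfOps.IsAugmentation i p) (a : A) :
    T.comul (i a) - T.dprec (i a) =
      TensorProduct.map i i ((T.restrict i p).dsucc a) + T.one ⊗ₜ[K] i a := by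
  rw [hT.comul_incl h, hT.dprec_incl h]
  simp only [BidendOps.dred, LinearMap.add_apply, map_add]
  abel

theorem UnitalOps.IsBidendriform.incl_mul (hT : T.IsBidendriform)
    (h : T.toHopfOps.IsAugmentation i p) (a b : A) :
    i ((T.restrict i p).mul a b) = T.mul (i a) (i b) := by
  simp [UnitalOps.restrict_mul, h.incl_proj, hT.counit_mul, h.counit_incl]

theorem UnitalOps.IsBidendriform.incl_prec (hT : T.IsBidendriform)
    (h : T.toHopfOps.IsAugmentation i p) (a b : A) :
    i ((T.restrict i p).prec a b) = T.prec (i a) (i b) := by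
  simp [UnitalOps.restrict, h.incl_proj, hT.counit_prec]

theorem UnitalOps.IsBidendriform.incl_succ (hT : T.IsBidendriform)
    (h : T.toHopfOps.IsAugmentation i p) (a b : A) :
    i ((T.restrict i p).succ a b) = T.mul (i a) (i b) - T.prec (i a) (i b) := by
  rw [← hT.incl_mul h, ← hT.incl_prec h, ← map_sub]
  simp [BidendOps.mul]

theorem UnitalOps.IsBidendriform.isDendriformAlgebra (hT : T.IsBidendriform)
    (h : T.toHopfOps.IsAugmentation i p) : (T.restrict i p).IsDendriformAlgebra := by
  have inj : Function.Injective i := fun a b hab => by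
    rw [← h.proj_incl a, hab, h.proj_incl]
  constructor
  · intro a b c
    apply inj
    simp only [hT.incl_prec h, hT.incl_succ h, map_add, hT.prec_prec, map_sub]
    abel
  · intro a b c
    apply inj
    simp only [hT.incl_prec h, hT.incl_succ h, LinearMap.map_sub₂, hT.prec_prec, hT.mul_prec]
    abel
  · intro a b c
    apply inj
    have hm : (T.restrict i p).prec a b + (T.restrict i p).succ a b =
      (T.restrict i p).mul a b := rfl
    rw [hm]
    simp only [hT.incl_mul h, hT.incl_succ h, map_sub, hT.mul_assoc, hT.mul_prec]
    abel

theorem HopfOps.IsAugmentation.rTensor_map {S : HopfOps K H} (h : S.IsAugmentation i p)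
    {f : H →ₗ[K] H ⊗[K] H} {g : A →ₗ[K] A ⊗[K] A}
    (hf : TensorProduct.map p p (f S.one) = 0)
    (hg : ∀ a, g a = TensorProduct.map p p (f (i a))) (z : H ⊗[K] H) :
    TensorProduct.assoc K A A A (g.rTensor A (TensorProduct.map p p z)) =
      TensorProduct.map p (TensorProduct.map p p)
        (TensorProduct.assoc K H H H (f.rTensor H z)) := by
  have nat : ∀ w : (H ⊗[K] H) ⊗[K] H, TensorProduct.map p (TensorProduct.map p p)
      (TensorProduct.assoc K H H H w) =
      TensorProduct.assoc K A A A (TensorProduct.map (TensorProduct.map p p) p w) := by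
    intro w
    exact (LinearMap.congr_fun (TensorProduct.map_map_comp_assoc_eq p p p) w)
  rw [nat]
  induction z with
  | zero => simp
  | add x y hx hy => simp only [map_add, hx, hy]
  | tmul x y => simp [hg, h.incl_proj, hf]

theorem HopfOps.IsAugmentation.lTensor_map {S : HopfOps K H} (h : S.IsAugmentation i p)
    {f : H →ₗ[K] H ⊗[K] H} {g : A →ₗ[K] A ⊗[K] A}
    (hf : TensorProduct.map p p (f S.one) = 0)
    (hg : ∀ a, g a = TensorProduct.map p p (f (i a))) (z : H ⊗[K] H) :
    g.lTensor A (TensorProduct.map p p z) =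
      TensorProduct.map p (TensorProduct.map p p) (f.lTensor H z) := by
  induction z with
  | zero => simp
  | add x y hx hy => simp only [map_add, hx, hy]
  | tmul x y => simp [hg, h.incl_proj, hf]

theorem UnitalOps.IsBidendriform.isDendriformCoalgebra (hT : T.IsBidendriform)
    (h : T.toHopfOps.IsAugmentation i p) : (T.restrict i p).IsDendriformCoalgebra := by
  have h1 : TensorProduct.map p p (T.comul T.one) = 0 := by simp [hT.comul_one, h.proj_one]
  have h2 : TensorProduct.map p p (T.dprec T.one) = 0 := by simp [hT.dprec_one]
  have h3 : TensorProduct.map p p ((T.comul - T.dprec) T.one) = 0 := by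
    rw [LinearMap.sub_apply, map_sub, h1, h2, sub_zero]
  have g1 : ∀ a, ((T.restrict i p).dprec + (T.restrict i p).dsucc) a =
      TensorProduct.map p p (T.comul (i a)) := UnitalOps.restrict_dred
  have g2 : ∀ a, (T.restrict i p).dprec a = TensorProduct.map p p (T.dprec (i a)) :=
    fun _ => rfl
  have g3 : ∀ a, (T.restrict i p).dsucc a = TensorProduct.map p p ((T.comul - T.dprec) (i a)) :=
    fun _ => rfl
  constructor
  · intro a
    rw [g2 a, h.rTensor_map h2 g2, h.lTensor_map h1 g1, hT.dprec_dprec]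
  · intro a
    rw [g2 a, g3 a, h.rTensor_map h3 g3, h.lTensor_map h2 g2, hT.dsucc_dprec]
    rfl
  · intro a
    rw [g3 a, h.rTensor_map h1 g1, h.lTensor_map h3 g3]
    congr 1
    have e1 := hT.dprec_dprec (i a)
    have e2 := hT.dsucc_dprec (i a)
    have e3 := hT.coassoc (i a)
    simp only [LinearMap.sub_apply, LinearMap.rTensor_sub, LinearMap.lTensor_sub, map_sub] at *
    rw [e1] at e2
    have e4 := sub_eq_zero.2 e2
    rw [← sub_eq_zero, ← neg_eq_zero, ← e4, e3]
    abel

/-- The boundary terms of the axioms of a bidendriform bialgebra come from the terms with a unit in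
the expressions of the coproducts of elements of the augmentation ideal. -/
theorem UnitalOps.IsBidendriform.isBidendriformBialgebra (hT : T.IsBidendriform)
    (h : T.toHopfOps.IsAugmentation i p) : (T.restrict i p).IsBidendriformBialgebra := by
  set S := T.restrict i p with hS
  have hm : ∀ a b, p (T.mul (i a) (i b)) = S.mul a b := fun a b => (T.restrict_mul a b).symm
  -- The values of `mul ⊗ f` on the terms of `Δ(a)`, `Δ_≺(b)` and `Δ_≻(b)`.
  have t1 : ∀ (f : H →ₗ[K] H →ₗ[K] H) (X Y : A ⊗[K] A), TensorProduct.map p p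
      (TensorProduct.map₂ T.mul f (TensorProduct.map i i X) (TensorProduct.map i i Y)) =
      TensorProduct.map₂ S.mul ((f.compl₁₂ i i).compr₂ p) X Y := by
    intro f X Y
    induction X with
    | zero => simp
    | add x y hx hy => simp only [map_add, LinearMap.add_apply, hx, hy]
    | tmul a b =>
      induction Y with
      | zero => simp
      | add x y hx hy => simp only [map_add, hx, hy]
      | tmul c d => simp [TensorProduct.map₂_apply_tmul, hm]
  have t2 : ∀ (f : H →ₗ[K] H →ₗ[K] H) (X : A ⊗[K] A) (x y : H), TensorProduct.map p p
      (TensorProduct.map₂ T.mul f (TensorProduct.map i i X) (x ⊗ₜ[K] y)) =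
      TensorProduct.map (p ∘ₗ T.mul.flip x ∘ₗ i) (p ∘ₗ f.flip y ∘ₗ i) X := by
    intro f X x y
    induction X with
    | zero => simp
    | add x y hx hy => simp only [map_add, LinearMap.add_apply, hx, hy]
    | tmul c d => simp [TensorProduct.map₂_apply_tmul]
  have t3 : ∀ (f : H →ₗ[K] H →ₗ[K] H) (X : A ⊗[K] A) (x y : H), TensorProduct.map p p
      (TensorProduct.map₂ T.mul f (x ⊗ₜ[K] y) (TensorProduct.map i i X)) =
      TensorProduct.map (p ∘ₗ T.mul x ∘ₗ i) (p ∘ₗ f y ∘ₗ i) X := by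
    intro f X x y
    induction X with
    | zero => simp
    | add x y hx hy => simp only [map_add, hx, hy]
    | tmul c d => simp [TensorProduct.map₂_apply_tmul]
  have t4 : ∀ (f : H →ₗ[K] H →ₗ[K] H) (x y x' y' : H), TensorProduct.map p p
      (TensorProduct.map₂ T.mul f (x ⊗ₜ[K] y) (x' ⊗ₜ[K] y')) =
      p (T.mul x x') ⊗ₜ[K] p (f y y') := by
    intro f x y x' y'
    simp [TensorProduct.map₂_apply_tmul]
  have k1 : p ∘ₗ T.mul T.one ∘ₗ i = LinearMap.id := by
    ext a
    simp [hT.one_mul, h.proj_incl]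
  have k2 : p ∘ₗ T.mul.flip T.one ∘ₗ i = LinearMap.id := by
    ext a
    simp [hT.mul_one, h.proj_incl]
  have k3 : p ∘ₗ T.prec T.one ∘ₗ i = 0 := by
    ext a
    simp [hT.one_prec]
  have k4 : p ∘ₗ T.prec.flip T.one ∘ₗ i = LinearMap.id := by
    ext a
    simp [hT.prec_one, h.proj_incl, h.counit_incl]
  have k5 : p ∘ₗ (T.mul - T.prec) T.one ∘ₗ i = LinearMap.id := by
    ext a
    simp [hT.one_mul, hT.one_prec, h.proj_incl]
  have k6 : p ∘ₗ (T.mul - T.prec).flip T.one ∘ₗ i = 0 := by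
    ext a
    simp [hT.mul_one, hT.prec_one, h.counit_incl]
  have k7 : ∀ a, p ∘ₗ T.mul (i a) ∘ₗ i = S.mul a := fun a => by
    ext b
    simp [hm]
  have k8 : ∀ a, p ∘ₗ T.mul.flip (i a) ∘ₗ i = S.mul.flip a := fun a => by
    ext b
    simp [hm]
  have k9 : ∀ a, p ∘ₗ T.prec (i a) ∘ₗ i = S.prec a := fun a => rfl
  have k10 : ∀ a, p ∘ₗ T.prec.flip (i a) ∘ₗ i = S.prec.flip a := fun a => rfl
  have k11 : ∀ a, p ∘ₗ (T.mul - T.prec) (i a) ∘ₗ i = S.succ a := fun a => rfl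
  have k12 : ∀ a, p ∘ₗ (T.mul - T.prec).flip (i a) ∘ₗ i = S.succ.flip a := fun a => rfl
  have k13 : (T.prec.compl₁₂ i i).compr₂ p = S.prec := rfl
  have k14 : ((T.mul - T.prec).compl₁₂ i i).compr₂ p = S.succ := rfl
  have m₂sub : ∀ X Y, TensorProduct.map₂ T.mul (T.mul - T.prec) X Y =
      TensorProduct.map₂ T.mul T.mul X Y - TensorProduct.map₂ T.mul T.prec X Y := by
    intro X Y
    induction X with
    | zero => simp
    | add x y hx hy => simp only [map_add, LinearMap.add_apply, hx, hy]; abel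
    | tmul a b =>
      induction Y with
      | zero => simp
      | add x y hx hy => simp only [map_add, hx, hy]; abel
      | tmul c d => simp [TensorProduct.map₂_apply_tmul, TensorProduct.tmul_sub]
  have d1 : ∀ a b, S.dprec (S.prec a b) = TensorProduct.map p p
      (TensorProduct.map₂ T.mul T.prec (T.comul (i a)) (T.dprec (i b))) := by
    intro a b
    change TensorProduct.map p p (T.dprec (i (S.prec a b))) = _
    rw [hT.incl_prec h, hT.dprec_prec _ _ (h.counit_incl b)]
    simp [h.proj_one]
  have d2 : ∀ a b, S.dprec (S.succ a b) = TensorProduct.map p p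
      (TensorProduct.map₂ T.mul (T.mul - T.prec) (T.comul (i a)) (T.dprec (i b))) := by
    intro a b
    change TensorProduct.map p p (T.dprec (i (S.succ a b))) = _
    rw [hT.incl_succ h, map_sub, hT.dprec_prec _ _ (h.counit_incl b),
      hT.dprec_mul _ _ (h.counit_incl b), m₂sub]
    simp [h.proj_one]
  have d3 : ∀ a b, S.dsucc (S.prec a b) = TensorProduct.map p p
      (TensorProduct.map₂ T.mul T.prec (T.comul (i a)) (T.comul (i b) - T.dprec (i b))) := by
    intro a b
    change TensorProduct.map p p ((T.comul - T.dprec) (i (S.prec a b))) = _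
    rw [hT.incl_prec h, LinearMap.sub_apply, hT.dprec_prec _ _ (h.counit_incl b), hT.comul_prec]
    simp
  have d4 : ∀ a b, S.dsucc (S.succ a b) = TensorProduct.map p p
      (TensorProduct.map₂ T.mul (T.mul - T.prec) (T.comul (i a))
        (T.comul (i b) - T.dprec (i b))) := by
    intro a b
    change TensorProduct.map p p ((T.comul - T.dprec) (i (S.succ a b))) = _
    rw [hT.incl_succ h, LinearMap.sub_apply, map_sub T.comul, map_sub T.dprec,
      hT.dprec_prec _ _ (h.counit_incl b), hT.comul_prec, hT.comul_mul,
      hT.dprec_mul _ _ (h.counit_incl b), m₂sub]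
    simp only [map_sub, map_add]
    abel
  refine ⟨hT.isDendriformAlgebra h, hT.isDendriformCoalgebra h, ?_, ?_, ?_, ?_⟩
  · intro a b
    rw [d4, hT.comul_incl h, hT.dsucc_incl h, ← hS]
    simp only [map_add, LinearMap.add_apply, t1, t2, t3, t4, k1, k2, k5, k7, k11, k12, k14]
    simp [hT.one_mul, hT.mul_one, hT.one_prec, h.proj_one, h.proj_incl, LinearMap.lTensor,
      LinearMap.rTensor]
    abel
  · intro a b
    rw [d3, hT.comul_incl h, hT.dsucc_incl h, ← hS]
    simp only [map_add, LinearMap.add_apply, t1, t2, t3, t4, k1, k2, k3, k7, k9, k10, k13]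
    simp [hT.one_mul, hT.mul_one, hT.one_prec, h.proj_one, LinearMap.lTensor]
    abel
  · intro a b
    rw [d2, hT.comul_incl h, hT.dprec_incl h, ← hS]
    simp only [map_add, LinearMap.add_apply, t1, t2, t3, t4, k1, k5, k6, k7, k8, k11, k14]
    simp [hT.one_mul, hT.mul_one, hT.one_prec, hT.prec_one, h.counit_incl,
      h.proj_one, LinearMap.lTensor, LinearMap.rTensor]
  · intro a b
    rw [d1, hT.comul_incl h, hT.dprec_incl h, ← hS]
    simp only [map_add, LinearMap.add_apply, t1, t2, t3, t4, k1, k3, k4, k7, k8, k9, k13]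
    simp [hT.one_mul, hT.one_prec, hT.prec_one, h.counit_incl,
      h.proj_incl, LinearMap.lTensor, LinearMap.rTensor]
    abel

end Unital

/-! ### The shuffle algebra of words -/

section Words

theorem bilin_single (K : Type u) [Field K] {X : Type v} {M : Type w} [AddCommGroup M] [Module K M]
    (f : X → X → M) (x y : X) :
    bilin K f (Finsupp.single x 1) (Finsupp.single y 1) = f x y := by
  simp [bilin]

variable (K : Type u) [Field K]

/-- The vector space with basis the words on the alphabet `ℕ`. A word is represented by the list
of its letters read from right to left, so that the head of the list is the last letter. -/
abbrev Words : Type u := List ℕ →₀ K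

/-- The sum of the shuffles of two words. -/
def shuffleWord : List ℕ → List ℕ → Words K
  | [], b => Finsupp.single b 1
  | x :: a, [] => Finsupp.single (x :: a) 1
  | x :: a, y :: b => Finsupp.mapDomain (List.cons x) (shuffleWord a (y :: b)) +
      Finsupp.mapDomain (List.cons y) (shuffleWord (x :: a) b)

/-- The sum of the shuffles of two words that end with the last letter of the first word. -/
def halfShuffleWord : List ℕ → List ℕ → Words K
  | [], _ => 0
  | x :: a, b => Finsupp.mapDomain (List.cons x) (shuffleWord K a b)

/-- The ways to cut a word into two, as pairs `(left part, right part)`. -/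
def splits : List ℕ → List (List ℕ × List ℕ)
  | [] => [([], [])]
  | x :: a => (x :: a, []) :: (splits a).map fun p => (p.1, x :: p.2)

/-- The shuffle product. -/
def wmul : Words K →ₗ[K] Words K →ₗ[K] Words K := bilin K (shuffleWord K)

/-- The half shuffle product. -/
def wprec : Words K →ₗ[K] Words K →ₗ[K] Words K := bilin K (halfShuffleWord K)

/-- The deconcatenation coproduct. -/
def wcomul : Words K →ₗ[K] Words K ⊗[K] Words K :=
  Finsupp.linearCombination K fun a =>
    ((splits a).map fun p => Finsupp.single p.1 1 ⊗ₜ[K] Finsupp.single p.2 1).sum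

/-- The operator that appends the letter `x` at the end of each word. -/
def wcons (x : ℕ) : Words K →ₗ[K] Words K := Finsupp.lmapDomain K K (List.cons x)

open scoped Classical in
/-- The projection onto the span of the words that contain the letter `M`. -/
def wmem (M : ℕ) : Words K →ₗ[K] Words K :=
  Finsupp.linearCombination K fun a => if M ∈ a then Finsupp.single a 1 else 0

variable {K}

/-- A word as a basis vector of `Words K`. -/
local notation "𝐞" a:max => (Finsupp.single a (1 : K) : Words K)

theorem wcons_single (x : ℕ) (a : List ℕ) : wcons K x (𝐞 a) = (𝐞 (x :: a)) := by
  simp [wcons]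

theorem eq_of_eqOn_basis {X : Type v} {M : Type w} [AddCommMonoid M] [Module K M]
    {f g : (X →₀ K) →ₗ[K] M} (h : ∀ a, f (Finsupp.single a 1) = g (Finsupp.single a 1))
    (x : X →₀ K) : f x = g x := by
  have : f = g := by
    ext a
    exact h a
  rw [this]

theorem words_induction₂ {M : Type w} [AddCommMonoid M] [Module K M]
    {f g : Words K →ₗ[K] Words K →ₗ[K] M} (h : ∀ a b, f (𝐞 a) (𝐞 b) = g (𝐞 a) (𝐞 b))
    (x y : Words K) : f x y = g x y := by
  have : f = g := by
    ext a b
    exact h a b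
  rw [this]

theorem shuffleWord_nil_right (a : List ℕ) : shuffleWord K a [] = (𝐞 a) := by
  cases a <;> simp [shuffleWord]

theorem nil_wmul (z : Words K) : wmul K (𝐞 []) z = z := by
  have : wmul K (𝐞 []) = LinearMap.id := by
    ext1 b
    apply LinearMap.ext_ring
    simp [wmul, bilin_single, shuffleWord]
  rw [this, LinearMap.id_apply]

theorem wmul_nil (z : Words K) : wmul K z (𝐞 []) = z := by
  have : (wmul K).flip (𝐞 []) = LinearMap.id := by
    ext1 b
    apply LinearMap.ext_ring
    simp [wmul, bilin_single, shuffleWord_nil_right]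
  exact LinearMap.congr_fun this z

theorem nil_wprec (z : Words K) : wprec K (𝐞 []) z = 0 := by
  have : wprec K (𝐞 []) = 0 := by
    ext1 b
    apply LinearMap.ext_ring
    simp [wprec, bilin_single, halfShuffleWord]
  rw [this, LinearMap.zero_apply]

theorem wmul_wcons_wcons (x y : ℕ) (z z' : Words K) :
    wmul K (wcons K x z) (wcons K y z') =
      wcons K x (wmul K z (wcons K y z')) + wcons K y (wmul K (wcons K x z) z') := by
  refine words_induction₂ (f := (wmul K).compl₁₂ (wcons K x) (wcons K y))
    (g := ((wmul K).compl₁₂ LinearMap.id (wcons K y)).compr₂ (wcons K x) +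
      ((wmul K).compl₁₂ (wcons K x) LinearMap.id).compr₂ (wcons K y)) (fun a b => ?_) z z'
  simp only [LinearMap.compl₁₂_apply, LinearMap.add_apply, LinearMap.compr₂_apply, wcons_single,
    wmul, bilin_single, LinearMap.id_apply]
  rw [shuffleWord.eq_def]
  rfl

theorem wprec_wcons (x : ℕ) (z z' : Words K) :
    wprec K (wcons K x z) z' = wcons K x (wmul K z z') := by
  refine words_induction₂ (f := (wprec K).compl₁₂ (wcons K x) LinearMap.id)
    (g := (wmul K).compr₂ (wcons K x)) (fun a b => ?_) z z'
  simp only [LinearMap.compl₁₂_apply, LinearMap.compr₂_apply, wcons_single,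
    wmul, wprec, bilin_single, LinearMap.id_apply]
  rfl

theorem wmul_assoc (z z' z'' : Words K) :
    wmul K (wmul K z z') z'' = wmul K z (wmul K z' z'') := by
  have main : ∀ n, ∀ a b c : List ℕ, a.length + b.length + c.length = n →
      wmul K (wmul K (𝐞 a) (𝐞 b)) (𝐞 c) = wmul K (𝐞 a) (wmul K (𝐞 b) (𝐞 c)) := by
    intro n
    induction n with
    | zero =>
      intro a b c h
      obtain rfl : a = [] := List.length_eq_zero_iff.1 (by omega)
      rw [nil_wmul, nil_wmul]
    | succ n ih =>
      intro a b c h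
      rcases a with _ | ⟨x, a⟩
      · rw [nil_wmul, nil_wmul]
      rcases b with _ | ⟨y, b⟩
      · rw [nil_wmul, wmul_nil]
      rcases c with _ | ⟨t, c⟩
      · rw [wmul_nil, wmul_nil]
      simp only [List.length_cons] at h
      have h1 := ih a (y :: b) (t :: c) (by simp; omega)
      have h2 := ih (x :: a) b (t :: c) (by simp; omega)
      have h3 := ih (x :: a) (y :: b) c (by simp; omega)
      simp only [← wcons_single] at h1 h2 h3 ⊢
      rw [wmul_wcons_wcons x y, map_add, LinearMap.add_apply] at h3 ⊢
      rw [wmul_wcons_wcons x t, wmul_wcons_wcons y t, h1, h2, wmul_wcons_wcons y t, map_add,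
        map_add, map_add, wmul_wcons_wcons x y, wmul_wcons_wcons x t, ← h3, map_add]
      abel
  refine eq_of_eqOn_basis (f := (wmul K).flip z'' ∘ₗ (wmul K).flip z')
    (g := (wmul K).flip (wmul K z' z'')) (fun a => ?_) z
  refine eq_of_eqOn_basis (f := (wmul K).flip z'' ∘ₗ wmul K (𝐞 a))
    (g := wmul K (𝐞 a) ∘ₗ (wmul K).flip z'') (fun b => ?_) z'
  exact eq_of_eqOn_basis (f := wmul K (wmul K (𝐞 a) (𝐞 b)))
    (g := wmul K (𝐞 a) ∘ₗ wmul K (𝐞 b)) (fun c => main _ a b c rfl) z''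

theorem wprec_wprec (z z' z'' : Words K) :
    wprec K (wprec K z z') z'' = wprec K z (wmul K z' z'') := by
  refine eq_of_eqOn_basis (f := (wprec K).flip z'' ∘ₗ (wprec K).flip z')
    (g := (wprec K).flip (wmul K z' z'')) (fun a => ?_) z
  simp only [LinearMap.comp_apply, LinearMap.flip_apply]
  rcases a with _ | ⟨x, a⟩
  · simp [nil_wprec]
  · rw [← wcons_single, wprec_wcons, wprec_wcons, wprec_wcons, wmul_assoc]

theorem wprec_nil (z : Words K) :
    wprec K z (𝐞 []) = z - Finsupp.lapply (R := K) [] z • (𝐞 []) := by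
  refine eq_of_eqOn_basis (f := (wprec K).flip (𝐞 []))
    (g := LinearMap.id - (Finsupp.lapply (R := K) []).smulRight (𝐞 [])) (fun a => ?_) z
  rcases a with _ | ⟨x, a⟩
  · simp [nil_wprec]
  · simp only [LinearMap.flip_apply]
    rw [← wcons_single, wprec_wcons, wmul_nil, wcons_single]
    simp

/-- The axioms for `(a ≻ b) ≺ c` and `(a ≺ b) ≺ c` of a dendriform algebra, added up. -/
theorem wmul_wprec (z z' z'' : Words K) : wprec K (wmul K z z') z'' =
    wprec K z (wmul K z' z'') - wprec K z (wprec K z' z'') + wmul K z (wprec K z' z'') := by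
  refine eq_of_eqOn_basis (f := (wprec K).flip z'' ∘ₗ (wmul K).flip z')
    (g := (wprec K).flip (wmul K z' z'') - (wprec K).flip (wprec K z' z'')
      + (wmul K).flip (wprec K z' z'')) (fun a => ?_) z
  refine eq_of_eqOn_basis (f := (wprec K).flip z'' ∘ₗ wmul K (𝐞 a))
    (g := wprec K (𝐞 a) ∘ₗ (wmul K).flip z'' - wprec K (𝐞 a) ∘ₗ (wprec K).flip z''
      + wmul K (𝐞 a) ∘ₗ (wprec K).flip z'') (fun b => ?_) z'
  simp only [LinearMap.comp_apply, LinearMap.flip_apply, LinearMap.sub_apply, LinearMap.add_apply]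
  rcases a with _ | ⟨x, a⟩
  · simp [nil_wprec, nil_wmul]
  rcases b with _ | ⟨y, b⟩
  · simp [nil_wprec, nil_wmul, wmul_nil]
  rw [← wcons_single, ← wcons_single, wmul_wcons_wcons, map_add, LinearMap.add_apply,
    wprec_wcons, wprec_wcons, wprec_wcons, wprec_wcons, wprec_wcons, wmul_wcons_wcons,
    wmul_assoc, wmul_assoc]
  abel

/-! ### Deconcatenation of words -/

theorem wcomul_single (a : List ℕ) : wcomul K (𝐞 a) =
    ((splits a).map fun p => (𝐞 p.1) ⊗ₜ[K] (𝐞 p.2)).sum := by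
  simp [wcomul]

theorem wcomul_nil : wcomul K (𝐞 []) = (𝐞 []) ⊗ₜ[K] (𝐞 []) := by
  simp [wcomul_single, splits]

theorem wcomul_wcons (x : ℕ) (z : Words K) : wcomul K (wcons K x z) =
    wcons K x z ⊗ₜ[K] (𝐞 []) + (wcons K x).lTensor _ (wcomul K z) := by
  refine eq_of_eqOn_basis (f := wcomul K ∘ₗ wcons K x)
    (g := (TensorProduct.mk K _ _).flip (𝐞 []) ∘ₗ wcons K x +
      (wcons K x).lTensor _ ∘ₗ wcomul K) (fun a => ?_) z
  simp only [LinearMap.comp_apply, LinearMap.add_apply, LinearMap.flip_apply,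
    TensorProduct.mk_apply, wcons_single, wcomul_single, splits, List.map_cons, List.sum_cons,
    List.map_map, map_list_sum]
  congr 3
  funext p
  simp [wcons_single]

theorem wcoassoc (z : Words K) :
    TensorProduct.assoc K _ _ _ ((wcomul K).rTensor _ (wcomul K z)) =
      (wcomul K).lTensor _ (wcomul K z) := by
  refine eq_of_eqOn_basis
    (f := (TensorProduct.assoc K _ _ _).toLinearMap ∘ₗ (wcomul K).rTensor _ ∘ₗ wcomul K)
    (g := (wcomul K).lTensor _ ∘ₗ wcomul K) (fun a => ?_) z
  simp only [LinearMap.comp_apply, LinearEquiv.coe_coe]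
  induction a with
  | nil => simp [wcomul_nil]
  | cons x a ih =>
    have h1 : ∀ X : Words K ⊗[K] Words K, TensorProduct.assoc K _ _ _
        ((wcomul K).rTensor _ ((wcons K x).lTensor _ X)) =
        ((wcons K x).lTensor _).lTensor _
          (TensorProduct.assoc K _ _ _ ((wcomul K).rTensor _ X)) := by
      intro X
      induction X with
      | zero => simp
      | add X Y hX hY => simp only [map_add, hX, hY]
      | tmul b c =>
        simp only [LinearMap.lTensor_tmul, LinearMap.rTensor_tmul]
        generalize wcomul K b = Y
        induction Y with
        | zero => simp
        | add X Y hX hY => simp only [map_add, hX, hY, TensorProduct.add_tmul]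
        | tmul d e => simp
    have h2 : ∀ X : Words K ⊗[K] Words K, (wcomul K).lTensor _ ((wcons K x).lTensor _ X) =
        TensorProduct.assoc K _ _ _ ((wcons K x).lTensor _ X ⊗ₜ[K] (𝐞 [])) +
        ((wcons K x).lTensor _).lTensor _ ((wcomul K).lTensor _ X) := by
      intro X
      induction X with
      | zero => simp
      | add X Y hX hY => simp only [map_add, hX, hY, TensorProduct.add_tmul]; abel
      | tmul b c => simp [wcomul_wcons, TensorProduct.tmul_add]
    rw [← wcons_single, wcomul_wcons, map_add, map_add, map_add, h1, h2, ih,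
      LinearMap.rTensor_tmul, wcomul_wcons, TensorProduct.add_tmul, map_add]
    simp [wcomul_nil]
    abel

theorem wcomul_wmul (z z' : Words K) : wcomul K (wmul K z z') =
    TensorProduct.map₂ (wmul K) (wmul K) (wcomul K z) (wcomul K z') := by
  have q1 : ∀ (c : Words K) (y : ℕ) (Y : Words K ⊗[K] Words K),
      TensorProduct.map₂ (wmul K) (wmul K) (c ⊗ₜ[K] (𝐞 [])) ((wcons K y).lTensor _ Y) =
      (wcons K y).lTensor _ (TensorProduct.map₂ (wmul K) (wmul K) (c ⊗ₜ[K] (𝐞 [])) Y) := by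
    intro c y Y
    induction Y with
    | zero => simp
    | add X Y hX hY => simp only [map_add, hX, hY]
    | tmul d e => simp [TensorProduct.map₂_apply_tmul, nil_wmul]
  have q2 : ∀ (c : Words K) (x : ℕ) (X : Words K ⊗[K] Words K),
      TensorProduct.map₂ (wmul K) (wmul K) ((wcons K x).lTensor _ X) (c ⊗ₜ[K] (𝐞 [])) =
      (wcons K x).lTensor _ (TensorProduct.map₂ (wmul K) (wmul K) X (c ⊗ₜ[K] (𝐞 []))) := by
    intro c x X
    induction X with
    | zero => simp
    | add X Y hX hY => simp only [map_add, LinearMap.add_apply, hX, hY]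
    | tmul d e => simp [TensorProduct.map₂_apply_tmul, wmul_nil]
  have q3 : ∀ (x y : ℕ) (X Y : Words K ⊗[K] Words K),
      TensorProduct.map₂ (wmul K) (wmul K) ((wcons K x).lTensor _ X) ((wcons K y).lTensor _ Y) =
      (wcons K x).lTensor _
        (TensorProduct.map₂ (wmul K) (wmul K) X ((wcons K y).lTensor _ Y)) +
      (wcons K y).lTensor _
        (TensorProduct.map₂ (wmul K) (wmul K) ((wcons K x).lTensor _ X) Y) := by
    intro x y X Y
    induction X with
    | zero => simp
    | add X Y hX hY => simp only [map_add, LinearMap.add_apply, hX, hY]; abel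
    | tmul d e =>
      induction Y with
      | zero => simp
      | add X Y hX hY => simp only [map_add, hX, hY]; abel
      | tmul f g =>
        simp [TensorProduct.map₂_apply_tmul, wmul_wcons_wcons, TensorProduct.tmul_add]
  refine words_induction₂ (f := (wmul K).compr₂ (wcomul K))
    (g := (TensorProduct.map₂ (wmul K) (wmul K)).compl₁₂ (wcomul K) (wcomul K))
    (fun a => ?_) z z'
  simp only [LinearMap.compl₁₂_apply, LinearMap.compr₂_apply]
  have unit_left : ∀ X : Words K ⊗[K] Words K,
      TensorProduct.map₂ (wmul K) (wmul K) ((𝐞 []) ⊗ₜ[K] (𝐞 [])) X = X := by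
    intro X
    induction X with
    | zero => simp
    | add X Y hX hY => simp only [map_add, hX, hY]
    | tmul d e => simp [TensorProduct.map₂_apply_tmul, nil_wmul]
  have unit_right : ∀ X : Words K ⊗[K] Words K,
      TensorProduct.map₂ (wmul K) (wmul K) X ((𝐞 []) ⊗ₜ[K] (𝐞 [])) = X := by
    intro X
    induction X with
    | zero => simp
    | add X Y hX hY => simp only [map_add, LinearMap.add_apply, hX, hY]
    | tmul d e => simp [TensorProduct.map₂_apply_tmul, wmul_nil]
  induction a with
  | nil =>
    intro b
    rw [nil_wmul, wcomul_nil, unit_left]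
  | cons x a iha =>
    intro b
    induction b with
    | nil => rw [wmul_nil, wcomul_nil, unit_right]
    | cons y b ihb =>
      have iha' := iha (y :: b)
      simp only [← wcons_single] at iha' ihb ⊢
      rw [wmul_wcons_wcons, map_add, wcomul_wcons, wcomul_wcons, iha', ihb, wcomul_wcons,
        wcomul_wcons]
      simp only [map_add, LinearMap.add_apply, q1, q2, q3]
      rw [TensorProduct.map₂_apply_tmul, TensorProduct.map_tmul, nil_wmul, wmul_wcons_wcons,
        TensorProduct.add_tmul]
      abel

/-- If the right part of a cut of a word of `z ≺ z'` is not empty, then it ends with a letter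
of `z`; the last term is the cut with an empty right part. -/
theorem wcomul_wprec (z z' : Words K) : wcomul K (wprec K z z') =
    TensorProduct.map₂ (wmul K) (wprec K) (wcomul K z) (wcomul K z')
      + wprec K z z' ⊗ₜ[K] (𝐞 []) := by
  have q1 : ∀ (c : Words K) (Y : Words K ⊗[K] Words K),
      TensorProduct.map₂ (wmul K) (wprec K) (c ⊗ₜ[K] (𝐞 [])) Y = 0 := by
    intro c Y
    induction Y with
    | zero => simp
    | add X Y hX hY => rw [map_add, hX, hY, add_zero]
    | tmul d e => simp [TensorProduct.map₂_apply_tmul, nil_wprec]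
  have q2 : ∀ (x : ℕ) (X Y : Words K ⊗[K] Words K),
      TensorProduct.map₂ (wmul K) (wprec K) ((wcons K x).lTensor _ X) Y =
      (wcons K x).lTensor _ (TensorProduct.map₂ (wmul K) (wmul K) X Y) := by
    intro x X Y
    induction X with
    | zero => simp
    | add X Y hX hY => simp only [map_add, LinearMap.add_apply, hX, hY]
    | tmul d e =>
      induction Y with
      | zero => simp
      | add X Y hX hY => simp only [map_add, hX, hY]
      | tmul f g => simp [TensorProduct.map₂_apply_tmul, wprec_wcons]
  refine words_induction₂ (f := (wprec K).compr₂ (wcomul K))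
    (g := (TensorProduct.map₂ (wmul K) (wprec K)).compl₁₂ (wcomul K) (wcomul K) +
      (wprec K).compr₂ ((TensorProduct.mk K _ _).flip (𝐞 []))) (fun a b => ?_) z z'
  simp only [LinearMap.compl₁₂_apply, LinearMap.compr₂_apply, LinearMap.add_apply,
    LinearMap.flip_apply, TensorProduct.mk_apply]
  rcases a with _ | ⟨x, a⟩
  · rw [nil_wprec, wcomul_nil, q1]
    simp
  · rw [← wcons_single, wprec_wcons, wcomul_wcons, wcomul_wcons, map_add, LinearMap.add_apply,
      q1, q2, wcomul_wmul]
    abel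

theorem rTensor_lapply_wcomul (z : Words K) :
    (Finsupp.lapply (R := K) ([] : List ℕ)).rTensor _ (wcomul K z) = 1 ⊗ₜ[K] z := by
  refine eq_of_eqOn_basis (f := (Finsupp.lapply (R := K) ([] : List ℕ)).rTensor _ ∘ₗ wcomul K)
    (g := TensorProduct.mk K _ _ 1) (fun a => ?_) z
  simp only [LinearMap.comp_apply, TensorProduct.mk_apply]
  induction a with
  | nil => simp [wcomul_nil]
  | cons x a ih =>
    have h : ∀ X : Words K ⊗[K] Words K, (Finsupp.lapply (R := K) ([] : List ℕ)).rTensor _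
        ((wcons K x).lTensor _ X) = (wcons K x).lTensor _
        ((Finsupp.lapply (R := K) ([] : List ℕ)).rTensor _ X) := by
      intro X
      induction X with
      | zero => simp
      | add X Y hX hY => simp only [map_add, hX, hY]
      | tmul d e => simp
    rw [← wcons_single, wcomul_wcons, map_add, h, ih, wcons_single]
    simp [wcons_single]

theorem lTensor_lapply_wcomul (z : Words K) :
    (Finsupp.lapply (R := K) ([] : List ℕ)).lTensor _ (wcomul K z) = z ⊗ₜ[K] 1 := by
  refine eq_of_eqOn_basis (f := (Finsupp.lapply (R := K) ([] : List ℕ)).lTensor _ ∘ₗ wcomul K)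
    (g := (TensorProduct.mk K _ _).flip 1) (fun a => ?_) z
  simp only [LinearMap.comp_apply, LinearMap.flip_apply, TensorProduct.mk_apply]
  rcases a with _ | ⟨x, a⟩
  · simp [wcomul_nil]
  · have h : ∀ X : Words K ⊗[K] Words K, (Finsupp.lapply (R := K) ([] : List ℕ)).lTensor _
        ((wcons K x).lTensor _ X) = 0 := by
      intro X
      induction X with
      | zero => simp
      | add X Y hX hY => simp only [map_add, hX, hY, add_zero]
      | tmul d e =>
        have : (wcons K x e) [] = 0 := by
          refine Finsupp.mapDomain_of_notMem_range _ _ ?_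
          simp
        simp [this]
    rw [← wcons_single, wcomul_wcons, map_add, h, add_zero]
    simp

/-! ### Letters of the words that occur in a product or in a coproduct -/

theorem mapDomain_cons_mem_supported {S S' : Set (List ℕ)} {x : ℕ} {z : Words K}
    (hz : z ∈ Finsupp.supported K K S) (h : ∀ a ∈ S, x :: a ∈ S') :
    Finsupp.mapDomain (List.cons x) z ∈ Finsupp.supported K K S' := by
  classical
  rw [Finsupp.mem_supported] at hz ⊢
  intro b hb
  obtain ⟨a, ha, rfl⟩ := Finset.mem_image.1 (Finsupp.mapDomain_support hb)
  exact h a (hz ha)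

theorem shuffleWord_mem_supported (a b : List ℕ) :
    shuffleWord K a b ∈ Finsupp.supported K K {c | c.Perm (a ++ b)} := by
  induction a generalizing b with
  | nil =>
    rw [shuffleWord.eq_def]
    exact Finsupp.single_mem_supported K 1 (List.Perm.refl _)
  | cons x a iha =>
    induction b with
    | nil =>
      rw [shuffleWord_nil_right]
      refine Finsupp.single_mem_supported K 1 ?_
      simp
    | cons y b ihb =>
      rw [shuffleWord.eq_def]
      refine Submodule.add_mem _ ?_ ?_
      · refine mapDomain_cons_mem_supported (iha (y :: b)) fun c hc => ?_
        exact List.Perm.cons x hc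
      · refine mapDomain_cons_mem_supported ihb fun c hc => ?_
        exact (List.Perm.cons y hc).trans List.perm_middle.symm

theorem wmul_mem_supported (a b : List ℕ) :
    wmul K (𝐞 a) (𝐞 b) ∈ Finsupp.supported K K {c | c.Perm (a ++ b)} := by
  rw [wmul, bilin_single]
  exact shuffleWord_mem_supported a b

theorem wprec_mem_supported (a b : List ℕ) :
    wprec K (𝐞 a) (𝐞 b) ∈ Finsupp.supported K K {c | c.Perm (a ++ b)} := by
  rw [wprec, bilin_single]
  rcases a with _ | ⟨x, a⟩
  · exact Submodule.zero_mem _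
  · refine mapDomain_cons_mem_supported (shuffleWord_mem_supported a b) fun c hc => ?_
    exact List.Perm.cons x hc

theorem eq_append_of_mem_splits {a : List ℕ} {p : List ℕ × List ℕ} (h : p ∈ splits a) :
    a = p.2 ++ p.1 := by
  induction a generalizing p with
  | nil => simp_all [splits]
  | cons x a ih =>
    simp only [splits, List.mem_cons, List.mem_map] at h
    rcases h with rfl | ⟨q, hq, rfl⟩
    · simp
    · rw [ih hq, List.cons_append]

/-- Words being read from right to left, the cuts of `a` are the `b ⊗ c` with `a = c ++ b`. -/
theorem eqOn_wcomul_single {M : Type*} [AddCommMonoid M] [Module K M]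
    {f g : Words K ⊗[K] Words K →ₗ[K] M} {a : List ℕ}
    (h : ∀ b c, a = c ++ b → f ((𝐞 b) ⊗ₜ[K] (𝐞 c)) = g ((𝐞 b) ⊗ₜ[K] (𝐞 c))) :
    f (wcomul K (𝐞 a)) = g (wcomul K (𝐞 a)) := by
  rw [wcomul_single, map_list_sum, map_list_sum, List.map_map, List.map_map]
  congr 1
  refine List.map_congr_left fun p hp => ?_
  exact h _ _ (eq_append_of_mem_splits hp)

theorem wmem_single (M : ℕ) (a : List ℕ) [Decidable (M ∈ a)] :
    wmem K M (𝐞 a) = if M ∈ a then (𝐞 a) else 0 := by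
  classical
  simp only [wmem, Finsupp.linearCombination_single, one_smul]
  congr

theorem wmem_single_of_mem {M : ℕ} {a : List ℕ} (h : M ∈ a) : wmem K M (𝐞 a) = 𝐞 a := by
  rw [wmem_single, if_pos h]

theorem wmem_single_of_not_mem {M : ℕ} {a : List ℕ} (h : M ∉ a) : wmem K M (𝐞 a) = 0 := by
  rw [wmem_single, if_neg h]

theorem eqOn_supported {X : Type v} {M : Type w} [AddCommMonoid M] [Module K M] {S : Set X}
    {f g : (X →₀ K) →ₗ[K] M}
    (h : ∀ x ∈ S, f (Finsupp.single x 1) = g (Finsupp.single x 1)) :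
    ∀ z ∈ Finsupp.supported K K S, f z = g z := by
  intro z hz
  rw [Finsupp.supported_eq_span_single] at hz
  refine LinearMap.eqOn_span ?_ hz
  rintro _ ⟨x, hx, rfl⟩
  exact h x hx

theorem wmem_wmul {M : ℕ} {a : List ℕ} (ha : M ∉ a) (z : Words K) :
    wmem K M (wmul K (𝐞 a) z) = wmul K (𝐞 a) (wmem K M z) := by
  refine eq_of_eqOn_basis (f := wmem K M ∘ₗ wmul K (𝐞 a)) (g := wmul K (𝐞 a) ∘ₗ wmem K M)
    (fun b => ?_) z
  simp only [LinearMap.comp_apply]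
  by_cases h : M ∈ b
  · rw [wmem_single_of_mem h]
    refine eqOn_supported (f := wmem K M) (g := LinearMap.id) (fun c hc => ?_) _
      (wmul_mem_supported a b)
    exact wmem_single_of_mem ((List.Perm.mem_iff hc).2 (by simp [h]))
  · rw [wmem_single_of_not_mem h, map_zero]
    refine eqOn_supported (f := wmem K M) (g := 0) (fun c hc => ?_) _
      (wmul_mem_supported a b)
    exact wmem_single_of_not_mem (mt (List.Perm.mem_iff hc).1 (by simp [h, ha]))

theorem wmem_wprec {M : ℕ} {a b : List ℕ} (hb : M ∈ b) :
    wmem K M (wprec K (𝐞 a) (𝐞 b)) = wprec K (𝐞 a) (𝐞 b) := by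
  refine eqOn_supported (f := wmem K M) (g := LinearMap.id) (fun c hc => ?_) _
    (wprec_mem_supported a b)
  exact wmem_single_of_mem ((List.Perm.mem_iff hc).2 (by simp [hb]))

/-- If `M` is not a letter of `a`, then it belongs to the left part of a product if and only if it
belongs to that of the second factor. -/
theorem rTensor_wmem_map₂ {M : ℕ} {a : List ℕ} (ha : M ∉ a)
    (f : Words K →ₗ[K] Words K →ₗ[K] Words K) (Y : Words K ⊗[K] Words K) :
    (wmem K M).rTensor _ (TensorProduct.map₂ (wmul K) f (wcomul K (𝐞 a)) Y) =
      TensorProduct.map₂ (wmul K) f (wcomul K (𝐞 a)) ((wmem K M).rTensor _ Y) := by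
  refine eqOn_wcomul_single (a := a)
    (f := (wmem K M).rTensor _ ∘ₗ (TensorProduct.map₂ (wmul K) f).flip Y)
    (g := (TensorProduct.map₂ (wmul K) f).flip ((wmem K M).rTensor _ Y)) fun b c hbc => ?_
  have hb : M ∉ b := fun h => ha (by simp [hbc, h])
  simp only [LinearMap.comp_apply, LinearMap.flip_apply]
  induction Y with
  | zero => simp
  | add X Y hX hY => simp only [map_add, hX, hY]
  | tmul d e => simp [TensorProduct.map₂_apply_tmul, wmem_wmul hb]

theorem rTensor_wmem_wcomul_wmem (M : ℕ) (z : Words K) :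
    (wmem K M).rTensor _ (wcomul K (wmem K M z)) = (wmem K M).rTensor _ (wcomul K z) := by
  refine eq_of_eqOn_basis (f := (wmem K M).rTensor _ ∘ₗ wcomul K ∘ₗ wmem K M)
    (g := (wmem K M).rTensor _ ∘ₗ wcomul K) (fun a => ?_) z
  simp only [LinearMap.comp_apply]
  by_cases h : M ∈ a
  · rw [wmem_single_of_mem h]
  · rw [wmem_single_of_not_mem h, map_zero, map_zero]
    refine eqOn_wcomul_single (f := 0) (g := (wmem K M).rTensor _) fun b c hbc => ?_
    have hb : M ∉ b := fun h' => h (by simp [hbc, h'])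
    simp [wmem_single_of_not_mem hb]

theorem map_wmem_wcomul_wmem (M : ℕ) (z : Words K) :
    (LinearMap.id - wmem K M).rTensor _ (wcomul K (wmem K M z)) =
      TensorProduct.map (LinearMap.id - wmem K M) (wmem K M) (wcomul K z) := by
  refine eq_of_eqOn_basis (f := (LinearMap.id - wmem K M).rTensor _ ∘ₗ wcomul K ∘ₗ wmem K M)
    (g := TensorProduct.map (LinearMap.id - wmem K M) (wmem K M) ∘ₗ wcomul K) (fun a => ?_) z
  simp only [LinearMap.comp_apply]
  by_cases h : M ∈ a
  · rw [wmem_single_of_mem h]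
    refine eqOn_wcomul_single fun b c hbc => ?_
    by_cases hb : M ∈ b
    · rw [LinearMap.rTensor_tmul, TensorProduct.map_tmul, LinearMap.sub_apply,
        wmem_single_of_mem hb]
      simp
    · have hc : M ∈ c := by simpa [hbc, hb] using h
      rw [LinearMap.rTensor_tmul, TensorProduct.map_tmul, wmem_single_of_mem hc]
  · rw [wmem_single_of_not_mem h, map_zero, map_zero]
    refine eqOn_wcomul_single (f := 0) (g := TensorProduct.map (LinearMap.id - wmem K M)
      (wmem K M)) fun b c hbc => ?_
    have hc : M ∉ c := fun h' => h (by simp [hbc, h'])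
    simp [wmem_single_of_not_mem hc]

end Words

/-! ### Standardisation of words -/

section Standardisation

theorem st_lt_st {k : ℕ} {α : Type v} [LinearOrder α] {w : Fin k → α}
    (hw : Function.Injective w) (i j : Fin k) : st w i < st w j ↔ w i < w j := by
  have h : StrictMono (w ∘ Tuple.sort w) :=
    (Tuple.monotone_sort w).strictMono_of_injective (hw.comp (Tuple.sort w).injective)
  have := h.lt_iff_lt (a := st w i) (b := st w j)
  rw [← this]
  simp [st]

/-- A permutation is determined by its inversions. -/
theorem AllPerm.ext_of_lt {u v : AllPerm} (h : u.1 = v.1)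
    (hlt : ∀ (i j : ℕ) (hi : i < u.1) (hj : j < u.1), u.2 ⟨i, hi⟩ < u.2 ⟨j, hj⟩ ↔
      v.2 ⟨i, h ▸ hi⟩ < v.2 ⟨j, h ▸ hj⟩) : u = v := by
  obtain ⟨n, u⟩ := u
  obtain ⟨m, v⟩ := v
  obtain rfl : n = m := h
  congr
  have hm : StrictMono (u ∘ v.symm) := by
    intro i j hij
    have := hlt (v.symm i) (v.symm j) (v.symm i).2 (v.symm j).2
    simpa using this.2 (by simpa using hij)
  have h2 : (u ∘ v.symm : Fin n → Fin n) = id := by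
    refine (hm.range_inj strictMono_id).1 ?_
    rw [Set.range_id, Set.range_eq_univ.2 (u.surjective.comp v.symm.surjective)]
  ext i
  have := congrFun h2 (v i)
  simp at this
  rw [this]

/-- The standardisation of a word with distinct letters; the word is read from right to left. -/
def ofWord (a : List ℕ) : AllPerm := ⟨a.length, st fun i : Fin a.length => a[a.length - 1 - i]⟩

/-- The word of a permutation, read from right to left. -/
def toWord (u : AllPerm) : List ℕ := List.ofFn fun i : Fin u.1 => (u.2 i.rev : ℕ)

theorem ofWord_lt_ofWord {a : List ℕ} (ha : a.Nodup) (i j : Fin a.length) :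
    (ofWord a).2 i < (ofWord a).2 j ↔ a[a.length - 1 - i] < a[a.length - 1 - j] := by
  refine st_lt_st (w := fun i : Fin a.length => a[a.length - 1 - i]) ?_ i j
  intro i j h
  have := (List.Nodup.getElem_inj_iff ha).1 h
  ext
  omega

theorem eq_ofWord {u : AllPerm} {a : List ℕ} (ha : a.Nodup) (h : u.1 = a.length)
    (hlt : ∀ (i j : ℕ) (hi : i < u.1) (hj : j < u.1), u.2 ⟨i, hi⟩ < u.2 ⟨j, hj⟩ ↔
      a[a.length - 1 - i] < a[a.length - 1 - j]) : u = ofWord a := by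
  refine AllPerm.ext_of_lt h fun i j hi hj => ?_
  rw [hlt i j hi hj]
  exact (ofWord_lt_ofWord ha ⟨i, h ▸ hi⟩ ⟨j, h ▸ hj⟩).symm

theorem length_toWord (u : AllPerm) : (toWord u).length = u.1 := by simp [toWord]

theorem nodup_toWord (u : AllPerm) : (toWord u).Nodup := by
  rw [toWord, List.nodup_ofFn]
  intro i j h
  simpa [Fin.val_inj] using h

theorem lt_of_mem_toWord {u : AllPerm} {x : ℕ} (h : x ∈ toWord u) : x < u.1 := by
  rw [toWord, List.mem_ofFn] at h
  obtain ⟨i, rfl⟩ := h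
  exact (u.2 i.rev).2

theorem getElem_toWord (u : AllPerm) {k : ℕ} (hk : k < u.1) :
    (toWord u)[(toWord u).length - 1 - k]'(by rw [length_toWord]; omega) =
      (u.2 ⟨k, hk⟩ : ℕ) := by
  simp only [toWord, List.getElem_ofFn, List.length_ofFn]
  congr 2
  ext
  simp [Fin.rev]
  omega

theorem ofWord_toWord (u : AllPerm) : ofWord (toWord u) = u := by
  symm
  refine eq_ofWord (nodup_toWord u) (length_toWord u).symm fun i j hi hj => ?_
  rw [getElem_toWord u hi, getElem_toWord u hj, Fin.lt_def]

theorem ofWord_map {a : List ℕ} (ha : a.Nodup) {f : ℕ → ℕ} (hf : StrictMonoOn f {x | x ∈ a}) :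
    ofWord (a.map f) = ofWord a := by
  symm
  refine eq_ofWord (u := ofWord a) (a := a.map f) (ha.map_on fun x hx y hy h => ?_) ?_ ?_
  · exact hf.injOn hx hy h
  · simp [ofWord]
  · intro i j hi hj
    have h := ofWord_lt_ofWord ha ⟨i, hi⟩ ⟨j, hj⟩
    simp only [List.length_map, List.getElem_map]
    refine h.trans ?_
    rw [hf.lt_iff_lt (List.getElem_mem _) (List.getElem_mem _)]

theorem stLeft_eq (u : AllPerm) (i : Fin (u.1 + 1)) :
    stLeft u i = ofWord ((toWord u).drop (u.1 - i)) := by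
  refine eq_ofWord ((nodup_toWord u).sublist (List.drop_sublist _ _)) ?_ ?_
  · simp only [stLeft, List.length_drop, length_toWord]
    omega
  · intro j k hj hk
    simp only [stLeft] at hj hk
    refine (st_lt_st (w := fun j : Fin i => u.2 ⟨j, by omega⟩) ?_ ⟨j, hj⟩ ⟨k, hk⟩).trans ?_
    · intro x y h
      simpa [Fin.ext_iff] using u.2.injective h
    · rw [Fin.lt_def, ← getElem_toWord u, ← getElem_toWord u]
      simp only [List.getElem_drop, List.length_drop, length_toWord]
      have e1 : u.1 - (i : ℕ) + (u.1 - (u.1 - (i : ℕ)) - 1 - j) = u.1 - 1 - j := by omega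
      have e2 : u.1 - (i : ℕ) + (u.1 - (u.1 - (i : ℕ)) - 1 - k) = u.1 - 1 - k := by omega
      simp only [e1, e2]

theorem stRight_eq (u : AllPerm) (i : Fin (u.1 + 1)) :
    stRight u i = ofWord ((toWord u).take (u.1 - i)) := by
  refine eq_ofWord ((nodup_toWord u).sublist (List.take_sublist _ _)) ?_ ?_
  · simp [stRight, List.length_take, length_toWord]
  · intro j k hj hk
    simp only [stRight] at hj hk
    refine (st_lt_st (w := fun j : Fin (u.1 - i) => u.2 ⟨i + j, by omega⟩) ?_
      ⟨j, hj⟩ ⟨k, hk⟩).trans ?_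
    · intro x y h
      simpa [Fin.ext_iff] using u.2.injective h
    · rw [Fin.lt_def, ← getElem_toWord u, ← getElem_toWord u]
      simp only [List.getElem_take, List.length_take, length_toWord]
      have e1 : min (u.1 - (i : ℕ)) u.1 - 1 - j = u.1 - 1 - (i + j) := by omega
      have e2 : min (u.1 - (i : ℕ)) u.1 - 1 - k = u.1 - 1 - (i + k) := by omega
      simp only [e1, e2]

/-- The rank of `x` among the letters of a word. -/
def rank (a : List ℕ) (x : ℕ) : ℕ := (a.filter (· < x)).length

theorem rank_lt_rank {a : List ℕ} {x y : ℕ} (hx : x ∈ a) (hxy : x < y) : rank a x < rank a y := by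
  have h1 : (a.filter (· < x)) = (a.filter (· < y)).filter (· < x) := by
    rw [List.filter_filter]
    refine List.filter_congr fun z _ => ?_
    simp
    omega
  rw [rank, rank, h1]
  refine List.length_filter_lt_length_iff_exists.2 ⟨x, ?_, ?_⟩
  · simp [hx, hxy]
  · simp

theorem rank_strictMonoOn (a : List ℕ) : StrictMonoOn (rank a) {x | x ∈ a} :=
  fun _ hx _ _ hxy => rank_lt_rank hx hxy

theorem rank_lt_length {a : List ℕ} {x : ℕ} (hx : x ∈ a) : rank a x < a.length :=
  List.length_filter_lt_length_iff_exists.2 ⟨x, hx, by simp⟩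

/-- A word without repetition of length `n` on `{0, …, n-1}` is the word of a permutation. -/
theorem exists_toWord_eq {a : List ℕ} {n : ℕ} (hn : a.length = n) (ha : a.Nodup)
    (h : ∀ x ∈ a, x < n) : ∃ u : Equiv.Perm (Fin n), toWord ⟨n, u⟩ = a := by
  subst hn
  let f : Fin a.length → Fin a.length := fun i =>
    ⟨a[a.length - 1 - i], h _ (List.getElem_mem _)⟩
  have hf : Function.Injective f := by
    intro i j hij
    have := (List.Nodup.getElem_inj_iff ha).1 (congrArg Fin.val hij)
    ext
    omega
  refine ⟨Equiv.ofBijective f (Finite.injective_iff_bijective.1 hf), ?_⟩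
  refine List.ext_getElem (by simp [toWord]) fun k h1 h2 => ?_
  simp only [toWord, List.getElem_ofFn, Equiv.ofBijective_apply, f]
  congr 1
  simp [Fin.rev]
  omega

theorem toWord_ofWord {a : List ℕ} (ha : a.Nodup) : toWord (ofWord a) = a.map (rank a) := by
  have h1 : (a.map (rank a)).Nodup :=
    ha.map_on fun x hx y hy h => (rank_strictMonoOn a).injOn hx hy h
  obtain ⟨u, hu⟩ := exists_toWord_eq rfl h1 (by
    intro x hx
    obtain ⟨y, hy, rfl⟩ := List.mem_map.1 hx
    simpa using rank_lt_length hy)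
  rw [← ofWord_map ha (rank_strictMonoOn a), ← hu, ofWord_toWord]

end Standardisation

/-! ### Shuffles of permutations and of words -/

section Shuffles

/-- The letters in the image of `e` occur in increasing order in the word of `ζ⁻¹` if and only
if `ζ ∘ e` is increasing. -/
theorem shuffle_filter_iff {N k : ℕ} (ζ : Equiv.Perm (Fin N)) (e : Fin k → Fin N)
    (he : StrictMono e) (p : Fin N → Bool) (hp : ∀ x, p x = true ↔ ∃ i, e i = x) :
    (List.ofFn fun i => ζ⁻¹ i.rev).filter p = (List.ofFn fun i => e i.rev) ↔
      StrictMono fun i => ζ (e i) := by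
  have hA : (List.ofFn fun i => e i.rev).Pairwise (· > ·) := by
    rw [List.pairwise_ofFn]
    intro i j hij
    exact he (Fin.rev_lt_rev.2 hij)
  have h1 : (List.ofFn fun i => ζ⁻¹ i.rev).filter p = (List.ofFn fun i => e i.rev) ↔
      ((List.ofFn fun i => ζ⁻¹ i.rev).filter p).Pairwise (· > ·) := by
    constructor
    · intro h
      rw [h]
      exact hA
    · intro h
      refine List.Perm.eq_of_pairwise (fun x y _ _ hxy hyx => ?_) h hA ?_
      · exact absurd hxy (lt_asymm hyx)
      · rw [List.perm_ext_iff_of_nodup]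
        · intro x
          rw [List.mem_filter, hp, List.mem_ofFn, List.mem_ofFn]
          constructor
          · rintro ⟨-, i, hi⟩
            exact ⟨i.rev, by simpa using hi⟩
          · rintro ⟨i, hi⟩
            exact ⟨⟨(ζ x).rev, by simp⟩, i.rev, hi⟩
        · refine List.Nodup.filter _ (List.nodup_ofFn.2 ?_)
          exact ζ⁻¹.injective.comp Fin.rev_injective
        · exact List.nodup_ofFn.2 (he.injective.comp Fin.rev_injective)
  rw [h1, List.pairwise_filter, List.pairwise_ofFn]
  constructor
  · intro h i j hij
    by_contra hlt
    have hne : ζ (e i) ≠ ζ (e j) := fun h' => hij.ne (he.injective (ζ.injective h'))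
    have := h (i := (ζ (e i)).rev) (j := (ζ (e j)).rev)
      (Fin.rev_lt_rev.2 (lt_of_le_of_ne (not_lt.1 hlt) hne.symm))
      ((hp _).2 ⟨i, by simp⟩) ((hp _).2 ⟨j, by simp⟩)
    simp only [Fin.rev_rev, Equiv.Perm.inv_def, Equiv.symm_apply_apply, gt_iff_lt,
      he.lt_iff_lt] at this
    exact lt_asymm this hij
  · intro h i j hij hi hj
    obtain ⟨a, ha⟩ := (hp _).1 hi
    obtain ⟨b, hb⟩ := (hp _).1 hj
    rw [gt_iff_lt, ← ha, ← hb, he.lt_iff_lt]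
    by_contra hab
    have hab' : a ≤ b := not_lt.1 hab
    have := h.monotone hab'
    simp only [ha, hb, Equiv.Perm.inv_def, Equiv.apply_symm_apply] at this
    exact absurd hij (not_lt.2 (Fin.rev_le_rev.1 this))

theorem val_add_one_eq_of_strictMono {k N : ℕ} {f : Fin k → Fin N} (hf : StrictMono f) {i : Fin k}
    (hi : (f i : ℕ) + 1 = N) : (i : ℕ) + 1 = k := by
  by_contra h
  have h2 : (i : ℕ) + 1 < k := by omega
  have h3 : i < ⟨i + 1, h2⟩ := by rw [Fin.lt_def]; simp
  have h4 := hf h3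
  rw [Fin.lt_def] at h4
  have := (f ⟨i + 1, h2⟩).2
  omega

/-- The word `c` is a shuffle of `a` and `b`, where `a` has its letters in `{0, …, n-1}` and `b`
has no such letters. -/
def IsShuffle (n : ℕ) (a b c : List ℕ) : Prop :=
  c.filter (· < n) = a ∧ c.filter (n ≤ ·) = b

open scoped Classical in
theorem mapDomain_cons_apply {K : Type u} [Field K] (x : ℕ) (z : Words K) (c : List ℕ) :
    Finsupp.mapDomain (List.cons x) z c =
      if c.head? = some x then z c.tail else 0 := by
  rcases c with _ | ⟨y, c⟩
  · rw [Finsupp.mapDomain_of_notMem_range _ _ (by simp)]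
    simp
  · by_cases h : y = x
    · subst h
      rw [Finsupp.mapDomain_apply (List.cons_injective)]
      simp
    · rw [Finsupp.mapDomain_of_notMem_range _ _ (by
        rintro ⟨d, hd⟩
        exact h (List.cons.inj hd).1.symm)]
      simp [h]

theorem isShuffle_cons_cons {n x y : ℕ} {a b c : List ℕ} {z : ℕ} (hx : x < n) (hy : n ≤ y) :
    IsShuffle n (x :: a) (y :: b) (z :: c) ↔
      (z = x ∧ IsShuffle n a (y :: b) c) ∨ (z = y ∧ IsShuffle n (x :: a) b c) := by
  unfold IsShuffle
  by_cases hz : z < n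
  · have h1 : ¬ n ≤ z := by omega
    have h2 : z ≠ y := by omega
    simp [hz, h1, h2]
    tauto
  · have h1 : n ≤ z := by omega
    have h2 : z ≠ x := by omega
    simp [hz, h1, h2]
    tauto

open scoped Classical in
theorem shuffleWord_apply {K : Type u} [Field K] {n : ℕ} {a b : List ℕ} (ha : ∀ x ∈ a, x < n)
    (hb : ∀ x ∈ b, n ≤ x) (c : List ℕ) :
    shuffleWord K a b c = if IsShuffle n a b c then 1 else 0 := by
  induction a generalizing b c with
  | nil =>
    rw [shuffleWord.eq_def, Finsupp.single_apply]
    refine if_congr ?_ rfl rfl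
    constructor
    · rintro rfl
      refine ⟨List.filter_eq_nil_iff.2 fun x hx => ?_, List.filter_eq_self.2 fun x hx => ?_⟩
      · simpa using hb x hx
      · simpa using hb x hx
    · rintro ⟨h1, h2⟩
      rw [← h2, List.filter_eq_self]
      intro x hx
      simpa using List.filter_eq_nil_iff.1 h1 x hx
  | cons x a iha =>
    induction b generalizing c with
    | nil =>
      rw [shuffleWord_nil_right, Finsupp.single_apply]
      refine if_congr ?_ rfl rfl
      constructor
      · rintro rfl
        refine ⟨List.filter_eq_self.2 fun y hy => ?_, List.filter_eq_nil_iff.2 fun y hy => ?_⟩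
        · simpa using ha y hy
        · simpa using ha y hy
      · rintro ⟨h1, h2⟩
        rw [← h1, List.filter_eq_self]
        intro x hx
        simpa using List.filter_eq_nil_iff.1 h2 x hx
    | cons y b ihb =>
      have hx : x < n := ha x (by simp)
      have hy : n ≤ y := hb y (by simp)
      rw [shuffleWord.eq_def]
      simp only [Finsupp.add_apply, mapDomain_cons_apply]
      rcases c with _ | ⟨z, c⟩
      · simp [IsShuffle]
      · simp only [List.head?_cons, Option.some.injEq, List.tail_cons, isShuffle_cons_cons hx hy]
        rw [iha (fun t ht => ha t (by simp [ht])) hb, ihb (fun t ht => hb t (by simp [ht]))]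
        by_cases h1 : z = x
        · have h2 : z ≠ y := by omega
          simp [h1, show x ≠ y by omega]
        · by_cases h2 : z = y
          · simp [h2, show y ≠ x by omega]
          · simp [h1, h2]

open scoped Classical in
theorem halfShuffleWord_apply {K : Type u} [Field K] {n : ℕ} {a b : List ℕ} (ha : ∀ x ∈ a, x < n)
    (hb : ∀ x ∈ b, n ≤ x) (c : List ℕ) : halfShuffleWord K a b c =
      if IsShuffle n a b c ∧ ∃ x, c.head? = some x ∧ x < n then 1 else 0 := by
  rcases a with _ | ⟨x, a⟩
  · rw [halfShuffleWord, Finsupp.zero_apply, if_neg]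
    rintro ⟨⟨h, -⟩, x, hx, hxn⟩
    rcases c with _ | ⟨z, c⟩
    · simp at hx
    · simp at hx
      simp [hx, hxn] at h
  · rw [halfShuffleWord, mapDomain_cons_apply]
    have hx : x < n := ha x (by simp)
    rcases c with _ | ⟨z, c⟩
    · simp
    · simp only [List.head?_cons, Option.some.injEq, List.tail_cons, exists_eq_left']
      rw [shuffleWord_apply (fun t ht => ha t (by simp [ht])) hb]
      by_cases hzx : z = x
      · subst hzx
        rw [if_pos rfl]
        refine if_congr ?_ rfl rfl
        simp [IsShuffle, hx]
      · rw [if_neg hzx, if_neg]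
        rintro ⟨⟨h, -⟩, hz⟩
        simp [hz, hzx] at h

theorem block_castAdd {n m : ℕ} (u : Equiv.Perm (Fin n)) (v : Equiv.Perm (Fin m)) (i : Fin n) :
    block u v (Fin.castAdd m i) = Fin.castAdd m (u i) := by
  simp [block]

theorem block_natAdd {n m : ℕ} (u : Equiv.Perm (Fin n)) (v : Equiv.Perm (Fin m)) (i : Fin m) :
    block u v (Fin.natAdd n i) = Fin.natAdd n (v i) := by
  simp [block]

theorem block_lt_iff {n m : ℕ} (u : Equiv.Perm (Fin n)) (v : Equiv.Perm (Fin m))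
    (x : Fin (n + m)) : (block u v x : ℕ) < n ↔ (x : ℕ) < n := by
  refine Fin.addCases (fun i => ?_) (fun i => ?_) x
  · simp [block_castAdd]
  · simp [block_natAdd]

/-- The word of the second factor of a product, on the letters that follow those of the first. -/
def shiftWord (u v : AllPerm) : List ℕ := (toWord v).map (u.1 + ·)

theorem le_of_mem_shiftWord {u v : AllPerm} {x : ℕ} (h : x ∈ shiftWord u v) : u.1 ≤ x := by
  obtain ⟨y, -, rfl⟩ := List.mem_map.1 h
  omega

/-- Shuffles in the sense of permutations are shuffles in the sense of words. -/
theorem mem_shuffles_iff (u v : AllPerm) (ζ : Equiv.Perm (Fin (u.1 + v.1))) :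
    ζ ∈ shuffles u.1 v.1 ↔
      IsShuffle u.1 (toWord u) (shiftWord u v) (toWord (shufflePerm u v ζ)) := by
  set g : Fin (u.1 + v.1) → ℕ := fun x => block u.2 v.2 x with hg
  have ginj : Function.Injective g := Fin.val_injective.comp (block u.2 v.2).injective
  have h1 : toWord (shufflePerm u v ζ) = (List.ofFn fun i => ζ⁻¹ i.rev).map g := by
    rw [List.map_ofFn]
    rfl
  have h2 : toWord u = (List.ofFn fun i : Fin u.1 => Fin.castAdd v.1 i.rev).map g := by
    rw [List.map_ofFn, toWord]
    congr
    funext i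
    simp [g, block_castAdd]
  have h3 : shiftWord u v = (List.ofFn fun i : Fin v.1 => Fin.natAdd u.1 i.rev).map g := by
    rw [List.map_ofFn, shiftWord, toWord, List.map_ofFn]
    refine congrArg List.ofFn ?_
    funext i
    simp [g, block_natAdd]
  rw [IsShuffle, h1, h2, h3, List.filter_map, List.filter_map,
    (List.map_injective_iff.2 ginj).eq_iff, (List.map_injective_iff.2 ginj).eq_iff,
    shuffle_filter_iff ζ (Fin.castAdd v.1) (Fin.strictMono_castAdd _),
    shuffle_filter_iff ζ (Fin.natAdd u.1) (Fin.strictMono_natAdd _)]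
  · simp [shuffles]
  · intro x
    simp only [Function.comp_apply, decide_eq_true_eq, g]
    rw [← not_lt, block_lt_iff]
    refine Fin.addCases (fun i => ?_) (fun i => ?_) x
    · simp only [Fin.val_castAdd, i.2, not_true_eq_false, false_iff, not_exists]
      intro j h
      have := congrArg Fin.val h
      simp at this
      omega
    · simp
  · intro x
    simp only [Function.comp_apply, decide_eq_true_eq, g]
    rw [block_lt_iff]
    refine Fin.addCases (fun i => ?_) (fun i => ?_) x
    · simp
    · simp only [Fin.val_natAdd, add_lt_iff_neg_left, not_lt_zero, false_iff, not_exists]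
      intro j h
      have := congrArg Fin.val h
      simp at this
      omega

theorem toWord_injective : Function.Injective toWord := fun u v h => by
  rw [← ofWord_toWord u, h, ofWord_toWord]

theorem shufflePerm_injective (u v : AllPerm) : Function.Injective (shufflePerm u v) := by
  intro ζ ζ' h
  have := eq_of_heq (Sigma.mk.inj h).2
  simpa using this

/-- Each shuffle of the two words is the word of some `(u × v) ζ⁻¹`. -/
theorem exists_shufflePerm_eq {u v : AllPerm} {c : List ℕ}
    (h : IsShuffle u.1 (toWord u) (shiftWord u v) c) : ∃ ζ, toWord (shufflePerm u v ζ) = c := by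
  have hperm : (toWord u ++ shiftWord u v).Perm c := by
    rw [← h.1, ← h.2]
    have := List.filter_append_perm (fun x => decide (x < u.1)) c
    have e : (fun x => decide (u.1 ≤ x)) = fun x => !decide (x < u.1) := by
      funext x
      rw [← decide_not, decide_eq_decide, not_lt]
    rw [e]
    exact this
  have hlen : c.length = u.1 + v.1 := by
    rw [← hperm.length_eq]
    simp [length_toWord, shiftWord]
  have hnodup : c.Nodup := by
    rw [← hperm.nodup_iff, List.nodup_append]
    refine ⟨nodup_toWord u, (nodup_toWord v).map (add_right_injective _), ?_⟩
    intro x hx y hy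
    have h1 := lt_of_mem_toWord hx
    have h2 := le_of_mem_shiftWord hy
    omega
  obtain ⟨p, hp⟩ := exists_toWord_eq hlen hnodup (by
    intro x hx
    rw [← hperm.mem_iff, List.mem_append] at hx
    rcases hx with hx | hx
    · have := lt_of_mem_toWord hx
      omega
    · obtain ⟨y, hy, rfl⟩ := List.mem_map.1 hx
      have := lt_of_mem_toWord hy
      omega)
  refine ⟨p⁻¹ * block u.2 v.2, ?_⟩
  rw [← hp, shufflePerm]
  simp

open scoped Classical in
theorem sum_single_toWord {K : Type u} [Field K] (u v : AllPerm)
    (P : Equiv.Perm (Fin (u.1 + v.1)) → Prop) [DecidablePred P]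
    (Q : List ℕ → Prop) (hPQ : ∀ ζ ∈ shuffles u.1 v.1, P ζ ↔ Q (toWord (shufflePerm u v ζ)))
    (z : Words K)
    (hz : ∀ c, z c = if IsShuffle u.1 (toWord u) (shiftWord u v) c ∧ Q c then 1 else 0) :
    ∑ ζ ∈ (shuffles u.1 v.1).filter P, Finsupp.single (toWord (shufflePerm u v ζ)) 1 = z := by
  ext c
  rw [Finsupp.finsetSum_apply, hz]
  simp only [Finsupp.single_apply]
  split_ifs with h
  · obtain ⟨ζ, hζ⟩ := exists_shufflePerm_eq h.1
    subst hζ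
    have hmem : ζ ∈ shuffles u.1 v.1 := (mem_shuffles_iff u v ζ).2 h.1
    rw [Finset.sum_eq_single_of_mem ζ (by simp [hmem, hPQ ζ hmem, h.2])]
    · simp
    · intro ζ' _ hne
      rw [if_neg]
      intro h'
      exact hne (shufflePerm_injective u v (toWord_injective h'))
  · refine Finset.sum_eq_zero fun ζ hζ => ?_
    rw [if_neg]
    rintro rfl
    rw [Finset.mem_filter] at hζ
    exact h ⟨(mem_shuffles_iff u v ζ).1 hζ.1, (hPQ ζ hζ.1).1 hζ.2⟩

theorem sum_shuffles {K : Type u} [Field K] (u v : AllPerm) :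
    ∑ ζ ∈ shuffles u.1 v.1, Finsupp.single (toWord (shufflePerm u v ζ)) (1 : K) =
      shuffleWord K (toWord u) (shiftWord u v) := by
  classical
  have := sum_single_toWord (K := K) u v (fun _ => True) (fun _ => True) (by simp)
    (shuffleWord K (toWord u) (shiftWord u v)) (fun c => by
      rw [shuffleWord_apply (n := u.1) (fun x => lt_of_mem_toWord)
        (fun x => le_of_mem_shiftWord)]
      simp)
  simpa using this

/-- The last letter of a shuffle of two words is the last letter of one of them. -/
theorem shuffle_last {n m : ℕ} {ζ : Equiv.Perm (Fin (n + m))} (hζ : ζ ∈ shuffles n m)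
    {l : Fin (n + m)} (hl : (l : ℕ) + 1 = n + m) :
    ((ζ⁻¹ l : ℕ) < n ∧ (ζ⁻¹ l : ℕ) + 1 = n) ∨ (n ≤ (ζ⁻¹ l : ℕ) ∧ (ζ⁻¹ l : ℕ) + 1 = n + m) := by
  have hζ' : StrictMono (fun i : Fin n => ζ (Fin.castAdd m i)) ∧
    StrictMono (fun j : Fin m => ζ (Fin.natAdd n j)) := by simpa [shuffles] using hζ
  obtain ⟨x, rfl⟩ : ∃ x, l = ζ x := ⟨ζ⁻¹ l, by simp⟩
  rw [Equiv.Perm.inv_def, Equiv.symm_apply_apply]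
  revert hl
  refine Fin.addCases (fun i => ?_) (fun i => ?_) x
  · intro hl
    left
    have := val_add_one_eq_of_strictMono hζ'.1 hl
    simpa using this
  · intro hl
    right
    have := val_add_one_eq_of_strictMono hζ'.2 hl
    simp only [Fin.val_natAdd]
    omega

open scoped Classical in
theorem sum_half_shuffles {K : Type u} [Field K] (u v : AllPerm) :
    ∑ ζ ∈ (shuffles u.1 v.1).filter fun ζ => 1 ≤ u.1 ∧
        ∀ l : Fin (u.1 + v.1), (l : ℕ) + 1 = u.1 + v.1 → (ζ⁻¹ l : ℕ) + 1 = u.1,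
      Finsupp.single (toWord (shufflePerm u v ζ)) (1 : K) =
      halfShuffleWord K (toWord u) (shiftWord u v) := by
  refine sum_single_toWord (K := K) u v _ (fun c => ∃ x, c.head? = some x ∧ x < u.1) ?_ _
    (fun c => by
    rw [halfShuffleWord_apply (K := K) (n := u.1) (fun x => lt_of_mem_toWord)
      (fun x => le_of_mem_shiftWord)]
    congr)
  intro ζ hζ
  by_cases h0 : u.1 + v.1 = 0
  · have h1 : toWord (shufflePerm u v ζ) = [] := by
      rw [← List.length_eq_zero_iff, length_toWord]
      exact h0
    rw [h1]
    simp
    omega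
  · set l : Fin (u.1 + v.1) := ⟨u.1 + v.1 - 1, by omega⟩ with hl
    have hl' : (l : ℕ) + 1 = u.1 + v.1 := by simp [hl]; omega
    have h1 : (toWord (shufflePerm u v ζ)).head? = some (block u.2 v.2 (ζ⁻¹ l) : ℕ) := by
      rw [List.head?_eq_getElem?, List.getElem?_eq_getElem (by
        rw [length_toWord]; exact Nat.pos_of_ne_zero h0)]
      simp only [toWord, List.getElem_ofFn, shufflePerm]
      rfl
    rw [h1]
    simp only [Option.some.injEq, exists_eq_left', block_lt_iff]
    constructor
    · rintro ⟨-, h⟩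
      have := h l hl'
      omega
    · intro h
      refine ⟨by omega, fun l' hl'' => ?_⟩
      have : l' = l := by
        ext
        omega
      subst this
      rcases shuffle_last hζ hl' with h' | h' <;> omega

end Shuffles

/-! ### `FQSym` as a quotient of words -/

section FQSymWords

variable {K : Type u} [Field K]

local notation "𝐞" a:max => (Finsupp.single a (1 : K) : Words K)

variable (K) in
open scoped Classical in
/-- The Hopf algebra operations of `FQSym` and the extensions of `≺` and `Δ_≺`. -/
def fqsymUnital : UnitalOps K (FQSym K) where
  toHopfOps := fqsymHopf K
  prec := bilin K fun u v =>
    ∑ ζ ∈ (shuffles u.1 v.1).filter fun ζ => 1 ≤ u.1 ∧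
        ∀ l : Fin (u.1 + v.1), (l : ℕ) + 1 = u.1 + v.1 → (ζ⁻¹ l : ℕ) + 1 = u.1,
      Finsupp.single (shufflePerm u v ζ) 1
  dprec := Finsupp.linearCombination K fun u =>
    ∑ i ∈ Finset.univ.filter fun i : Fin (u.1 + 1) => 1 ≤ (i : ℕ) ∧
        ∀ k : Fin u.1, (u.2 k : ℕ) + 1 = u.1 → (k : ℕ) + 1 ≤ i,
      Finsupp.single (stLeft u i) 1 ⊗ₜ[K] Finsupp.single (stRight u i) 1

variable (K) in
/-- The linear map that sends a word to the basis element of `FQSym` of its standardisation. -/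
def wstd : Words K →ₗ[K] FQSym K := Finsupp.lmapDomain K K ofWord

theorem wstd_single (a : List ℕ) : wstd K (𝐞 a) = Finsupp.single (ofWord a) 1 := by
  simp [wstd]

theorem shuffleWord_map (f : ℕ → ℕ) (a b : List ℕ) :
    shuffleWord K (a.map f) (b.map f) = Finsupp.mapDomain (List.map f) (shuffleWord K a b) := by
  have h : ∀ x, List.cons (f x) ∘ List.map f = List.map f ∘ List.cons x := fun x => rfl
  induction a generalizing b with
  | nil => simp [shuffleWord.eq_def]
  | cons x a iha =>
    induction b with
    | nil => simp [shuffleWord_nil_right]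
    | cons y b ihb =>
      have iha' := iha (y :: b)
      simp only [List.map_cons] at iha' ihb ⊢
      rw [shuffleWord.eq_def]
      simp only
      rw [iha', ihb, shuffleWord.eq_def K (x :: a) (y :: b)]
      simp only
      rw [Finsupp.mapDomain_add, ← Finsupp.mapDomain_comp, ← Finsupp.mapDomain_comp,
        ← Finsupp.mapDomain_comp, ← Finsupp.mapDomain_comp, h, h]

theorem halfShuffleWord_map (f : ℕ → ℕ) (a b : List ℕ) : halfShuffleWord K (a.map f) (b.map f) =
    Finsupp.mapDomain (List.map f) (halfShuffleWord K a b) := by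
  rcases a with _ | ⟨x, a⟩
  · simp [halfShuffleWord]
  · rw [List.map_cons, halfShuffleWord, halfShuffleWord, shuffleWord_map,
      ← Finsupp.mapDomain_comp, ← Finsupp.mapDomain_comp]
    rfl

/-- An increasing change of the letters does not change the standardisation. -/
theorem wstd_mapDomain {f : ℕ → ℕ} {a : List ℕ} (ha : a.Nodup)
    (hf : StrictMonoOn f {x | x ∈ a}) {z : Words K}
    (hz : z ∈ Finsupp.supported K K {c | c.Perm a}) :
    wstd K (Finsupp.mapDomain (List.map f) z) = wstd K z := by
  refine eqOn_supported (f := wstd K ∘ₗ Finsupp.lmapDomain K K (List.map f)) (g := wstd K)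
    (fun c hc => ?_) z hz
  have hc' : c.Perm a := hc
  simp only [LinearMap.comp_apply, Finsupp.lmapDomain_apply, Finsupp.mapDomain_single,
    wstd_single]
  rw [ofWord_map (hc'.nodup_iff.2 ha) (hf.mono fun x hx => (hc'.mem_iff).1 hx)]

theorem nodup_append_of_lt {a b : List ℕ} (ha : a.Nodup) (hb : b.Nodup)
    (hab : ∀ x ∈ a, ∀ y ∈ b, x < y) : (a ++ b).Nodup :=
  List.nodup_append.2 ⟨ha, hb, fun x hx y hy => (hab x hx y hy).ne⟩

theorem toWord_ofWord_eq_map {a b : List ℕ} (ha : a.Nodup) (hab : ∀ x ∈ a, ∀ y ∈ b, x < y) :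
    toWord (ofWord a) = a.map (rank (a ++ b)) := by
  rw [toWord_ofWord ha]
  refine List.map_congr_left fun x hx => ?_
  have : b.filter (· < x) = [] := by
    rw [List.filter_eq_nil_iff]
    intro y hy
    have := hab x hx y hy
    simp
    omega
  rw [rank, rank, List.filter_append, this, List.append_nil]

theorem shiftWord_ofWord_eq_map {a b : List ℕ} (hb : b.Nodup) (hab : ∀ x ∈ a, ∀ y ∈ b, x < y) :
    shiftWord (ofWord a) (ofWord b) = b.map (rank (a ++ b)) := by
  rw [shiftWord, toWord_ofWord hb, List.map_map]
  refine List.map_congr_left fun x hx => ?_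
  have : a.filter (· < x) = a := by
    rw [List.filter_eq_self]
    intro y hy
    simpa using hab y hy x hx
  rw [Function.comp_apply, rank, rank, List.filter_append, this, List.length_append]
  rfl

/-- If the letters of `a` are smaller than those of `b`, then the product of their standardisations
is the standardisation of their shuffle product. -/
theorem fqsym_mul_single {a b : List ℕ} (ha : a.Nodup) (hb : b.Nodup)
    (hab : ∀ x ∈ a, ∀ y ∈ b, x < y) :
    (fqsymHopf K).mul (wstd K (𝐞 a)) (wstd K (𝐞 b)) = wstd K (wmul K (𝐞 a) (𝐞 b)) := by
  rw [wstd_single, wstd_single, fqsymHopf, bilin_single, wmul, bilin_single,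
    ← wstd_mapDomain (nodup_append_of_lt ha hb hab) (rank_strictMonoOn _)
      (shuffleWord_mem_supported a b), ← shuffleWord_map, ← toWord_ofWord_eq_map ha hab,
    ← shiftWord_ofWord_eq_map hb hab, ← sum_shuffles, map_sum]
  refine Finset.sum_congr rfl fun ζ _ => ?_
  rw [wstd_single, ofWord_toWord]

theorem fqsym_prec_single {a b : List ℕ} (ha : a.Nodup) (hb : b.Nodup)
    (hab : ∀ x ∈ a, ∀ y ∈ b, x < y) :
    (fqsymUnital K).prec (wstd K (𝐞 a)) (wstd K (𝐞 b)) = wstd K (wprec K (𝐞 a) (𝐞 b)) := by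
  have h := wprec_mem_supported (K := K) a b
  rw [wprec, bilin_single] at h
  rw [wstd_single, wstd_single, fqsymUnital, bilin_single, wprec, bilin_single,
    ← wstd_mapDomain (nodup_append_of_lt ha hb hab) (rank_strictMonoOn _)
      h, ← halfShuffleWord_map, ← toWord_ofWord_eq_map ha hab,
    ← shiftWord_ofWord_eq_map hb hab, ← sum_half_shuffles, map_sum]
  refine Finset.sum_congr rfl fun ζ _ => ?_
  rw [wstd_single, ofWord_toWord]

/-- The words with distinct letters in `s`. -/
def goodWords (s : Set ℕ) : Set (List ℕ) := {c | c.Nodup ∧ ∀ x ∈ c, x ∈ s}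

theorem eqOn_supported₂ {X : Type v} {Y : Type*} {M : Type w} [AddCommMonoid M] [Module K M]
    {S : Set X} {S' : Set Y} {f g : (X →₀ K) →ₗ[K] (Y →₀ K) →ₗ[K] M}
    (h : ∀ x ∈ S, ∀ y ∈ S',
      f (Finsupp.single x 1) (Finsupp.single y 1) = g (Finsupp.single x 1) (Finsupp.single y 1))
    {z : X →₀ K} (hz : z ∈ Finsupp.supported K K S) {z' : Y →₀ K}
    (hz' : z' ∈ Finsupp.supported K K S') : f z z' = g z z' :=
  eqOn_supported (f := f.flip z') (g := g.flip z')
    (fun x hx => eqOn_supported (f := f (Finsupp.single x 1)) (g := g (Finsupp.single x 1))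
      (fun y hy => h x hx y hy) z' hz') z hz

theorem fqsym_mul_wstd {N : ℕ} {z z' : Words K}
    (hz : z ∈ Finsupp.supported K K (goodWords (Set.Iio N)))
    (hz' : z' ∈ Finsupp.supported K K (goodWords (Set.Ici N))) :
    (fqsymHopf K).mul (wstd K z) (wstd K z') = wstd K (wmul K z z') :=
  eqOn_supported₂ (f := (fqsymHopf K).mul.compl₁₂ (wstd K) (wstd K))
    (g := (wmul K).compr₂ (wstd K)) (fun _ ha _ hb => fqsym_mul_single ha.1 hb.1
      fun x hx y hy => lt_of_lt_of_le (ha.2 x hx) (hb.2 y hy)) hz hz'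

theorem fqsym_prec_wstd {N : ℕ} {z z' : Words K}
    (hz : z ∈ Finsupp.supported K K (goodWords (Set.Iio N)))
    (hz' : z' ∈ Finsupp.supported K K (goodWords (Set.Ici N))) :
    (fqsymUnital K).prec (wstd K z) (wstd K z') = wstd K (wprec K z z') :=
  eqOn_supported₂ (f := (fqsymUnital K).prec.compl₁₂ (wstd K) (wstd K))
    (g := (wprec K).compr₂ (wstd K)) (fun _ ha _ hb => fqsym_prec_single ha.1 hb.1
      fun x hx y hy => lt_of_lt_of_le (ha.2 x hx) (hb.2 y hy)) hz hz'

theorem supported_perm_le {a b : List ℕ} {s t r : Set ℕ} (ha : a ∈ goodWords s)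
    (hb : b ∈ goodWords t) (hst : ∀ x ∈ s, ∀ y ∈ t, x < y) (hs : s ⊆ r) (ht : t ⊆ r) :
    Finsupp.supported K K {c : List ℕ | c.Perm (a ++ b)} ≤
      Finsupp.supported K K (goodWords r) := by
  refine Finsupp.supported_mono fun c hc => ?_
  have hc' : c.Perm (a ++ b) := hc
  refine ⟨hc'.nodup_iff.2 (nodup_append_of_lt ha.1 hb.1
    fun x hx y hy => hst x (ha.2 x hx) y (hb.2 y hy)), fun x hx => ?_⟩
  rcases List.mem_append.1 (hc'.mem_iff.1 hx) with h | h
  · exact hs (ha.2 x h)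
  · exact ht (hb.2 x h)

/-- Each permutation is the standardisation of a word with letters `≥ N`. -/
theorem exists_goodWord (u : AllPerm) (N : ℕ) : ∃ a, a ∈ goodWords (Set.Ico N (N + u.1)) ∧
    wstd K (𝐞 a) = Finsupp.single u 1 := by
  refine ⟨(toWord u).map (N + ·), ⟨(nodup_toWord u).map (add_right_injective _), ?_⟩, ?_⟩
  · intro x hx
    obtain ⟨y, hy, rfl⟩ := List.mem_map.1 hx
    have := lt_of_mem_toWord hy
    simp
    omega
  · rw [wstd_single, ofWord_map (nodup_toWord u) (fun x _ y _ h => by simpa using h),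
      ofWord_toWord]

theorem goodWords_mono {s t : Set ℕ} (h : s ⊆ t) : goodWords s ⊆ goodWords t :=
  fun _ hc => ⟨hc.1, fun x hx => h (hc.2 x hx)⟩

theorem single_mem_goodWords {s t : Set ℕ} {a : List ℕ} (ha : a ∈ goodWords s) (h : s ⊆ t) :
    (𝐞 a) ∈ Finsupp.supported K K (goodWords t) :=
  Finsupp.single_mem_supported K 1 (goodWords_mono h ha)

/-! ### Coproducts of standardised words -/

theorem splits_eq_map (a : List ℕ) :
    splits a = (List.range (a.length + 1)).map fun j => (a.drop j, a.take j) := by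
  induction a with
  | nil => simp [splits]
  | cons x a ih =>
    rw [splits, ih, List.length_cons, List.range_succ_eq_map (n := a.length + 1)]
    simp

theorem map_wcomul_toWord {M : Type w} [AddCommMonoid M] [Module K M] (u : AllPerm)
    (f : Words K ⊗[K] Words K →ₗ[K] M) : f (wcomul K (𝐞 (toWord u))) =
    ∑ i : Fin (u.1 + 1),
      f ((𝐞 ((toWord u).drop (u.1 - i))) ⊗ₜ[K] (𝐞 ((toWord u).take (u.1 - i)))) := by
  rw [wcomul_single, map_list_sum, splits_eq_map, List.map_map, List.map_map, length_toWord,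
    Fin.sum_univ_eq_sum_range
      (fun i => f ((𝐞 ((toWord u).drop (u.1 - i))) ⊗ₜ[K] (𝐞 ((toWord u).take (u.1 - i)))))
      (u.1 + 1),
    ← Finset.sum_range_reflect]
  change ∑ j ∈ Finset.range (u.1 + 1), _ = _
  refine Finset.sum_congr rfl fun j hj => ?_
  have hj' : u.1 - (u.1 + 1 - 1 - j) = j := by
    have := Finset.mem_range.1 hj
    omega
  rw [hj']
  rfl

theorem fqsym_comul_single_toWord (u : AllPerm) : (fqsymHopf K).comul (Finsupp.single u 1) =
    TensorProduct.map (wstd K) (wstd K) (wcomul K (𝐞 (toWord u))) := by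
  rw [map_wcomul_toWord]
  simp [fqsymHopf, wstd_single, stLeft_eq, stRight_eq]

/-- The largest letter of a permutation lies in the left part of the cut at `i` if and only if it is
among the first `i` letters. -/
theorem max_mem_drop_iff (u : AllPerm) (hu : 1 ≤ u.1) (i : Fin (u.1 + 1)) :
    u.1 - 1 ∈ (toWord u).drop (u.1 - i) ↔
      (1 ≤ (i : ℕ) ∧ ∀ k : Fin u.1, (u.2 k : ℕ) + 1 = u.1 → (k : ℕ) + 1 ≤ i) := by
  rw [List.mem_drop_iff_getElem]
  constructor
  · rintro ⟨j, hj, h⟩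
    rw [length_toWord] at hj
    have hr : u.2 (Fin.rev ⟨u.1 - i + j, by omega⟩) = (u.1 - 1 : ℕ) := by
      simpa [toWord] using h
    refine ⟨by omega, fun k hk => ?_⟩
    have : k = Fin.rev ⟨u.1 - i + j, by omega⟩ := by
      apply u.2.injective
      ext
      omega
    rw [this, Fin.val_rev]
    simp
    omega
  · rintro ⟨h1, h2⟩
    set k := u.2⁻¹ ⟨u.1 - 1, by omega⟩ with hk
    have hk' : u.2 k = ⟨u.1 - 1, by omega⟩ := by simp [hk]
    have := h2 k (by rw [hk']; simp; omega)
    refine ⟨i - 1 - k, ?_, ?_⟩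
    · rw [length_toWord]
      omega
    · simp only [toWord, List.getElem_ofFn]
      have e : (Fin.rev ⟨u.1 - i + (i - 1 - k), by omega⟩ : Fin u.1) = k := by
        ext
        simp [Fin.val_rev]
        omega
      rw [e, hk']

theorem fqsym_dprec_single_toWord (u : AllPerm) (hu : 1 ≤ u.1) :
    (fqsymUnital K).dprec (Finsupp.single u 1) = TensorProduct.map (wstd K) (wstd K)
      ((wmem K (u.1 - 1)).rTensor _ (wcomul K (𝐞 (toWord u)))) := by
  classical
  rw [← LinearMap.comp_apply, map_wcomul_toWord]
  simp only [fqsymUnital, Finsupp.linearCombination_single, one_smul, Finset.sum_filter]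
  refine Finset.sum_congr rfl fun i _ => ?_
  rw [LinearMap.comp_apply, LinearMap.rTensor_tmul, wmem_single, TensorProduct.map_tmul,
    stLeft_eq, stRight_eq]
  by_cases h : u.1 - 1 ∈ (toWord u).drop (u.1 - i)
  · rw [if_pos h, if_pos ((max_mem_drop_iff u hu i).1 h), wstd_single, wstd_single]
  · rw [if_neg h, if_neg (mt (max_mem_drop_iff u hu i).2 h)]
    simp

theorem wcomul_map {f : ℕ → ℕ} (a : List ℕ) : wcomul K (𝐞 (a.map f)) =
    TensorProduct.map (Finsupp.lmapDomain K K (List.map f)) (Finsupp.lmapDomain K K (List.map f))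
      (wcomul K (𝐞 a)) := by
  rw [wcomul_single, wcomul_single, map_list_sum, splits_eq_map, splits_eq_map, List.map_map,
    List.map_map, List.map_map, List.length_map]
  congr 1
  refine List.map_congr_left fun j _ => ?_
  simp

/-- Standardisation of words without repetition respects the coproducts. -/
theorem fqsym_comul_single {a : List ℕ} (ha : a.Nodup) : (fqsymHopf K).comul (wstd K (𝐞 a)) =
    TensorProduct.map (wstd K) (wstd K) (wcomul K (𝐞 a)) := by
  rw [wstd_single, fqsym_comul_single_toWord, toWord_ofWord ha, wcomul_map,
    ← LinearMap.comp_apply, ← TensorProduct.map_comp]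
  refine eqOn_wcomul_single fun b c hbc => ?_
  have hb : b.Nodup := by rw [hbc] at ha; exact (List.nodup_append.1 ha).2.1
  have hc : c.Nodup := by rw [hbc] at ha; exact (List.nodup_append.1 ha).1
  simp only [TensorProduct.map_tmul, LinearMap.comp_apply, Finsupp.lmapDomain_apply,
    Finsupp.mapDomain_single, wstd_single]
  rw [ofWord_map hb ((rank_strictMonoOn a).mono fun x (hx : x ∈ b) => by simp [hbc, hx]),
    ofWord_map hc ((rank_strictMonoOn a).mono fun x (hx : x ∈ c) => by simp [hbc, hx])]

/-- On standardisations, `Δ_≺` consists of the cuts with the largest letter in the left part. -/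
theorem fqsym_dprec_single {a : List ℕ} (ha : a.Nodup) {M : ℕ} (hM : M ∈ a)
    (hmax : ∀ x ∈ a, x ≤ M) : (fqsymUnital K).dprec (wstd K (𝐞 a)) =
    TensorProduct.map (wstd K) (wstd K) ((wmem K M).rTensor _ (wcomul K (𝐞 a))) := by
  have hlen : 1 ≤ (ofWord a).1 := List.length_pos_of_mem hM
  have hrank : rank a M = (ofWord a).1 - 1 := by
    have h1 : rank a M < a.length := rank_lt_length hM
    have h2 : a.length - 1 ≤ rank a M := by
      have h3 : (a.erase M).Sublist (a.filter (· < M)) := by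
        rw [ha.erase_eq_filter]
        have : a.filter (· != M) = a.filter (· < M) := by
          refine List.filter_congr fun x hx => ?_
          have := hmax x hx
          rw [Bool.eq_iff_iff, bne_iff_ne, decide_eq_true_eq]
          omega
        rw [this]
      have := h3.length_le
      rwa [List.length_erase_of_mem hM] at this
    change rank a M = a.length - 1
    omega
  rw [wstd_single, fqsym_dprec_single_toWord _ hlen, toWord_ofWord ha, wcomul_map, ← hrank,
    ]
  refine eqOn_wcomul_single
    (f := TensorProduct.map (wstd K) (wstd K) ∘ₗ (wmem K (rank a M)).rTensor _ ∘ₗ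
      TensorProduct.map (Finsupp.lmapDomain K K (List.map (rank a)))
        (Finsupp.lmapDomain K K (List.map (rank a))))
    (g := TensorProduct.map (wstd K) (wstd K) ∘ₗ (wmem K M).rTensor _) fun b c hbc => ?_
  have hb : b.Nodup := by rw [hbc] at ha; exact (List.nodup_append.1 ha).2.1
  have hc : c.Nodup := by rw [hbc] at ha; exact (List.nodup_append.1 ha).1
  have hfb : StrictMonoOn (rank a) {x | x ∈ b} :=
    (rank_strictMonoOn a).mono fun x (hx : x ∈ b) => by simp [hbc, hx]
  have hfc : StrictMonoOn (rank a) {x | x ∈ c} :=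
    (rank_strictMonoOn a).mono fun x (hx : x ∈ c) => by simp [hbc, hx]
  have hmem : rank a M ∈ b.map (rank a) ↔ M ∈ b := by
    constructor
    · intro h
      obtain ⟨x, hx, hxM⟩ := List.mem_map.1 h
      rwa [← (rank_strictMonoOn a).injOn (show x ∈ a by simp [hbc, hx]) hM hxM]
    · exact fun h => List.mem_map.2 ⟨M, h, rfl⟩
  simp only [LinearMap.comp_apply, TensorProduct.map_tmul, LinearMap.rTensor_tmul,
    Finsupp.lmapDomain_apply, Finsupp.mapDomain_single]
  by_cases h : M ∈ b
  · rw [wmem_single_of_mem h, wmem_single_of_mem (hmem.2 h)]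
    simp only [wstd_single]
    rw [ofWord_map hb hfb, ofWord_map hc hfc]
  · rw [wmem_single_of_not_mem h, wmem_single_of_not_mem (mt hmem.1 h)]
    simp

theorem fqsym_comul_wstd {s : Set ℕ} {z : Words K}
    (hz : z ∈ Finsupp.supported K K (goodWords s)) : (fqsymHopf K).comul (wstd K z) =
    TensorProduct.map (wstd K) (wstd K) (wcomul K z) :=
  eqOn_supported (f := (fqsymHopf K).comul ∘ₗ wstd K)
    (g := TensorProduct.map (wstd K) (wstd K) ∘ₗ wcomul K)
    (fun _ ha => fqsym_comul_single ha.1) z hz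

theorem fqsym_dprec_wstd {a : List ℕ} (ha : a.Nodup) {M : ℕ} (hM : M ∈ a)
    (hmax : ∀ x ∈ a, x ≤ M) {z : Words K} (hz : z ∈ Finsupp.supported K K {c | c.Perm a}) :
    (fqsymUnital K).dprec (wstd K z) =
    TensorProduct.map (wstd K) (wstd K) ((wmem K M).rTensor _ (wcomul K z)) :=
  eqOn_supported (f := (fqsymUnital K).dprec ∘ₗ wstd K)
    (g := TensorProduct.map (wstd K) (wstd K) ∘ₗ (wmem K M).rTensor _ ∘ₗ wcomul K)
    (fun c hc => by
      have hc' : c.Perm a := hc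
      exact fqsym_dprec_single (hc'.nodup_iff.2 ha) (hc'.mem_iff.2 hM)
        (fun x hx => hmax x (hc'.mem_iff.1 hx))) z hz

end FQSymWords

/-! ### The bidendriform bialgebra `FQSym` -/

section FQSymAxioms

/-- The extension of `Δ_≻`. -/
abbrev UnitalOps.dsucc {K : Type u} [Field K] {H : Type v} [AddCommGroup H] [Module K H]
    (T : UnitalOps K H) : H →ₗ[K] H ⊗[K] H := T.comul - T.dprec

variable {K : Type u} [Field K]

local notation "𝐞" a:max => (Finsupp.single a (1 : K) : Words K)

local notation "SS" => TensorProduct.map (wstd K) (wstd K)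

theorem fqsym_one : (fqsymHopf K).one = wstd K (𝐞 []) := by
  rw [wstd_single]
  have : ofWord [] = ⟨0, 1⟩ := by
    rw [ofWord]
    congr 1
    exact Subsingleton.elim (α := Equiv.Perm (Fin 0)) _ _
  rw [this]
  rfl

theorem fqsym_counit (z : Words K) :
    (fqsymHopf K).counit (wstd K z) = Finsupp.lapply (R := K) [] z := by
  classical
  refine eq_of_eqOn_basis (f := (fqsymHopf K).counit ∘ₗ wstd K) (fun a => ?_) z
  simp only [LinearMap.comp_apply, wstd_single, fqsymHopf, Finsupp.linearCombination_single,
    one_smul, Finsupp.lapply_apply, Finsupp.single_apply]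
  refine if_congr ?_ rfl rfl
  exact List.length_eq_zero_iff

theorem lapply_wcons (x : ℕ) (z : Words K) :
    Finsupp.lapply (R := K) [] (wcons K x z) = 0 :=
  Finsupp.mapDomain_of_notMem_range _ _ (by simp)

theorem lapply_wmul (a b : List ℕ) : Finsupp.lapply (R := K) [] (wmul K (𝐞 a) (𝐞 b)) =
    Finsupp.lapply (R := K) [] (𝐞 a) * Finsupp.lapply (R := K) [] (𝐞 b) := by
  rcases a with _ | ⟨x, a⟩
  · simp [nil_wmul]
  rcases b with _ | ⟨y, b⟩
  · simp [wmul_nil]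
  rw [← wcons_single, ← wcons_single, wmul_wcons_wcons, map_add, lapply_wcons,
    lapply_wcons, lapply_wcons]
  simp

theorem lapply_wprec (a b : List ℕ) :
    Finsupp.lapply (R := K) [] (wprec K (𝐞 a) (𝐞 b)) = 0 := by
  rcases a with _ | ⟨x, a⟩
  · simp [nil_wprec]
  · rw [← wcons_single, wprec_wcons, lapply_wcons]

/-- Linear maps on `FQSym` can be compared on words without repetition whose letters are as large
as needed. For a multilinear identity, this makes it possible to choose words on successive
intervals of letters for the successive arguments, where products are shuffle products. -/
theorem fqsym_eq_of_words {M : Type w} [AddCommMonoid M] [Module K M] {f g : FQSym K →ₗ[K] M}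
    (N : ℕ) (h : ∀ L, N ≤ L → ∀ a ∈ goodWords (Set.Ico N L), f (wstd K (𝐞 a)) = g (wstd K (𝐞 a)))
    (x : FQSym K) : f x = g x := by
  refine eq_of_eqOn_basis (fun u => ?_) x
  obtain ⟨a, ha, hu⟩ := exists_goodWord (K := K) u N
  rw [← hu]
  exact h _ (by omega) a ha

/-- On the augmentation ideal, linear maps can be compared on nonempty words, for which the largest
letter `M` exists. -/
theorem fqsym_eq_of_words_of_counit {M : Type w} [AddCommMonoid M] [Module K M]
    {f g : FQSym K →ₗ[K] M} (N : ℕ)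
    (h : ∀ a ∈ goodWords (Set.Ici N), ∀ M ∈ a, (∀ x ∈ a, x ≤ M) →
      f (wstd K (𝐞 a)) = g (wstd K (𝐞 a)))
    {x : FQSym K} (hx : (fqsymHopf K).counit x = 0) : f x = g x := by
  have key : ∀ u : AllPerm, 1 ≤ u.1 → f (Finsupp.single u 1) = g (Finsupp.single u 1) := by
    intro u hu
    obtain ⟨a, ha, hau⟩ := exists_goodWord (K := K) u N
    have hlen : ofWord a = u := by
      rw [wstd_single] at hau
      exact Finsupp.single_left_injective one_ne_zero hau
    have hne : a.toFinset.Nonempty := by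
      rw [List.toFinset_nonempty_iff]
      rintro rfl
      rw [← hlen] at hu
      exact absurd hu (by simp [ofWord])
    obtain ⟨M, hM, hmax⟩ := Finset.exists_max_image a.toFinset id hne
    rw [← hau]
    exact h a (goodWords_mono Set.Ico_subset_Ici_self ha) M (by simpa using hM)
      (by simpa using hmax)
  have h1 : ∀ y, f (y - (fqsymHopf K).counit y • (fqsymHopf K).one) =
      g (y - (fqsymHopf K).counit y • (fqsymHopf K).one) := by
    intro y
    refine eq_of_eqOn_basis (f := f ∘ₗ (LinearMap.id -
      (fqsymHopf K).counit.smulRight (fqsymHopf K).one)) (g := g ∘ₗ (LinearMap.id -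
      (fqsymHopf K).counit.smulRight (fqsymHopf K).one)) (fun u => ?_) y
    by_cases hu : u.1 = 0
    · obtain ⟨n, σ⟩ := u
      obtain rfl : n = 0 := hu
      obtain rfl : σ = 1 := Subsingleton.elim _ _
      simp [fqsymHopf]
    · simpa [fqsymHopf, hu] using key u (by omega)
  simpa [hx] using h1 x

/-! ### Algebra axioms of `FQSym` -/

theorem single_append_mem {a b : List ℕ} {N L : ℕ} (ha : a ∈ goodWords (Set.Ico 0 N))
    (hb : b ∈ goodWords (Set.Ico N L)) (h : N ≤ L) {z : Words K}
    (hz : z ∈ Finsupp.supported K K {c : List ℕ | c.Perm (a ++ b)}) :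
    z ∈ Finsupp.supported K K (goodWords (Set.Iio L)) := by
  refine supported_perm_le ha hb (fun x hx y hy => lt_of_lt_of_le hx.2 hy.1) ?_ ?_ hz
  · exact fun x hx => lt_of_lt_of_le hx.2 h
  · exact fun x hx => hx.2

theorem single_append_mem' {b c : List ℕ} {N L P : ℕ} (hb : b ∈ goodWords (Set.Ico N L))
    (hc : c ∈ goodWords (Set.Ico L P)) (h : N ≤ L) {z : Words K}
    (hz : z ∈ Finsupp.supported K K {d : List ℕ | d.Perm (b ++ c)}) :
    z ∈ Finsupp.supported K K (goodWords (Set.Ici N)) := by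
  refine supported_perm_le hb hc (fun x hx y hy => lt_of_lt_of_le hx.2 hy.1) ?_ ?_ hz
  · exact fun x hx => hx.1
  · exact fun x hx => h.trans hx.1

theorem fqsym_mul_assoc (x y z : FQSym K) : (fqsymHopf K).mul ((fqsymHopf K).mul x y) z =
    (fqsymHopf K).mul x ((fqsymHopf K).mul y z) := by
  set m := (fqsymHopf K).mul with hm
  refine fqsym_eq_of_words 0 (f := m.flip z ∘ₗ m.flip y) (g := m.flip (m y z))
    (fun N h0 a ha => ?_) x
  refine fqsym_eq_of_words N (f := m.flip z ∘ₗ m (wstd K (𝐞 a)))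
    (g := m (wstd K (𝐞 a)) ∘ₗ m.flip z) (fun L hN b hb => ?_) y
  refine fqsym_eq_of_words L (f := m (m (wstd K (𝐞 a)) (wstd K (𝐞 b))))
    (g := m (wstd K (𝐞 a)) ∘ₗ m (wstd K (𝐞 b))) (fun P hL c hc => ?_) z
  have ha' := single_mem_goodWords (K := K) ha (t := Set.Iio N) (fun x hx => hx.2)
  have hb' := single_mem_goodWords (K := K) hb (t := Set.Ici N) (fun x hx => hx.1)
  have hb'' := single_mem_goodWords (K := K) hb (t := Set.Iio L) (fun x hx => hx.2)
  have hc' := single_mem_goodWords (K := K) hc (t := Set.Ici L) (fun x hx => hx.1)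
  simp only [LinearMap.comp_apply, hm]
  rw [fqsym_mul_wstd ha' hb', fqsym_mul_wstd hb'' hc',
    fqsym_mul_wstd (single_append_mem ha hb hN (wmul_mem_supported a b)) hc',
    fqsym_mul_wstd ha' (single_append_mem' hb hc hN (wmul_mem_supported b c)), wmul_assoc]

theorem fqsym_prec_prec (x y z : FQSym K) :
    (fqsymUnital K).prec ((fqsymUnital K).prec x y) z =
      (fqsymUnital K).prec x ((fqsymHopf K).mul y z) := by
  set m := (fqsymHopf K).mul with hm
  set p := (fqsymUnital K).prec with hp
  refine fqsym_eq_of_words 0 (f := p.flip z ∘ₗ p.flip y) (g := p.flip (m y z))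
    (fun N h0 a ha => ?_) x
  refine fqsym_eq_of_words N (f := p.flip z ∘ₗ p (wstd K (𝐞 a)))
    (g := p (wstd K (𝐞 a)) ∘ₗ m.flip z) (fun L hN b hb => ?_) y
  refine fqsym_eq_of_words L (f := p (p (wstd K (𝐞 a)) (wstd K (𝐞 b))))
    (g := p (wstd K (𝐞 a)) ∘ₗ m (wstd K (𝐞 b))) (fun P hL c hc => ?_) z
  have ha' := single_mem_goodWords (K := K) ha (t := Set.Iio N) (fun x hx => hx.2)
  have hb' := single_mem_goodWords (K := K) hb (t := Set.Ici N) (fun x hx => hx.1)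
  have hb'' := single_mem_goodWords (K := K) hb (t := Set.Iio L) (fun x hx => hx.2)
  have hc' := single_mem_goodWords (K := K) hc (t := Set.Ici L) (fun x hx => hx.1)
  simp only [LinearMap.comp_apply, hm, hp]
  rw [fqsym_prec_wstd ha' hb', fqsym_mul_wstd hb'' hc',
    fqsym_prec_wstd (single_append_mem ha hb hN (wprec_mem_supported a b)) hc',
    fqsym_prec_wstd ha' (single_append_mem' hb hc hN (wmul_mem_supported b c)), wprec_wprec]

theorem fqsym_mul_prec (x y z : FQSym K) :
    (fqsymUnital K).prec ((fqsymHopf K).mul x y) z =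
      (fqsymUnital K).prec x ((fqsymHopf K).mul y z)
        - (fqsymUnital K).prec x ((fqsymUnital K).prec y z)
        + (fqsymHopf K).mul x ((fqsymUnital K).prec y z) := by
  set m := (fqsymHopf K).mul with hm
  set p := (fqsymUnital K).prec with hp
  refine fqsym_eq_of_words 0 (f := p.flip z ∘ₗ m.flip y)
    (g := p.flip (m y z) - p.flip (p y z) + m.flip (p y z)) (fun N h0 a ha => ?_) x
  refine fqsym_eq_of_words N (f := p.flip z ∘ₗ m (wstd K (𝐞 a)))
    (g := p (wstd K (𝐞 a)) ∘ₗ m.flip z - p (wstd K (𝐞 a)) ∘ₗ p.flip z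
      + m (wstd K (𝐞 a)) ∘ₗ p.flip z) (fun L hN b hb => ?_) y
  refine fqsym_eq_of_words L (f := p (m (wstd K (𝐞 a)) (wstd K (𝐞 b))))
    (g := p (wstd K (𝐞 a)) ∘ₗ m (wstd K (𝐞 b)) - p (wstd K (𝐞 a)) ∘ₗ p (wstd K (𝐞 b))
      + m (wstd K (𝐞 a)) ∘ₗ p (wstd K (𝐞 b))) (fun P hL c hc => ?_) z
  have ha' := single_mem_goodWords (K := K) ha (t := Set.Iio N) (fun x hx => hx.2)
  have hb' := single_mem_goodWords (K := K) hb (t := Set.Ici N) (fun x hx => hx.1)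
  have hb'' := single_mem_goodWords (K := K) hb (t := Set.Iio L) (fun x hx => hx.2)
  have hc' := single_mem_goodWords (K := K) hc (t := Set.Ici L) (fun x hx => hx.1)
  have hbc := single_append_mem' hb hc hN (wprec_mem_supported (K := K) b c)
  simp only [LinearMap.comp_apply, LinearMap.add_apply, LinearMap.sub_apply, hm, hp]
  rw [fqsym_mul_wstd ha' hb', fqsym_mul_wstd hb'' hc', fqsym_prec_wstd hb'' hc',
    fqsym_prec_wstd (single_append_mem ha hb hN (wmul_mem_supported a b)) hc',
    fqsym_prec_wstd ha' (single_append_mem' hb hc hN (wmul_mem_supported b c)),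
    fqsym_prec_wstd ha' hbc, fqsym_mul_wstd ha' hbc, wmul_wprec]
  simp only [map_add, map_sub]

/-! ### Coalgebra axioms of `FQSym` -/

/-- Transport along `wstd` of `(f ⊗ id) ∘ (h ⊗ id) ∘ Δ`, where `h` selects some of the left
parts. -/
theorem rTensor_wstd {a : List ℕ} {f : FQSym K →ₗ[K] FQSym K ⊗[K] FQSym K}
    {g : Words K →ₗ[K] Words K ⊗[K] Words K} {h : Words K →ₗ[K] Words K}
    (H : ∀ b c, a = c ++ b → f (wstd K (h (𝐞 b))) = SS (g (𝐞 b))) :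
    TensorProduct.assoc K _ _ _ (f.rTensor _ (SS (h.rTensor _ (wcomul K (𝐞 a))))) =
      TensorProduct.map (wstd K) SS
        (TensorProduct.assoc K _ _ _ (g.rTensor _ (wcomul K (𝐞 a)))) := by
  have nat := LinearMap.congr_fun (TensorProduct.map_map_comp_assoc_eq (wstd K) (wstd K) (wstd K))
    (g.rTensor _ (wcomul K (𝐞 a)))
  simp only [LinearMap.comp_apply, LinearEquiv.coe_coe] at nat
  rw [nat]
  congr 1
  refine eqOn_wcomul_single (f := f.rTensor _ ∘ₗ SS ∘ₗ h.rTensor _)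
    (g := TensorProduct.map SS (wstd K) ∘ₗ g.rTensor _) fun b c hbc => ?_
  simp [H b c hbc]

/-- Transport along `wstd` of `(id ⊗ f) ∘ (h ⊗ id) ∘ Δ`, where `h` selects some of the left
parts. -/
theorem lTensor_wstd {a : List ℕ} {f : FQSym K →ₗ[K] FQSym K ⊗[K] FQSym K}
    {g : Words K →ₗ[K] Words K ⊗[K] Words K} {h : Words K →ₗ[K] Words K}
    (H : ∀ b c, a = c ++ b → wstd K (h (𝐞 b)) ⊗ₜ[K] f (wstd K (𝐞 c)) =
      wstd K (h (𝐞 b)) ⊗ₜ[K] SS (g (𝐞 c))) :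
    f.lTensor _ (SS (h.rTensor _ (wcomul K (𝐞 a)))) =
      TensorProduct.map (wstd K) SS (TensorProduct.map h g (wcomul K (𝐞 a))) := by
  refine eqOn_wcomul_single (f := f.lTensor _ ∘ₗ SS ∘ₗ h.rTensor _)
    (g := TensorProduct.map (wstd K) SS ∘ₗ TensorProduct.map h g) fun b c hbc => ?_
  simp [H b c hbc]

theorem nodup_of_append {a b c : List ℕ} (ha : a.Nodup) (h : a = c ++ b) : b.Nodup ∧ c.Nodup := by
  rw [h] at ha
  exact ⟨(List.nodup_append.1 ha).2.1, (List.nodup_append.1 ha).1⟩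

theorem fqsym_coassoc (x : FQSym K) : TensorProduct.assoc K _ _ _
    ((fqsymHopf K).comul.rTensor _ ((fqsymHopf K).comul x)) =
      (fqsymHopf K).comul.lTensor _ ((fqsymHopf K).comul x) := by
  refine fqsym_eq_of_words 0
    (f := (TensorProduct.assoc K _ _ _).toLinearMap ∘ₗ (fqsymHopf K).comul.rTensor _ ∘ₗ
      (fqsymHopf K).comul)
    (g := (fqsymHopf K).comul.lTensor _ ∘ₗ (fqsymHopf K).comul) (fun N h0 a ha => ?_) x
  simp only [LinearMap.comp_apply, LinearEquiv.coe_coe]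
  have h1 := rTensor_wstd (K := K) (a := a) (f := (fqsymHopf K).comul) (g := wcomul K)
    (h := LinearMap.id) fun b c hbc => fqsym_comul_single (nodup_of_append ha.1 hbc).1
  have h2 := lTensor_wstd (K := K) (a := a) (f := (fqsymHopf K).comul) (g := wcomul K)
    (h := LinearMap.id) fun b c hbc => by
      rw [fqsym_comul_single (nodup_of_append ha.1 hbc).2]
  rw [LinearMap.rTensor_id, LinearMap.id_apply] at h1 h2
  rw [fqsym_comul_single ha.1, h1, h2, wcoassoc]
  rfl

theorem map_assoc {A : Type v} [AddCommGroup A] [Module K A] (f g h : A →ₗ[K] A)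
    (z : (A ⊗[K] A) ⊗[K] A) : TensorProduct.map f (TensorProduct.map g h)
      (TensorProduct.assoc K A A A z) =
    TensorProduct.assoc K A A A (TensorProduct.map (TensorProduct.map f g) h z) :=
  LinearMap.congr_fun (TensorProduct.map_map_comp_assoc_eq f g h) z

theorem fqsym_dprec_dprec {a : List ℕ} (ha : a.Nodup) {M : ℕ} (hM : M ∈ a)
    (hmax : ∀ x ∈ a, x ≤ M) : TensorProduct.assoc K _ _ _
    ((fqsymUnital K).dprec.rTensor _ ((fqsymUnital K).dprec (wstd K (𝐞 a)))) =
      (fqsymHopf K).comul.lTensor _ ((fqsymUnital K).dprec (wstd K (𝐞 a))) := by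
  have h1 := rTensor_wstd (K := K) (a := a) (f := (fqsymUnital K).dprec)
    (g := (wmem K M).rTensor _ ∘ₗ wcomul K) (h := wmem K M) fun b c hbc => by
      rw [LinearMap.comp_apply]
      by_cases h : M ∈ b
      · rw [wmem_single_of_mem h, fqsym_dprec_single (nodup_of_append ha hbc).1 h
          fun x hx => hmax x (by simp [hbc, hx])]
      · rw [← rTensor_wmem_wcomul_wmem, wmem_single_of_not_mem h]
        simp
  have h2 := lTensor_wstd (K := K) (a := a) (f := (fqsymHopf K).comul) (g := wcomul K)
    (h := wmem K M) fun b c hbc => by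
      rw [fqsym_comul_single (nodup_of_append ha hbc).2]
  rw [fqsym_dprec_single ha hM hmax, h1, h2]
  congr 1
  have h3 := congrArg (TensorProduct.map (wmem K M) (TensorProduct.map LinearMap.id LinearMap.id))
    (wcoassoc (𝐞 a))
  rw [map_assoc] at h3
  rw [LinearMap.rTensor_comp, LinearMap.comp_apply]
  refine Eq.trans h3 ?_
  rw [TensorProduct.map_id, LinearMap.lTensor, ← LinearMap.comp_apply, ← TensorProduct.map_comp]
  rfl

theorem map_wstd_rTensor_id_sub (χ : Words K →ₗ[K] Words K) (z : Words K ⊗[K] Words K) :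
    SS ((LinearMap.id - χ).rTensor _ z) = SS z - SS (χ.rTensor _ z) := by
  induction z with
  | zero => simp
  | add x y hx hy => simp only [map_add, hx, hy]; abel
  | tmul x y =>
    simp only [LinearMap.rTensor_tmul, LinearMap.sub_apply, TensorProduct.sub_tmul, map_sub,
      LinearMap.id_apply]

theorem fqsym_dsucc_apply (x : FQSym K) : (fqsymUnital K).dsucc x =
    (fqsymHopf K).comul x - (fqsymUnital K).dprec x := rfl

theorem fqsym_dsucc_dprec {a : List ℕ} (ha : a.Nodup) {M : ℕ} (hM : M ∈ a)
    (hmax : ∀ x ∈ a, x ≤ M) : TensorProduct.assoc K _ _ _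
    ((fqsymUnital K).dsucc.rTensor _
      ((fqsymUnital K).dprec (wstd K (𝐞 a)))) =
      (fqsymUnital K).dprec.lTensor _
        ((fqsymHopf K).comul (wstd K (𝐞 a)) - (fqsymUnital K).dprec (wstd K (𝐞 a))) := by
  have h1 := rTensor_wstd (K := K) (a := a) (f := (fqsymUnital K).dsucc)
    (g := TensorProduct.map (LinearMap.id - wmem K M) (wmem K M) ∘ₗ wcomul K)
    (h := wmem K M) fun b c hbc => by
      rw [LinearMap.comp_apply, ← map_wmem_wcomul_wmem]
      by_cases h : M ∈ b
      · rw [wmem_single_of_mem h, fqsym_dsucc_apply,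
          fqsym_comul_single (nodup_of_append ha hbc).1,
          fqsym_dprec_single (nodup_of_append ha hbc).1 h
          fun x hx => hmax x (by simp [hbc, hx]), map_wstd_rTensor_id_sub]
      · rw [wmem_single_of_not_mem h]
        simp
  have h2 := lTensor_wstd (K := K) (a := a) (f := (fqsymUnital K).dprec)
    (g := (wmem K M).rTensor _ ∘ₗ wcomul K) (h := LinearMap.id - wmem K M) fun b c hbc => by
      by_cases h : M ∈ b
      · rw [LinearMap.sub_apply, wmem_single_of_mem h]
        simp
      · have hc : M ∈ c := by simpa [hbc, h] using hM
        rw [fqsym_dprec_single (nodup_of_append ha hbc).2 hc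
          fun x hx => hmax x (by simp [hbc, hx])]
        rfl
  have h0 : (fqsymHopf K).comul (wstd K (𝐞 a)) - (fqsymUnital K).dprec (wstd K (𝐞 a)) =
      SS ((LinearMap.id - wmem K M).rTensor _ (wcomul K (𝐞 a))) := by
    rw [fqsym_dprec_single ha hM hmax, fqsym_comul_single ha, map_wstd_rTensor_id_sub]
  rw [h0, fqsym_dprec_single ha hM hmax, h1, h2]
  congr 1
  have h3 := congrArg (TensorProduct.map (LinearMap.id - wmem K M)
    (TensorProduct.map (wmem K M) LinearMap.id)) (wcoassoc (𝐞 a))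
  rw [map_assoc] at h3
  rw [LinearMap.rTensor_comp, LinearMap.comp_apply]
  refine Eq.trans h3 ?_
  rw [LinearMap.lTensor, ← LinearMap.comp_apply, ← TensorProduct.map_comp]
  rfl

/-! ### Compatibility of products and coproducts in `FQSym` -/

/-- Transport along `wstd` of a product of coproducts, where the letters of `a` are smaller than
those of `b`, and where `h` selects some of the left parts of the second factor. -/
theorem map_wstd_map₂ {a b : List ℕ} {N : ℕ} (ha : a ∈ goodWords (Set.Iio N))
    (hb : b ∈ goodWords (Set.Ici N)) {f : Words K →ₗ[K] Words K →ₗ[K] Words K}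
    {F : FQSym K →ₗ[K] FQSym K →ₗ[K] FQSym K}
    (hF : ∀ c ∈ goodWords (Set.Iio N), ∀ d ∈ goodWords (Set.Ici N),
      F (wstd K (𝐞 c)) (wstd K (𝐞 d)) = wstd K (f (𝐞 c) (𝐞 d)))
    {h : Words K →ₗ[K] Words K} (hh : ∀ d, h (𝐞 d) = 𝐞 d ∨ h (𝐞 d) = 0) :
    SS (TensorProduct.map₂ (wmul K) f (wcomul K (𝐞 a)) (h.rTensor _ (wcomul K (𝐞 b)))) =
      TensorProduct.map₂ (fqsymHopf K).mul F (SS (wcomul K (𝐞 a)))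
        (SS (h.rTensor _ (wcomul K (𝐞 b)))) := by
  have good : ∀ {e c d : List ℕ} {s : Set ℕ}, e ∈ goodWords s → e = d ++ c →
      c ∈ goodWords s ∧ d ∈ goodWords s := by
    intro e c d s he hcd
    exact ⟨⟨(nodup_of_append he.1 hcd).1, fun x hx => he.2 x (by simp [hcd, hx])⟩,
      ⟨(nodup_of_append he.1 hcd).2, fun x hx => he.2 x (by simp [hcd, hx])⟩⟩
  refine eqOn_wcomul_single
    (f := SS ∘ₗ (TensorProduct.map₂ (wmul K) f).flip (h.rTensor _ (wcomul K (𝐞 b))))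
    (g := (TensorProduct.map₂ (fqsymHopf K).mul F).flip (SS (h.rTensor _ (wcomul K (𝐞 b)))) ∘ₗ SS)
    fun c d hcd => ?_
  simp only [LinearMap.comp_apply, LinearMap.flip_apply]
  refine eqOn_wcomul_single
    (f := SS ∘ₗ TensorProduct.map₂ (wmul K) f ((𝐞 c) ⊗ₜ[K] (𝐞 d)) ∘ₗ h.rTensor _)
    (g := TensorProduct.map₂ (fqsymHopf K).mul F (SS ((𝐞 c) ⊗ₜ[K] (𝐞 d))) ∘ₗ SS ∘ₗ h.rTensor _)
    fun c' d' hcd' => ?_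
  simp only [LinearMap.comp_apply, TensorProduct.map₂_apply_tmul, TensorProduct.map_tmul,
    LinearMap.rTensor_tmul]
  rw [hF d (good ha hcd).2 d' (good hb hcd').2]
  rcases hh c' with h' | h' <;> rw [h']
  · rw [fqsym_mul_single (good ha hcd).1.1 (good hb hcd').1.1 fun x hx y hy =>
      lt_of_lt_of_le ((good ha hcd).1.2 x hx) ((good hb hcd').1.2 y hy)]
  · simp

theorem wmem_eq_or (M : ℕ) (d : List ℕ) : wmem K M (𝐞 d) = 𝐞 d ∨ wmem K M (𝐞 d) = 0 := by
  by_cases h : M ∈ d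
  · exact Or.inl (wmem_single_of_mem h)
  · exact Or.inr (wmem_single_of_not_mem h)

theorem fqsym_mul_good {N : ℕ} {c d : List ℕ} (hc : c ∈ goodWords (Set.Iio N))
    (hd : d ∈ goodWords (Set.Ici N)) :
    (fqsymHopf K).mul (wstd K (𝐞 c)) (wstd K (𝐞 d)) = wstd K (wmul K (𝐞 c) (𝐞 d)) :=
  fqsym_mul_single hc.1 hd.1 fun x hx y hy => lt_of_lt_of_le (hc.2 x hx) (hd.2 y hy)

theorem fqsym_prec_good {N : ℕ} {c d : List ℕ} (hc : c ∈ goodWords (Set.Iio N))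
    (hd : d ∈ goodWords (Set.Ici N)) :
    (fqsymUnital K).prec (wstd K (𝐞 c)) (wstd K (𝐞 d)) = wstd K (wprec K (𝐞 c) (𝐞 d)) :=
  fqsym_prec_single hc.1 hd.1 fun x hx y hy => lt_of_lt_of_le (hc.2 x hx) (hd.2 y hy)

theorem goodWords_Iio {N L : ℕ} {c : List ℕ} (h : c ∈ goodWords (Set.Ico N L)) :
    c ∈ goodWords (Set.Iio L) :=
  goodWords_mono (fun _ hx => hx.2) h

theorem goodWords_Ici {N L : ℕ} {c : List ℕ} (h : c ∈ goodWords (Set.Ico N L)) :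
    c ∈ goodWords (Set.Ici N) :=
  goodWords_mono (fun _ hx => hx.1) h

theorem nil_mem_goodWords (s : Set ℕ) : [] ∈ goodWords s := ⟨List.nodup_nil, by simp⟩

theorem nodup_append_of_good {N : ℕ} {a b : List ℕ} (ha : a ∈ goodWords (Set.Iio N))
    (hb : b ∈ goodWords (Set.Ici N)) : (a ++ b).Nodup :=
  nodup_append_of_lt ha.1 hb.1 fun x hx y hy => lt_of_lt_of_le (ha.2 x hx) (hb.2 y hy)

theorem supported_append_le {N : ℕ} {a b : List ℕ} {z : Words K}
    (ha : a ∈ goodWords (Set.Iio N)) (hb : b ∈ goodWords (Set.Ici N))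
    (hz : z ∈ Finsupp.supported K K {c : List ℕ | c.Perm (a ++ b)}) :
    z ∈ Finsupp.supported K K (goodWords Set.univ) :=
  supported_perm_le ha hb (fun _ hx _ hy => lt_of_lt_of_le hx hy) (fun _ _ => trivial)
    (fun _ _ => trivial) hz

theorem max_append {N : ℕ} {a b : List ℕ} {M : ℕ} (ha : a ∈ goodWords (Set.Iio N))
    (hb : b ∈ goodWords (Set.Ici N)) (hM : M ∈ b) (hmax : ∀ x ∈ b, x ≤ M) :
    M ∈ a ++ b ∧ (∀ x ∈ a ++ b, x ≤ M) ∧ M ∉ a := by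
  refine ⟨by simp [hM], fun x hx => ?_, fun h => ?_⟩
  · rcases List.mem_append.1 hx with h | h
    · exact ((ha.2 x h).trans_le (hb.2 M hM)).le
    · exact hmax x h
  · exact absurd (ha.2 M h) (by simpa using hb.2 M hM)

theorem fqsym_comul_mul (x y : FQSym K) : (fqsymHopf K).comul ((fqsymHopf K).mul x y) =
    TensorProduct.map₂ (fqsymHopf K).mul (fqsymHopf K).mul ((fqsymHopf K).comul x)
      ((fqsymHopf K).comul y) := by
  refine fqsym_eq_of_words 0 (f := (fqsymHopf K).comul ∘ₗ (fqsymHopf K).mul.flip y)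
    (g := (TensorProduct.map₂ (fqsymHopf K).mul (fqsymHopf K).mul).flip
      ((fqsymHopf K).comul y) ∘ₗ (fqsymHopf K).comul) (fun L _ a ha => ?_) x
  refine fqsym_eq_of_words L (f := (fqsymHopf K).comul ∘ₗ (fqsymHopf K).mul (wstd K (𝐞 a)))
    (g := TensorProduct.map₂ (fqsymHopf K).mul (fqsymHopf K).mul
      ((fqsymHopf K).comul (wstd K (𝐞 a))) ∘ₗ (fqsymHopf K).comul) (fun P _ b hb => ?_) y
  have h := map_wstd_map₂ (K := K) (goodWords_Iio ha) (goodWords_Ici hb)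
    (fun _ hc _ hd => fqsym_mul_good hc hd) (h := LinearMap.id) fun d => Or.inl rfl
  rw [LinearMap.rTensor_id, LinearMap.id_apply] at h
  rw [LinearMap.comp_apply, LinearMap.comp_apply,
    fqsym_mul_good (goodWords_Iio ha) (goodWords_Ici hb),
    fqsym_comul_wstd (supported_append_le (goodWords_Iio ha) (goodWords_Ici hb)
      (wmul_mem_supported a b)), wcomul_wmul,
    fqsym_comul_single ha.1, fqsym_comul_single hb.1, h]

theorem fqsym_dprec_mul (x : FQSym K) {y : FQSym K} (hy : (fqsymHopf K).counit y = 0) :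
    (fqsymUnital K).dprec ((fqsymHopf K).mul x y) =
    TensorProduct.map₂ (fqsymHopf K).mul (fqsymHopf K).mul ((fqsymHopf K).comul x)
      ((fqsymUnital K).dprec y) := by
  refine fqsym_eq_of_words 0 (f := (fqsymUnital K).dprec ∘ₗ (fqsymHopf K).mul.flip y)
    (g := (TensorProduct.map₂ (fqsymHopf K).mul (fqsymHopf K).mul).flip
      ((fqsymUnital K).dprec y) ∘ₗ (fqsymHopf K).comul) (fun L _ a ha => ?_) x
  refine fqsym_eq_of_words_of_counit L
    (f := (fqsymUnital K).dprec ∘ₗ (fqsymHopf K).mul (wstd K (𝐞 a)))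
    (g := TensorProduct.map₂ (fqsymHopf K).mul (fqsymHopf K).mul
      ((fqsymHopf K).comul (wstd K (𝐞 a))) ∘ₗ (fqsymUnital K).dprec)
    (fun b hb M hM hmax => ?_) hy
  obtain ⟨h1, h2, h3⟩ := max_append (goodWords_Iio ha) hb hM hmax
  rw [LinearMap.comp_apply, LinearMap.comp_apply, fqsym_mul_good (goodWords_Iio ha) hb,
    fqsym_dprec_wstd (nodup_append_of_good (goodWords_Iio ha) hb) h1 h2
      (wmul_mem_supported a b), wcomul_wmul,
    rTensor_wmem_map₂ h3, fqsym_comul_single ha.1, fqsym_dprec_single hb.1 hM hmax,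
    map_wstd_map₂ (goodWords_Iio ha) hb (fun _ hc _ hd => fqsym_mul_good hc hd) (wmem_eq_or M)]

theorem fqsym_comul_prec (x y : FQSym K) : (fqsymHopf K).comul ((fqsymUnital K).prec x y) =
    TensorProduct.map₂ (fqsymHopf K).mul (fqsymUnital K).prec ((fqsymHopf K).comul x)
      ((fqsymHopf K).comul y) + (fqsymUnital K).prec x y ⊗ₜ[K] (fqsymHopf K).one := by
  refine fqsym_eq_of_words 0 (f := (fqsymHopf K).comul ∘ₗ (fqsymUnital K).prec.flip y)
    (g := (TensorProduct.map₂ (fqsymHopf K).mul (fqsymUnital K).prec).flip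
      ((fqsymHopf K).comul y) ∘ₗ (fqsymHopf K).comul +
      (TensorProduct.mk K _ _).flip (fqsymHopf K).one ∘ₗ (fqsymUnital K).prec.flip y)
    (fun L _ a ha => ?_) x
  refine fqsym_eq_of_words L (f := (fqsymHopf K).comul ∘ₗ (fqsymUnital K).prec (wstd K (𝐞 a)))
    (g := TensorProduct.map₂ (fqsymHopf K).mul (fqsymUnital K).prec
      ((fqsymHopf K).comul (wstd K (𝐞 a))) ∘ₗ (fqsymHopf K).comul +
      (TensorProduct.mk K _ _).flip (fqsymHopf K).one ∘ₗ (fqsymUnital K).prec (wstd K (𝐞 a)))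
    (fun P _ b hb => ?_) y
  have h := map_wstd_map₂ (K := K) (goodWords_Iio ha) (goodWords_Ici hb)
    (fun _ hc _ hd => fqsym_prec_good hc hd) (h := LinearMap.id) fun d => Or.inl rfl
  rw [LinearMap.rTensor_id, LinearMap.id_apply] at h
  rw [LinearMap.comp_apply, LinearMap.add_apply, LinearMap.comp_apply, LinearMap.comp_apply,
    fqsym_prec_good (goodWords_Iio ha) (goodWords_Ici hb),
    fqsym_comul_wstd (supported_append_le (goodWords_Iio ha) (goodWords_Ici hb)
      (wprec_mem_supported a b)), wcomul_wprec,
    fqsym_comul_single ha.1, fqsym_comul_single hb.1, map_add, h, fqsym_one]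
  rfl

theorem fqsym_dprec_prec (x : FQSym K) {y : FQSym K} (hy : (fqsymHopf K).counit y = 0) :
    (fqsymUnital K).dprec ((fqsymUnital K).prec x y) =
    TensorProduct.map₂ (fqsymHopf K).mul (fqsymUnital K).prec ((fqsymHopf K).comul x)
      ((fqsymUnital K).dprec y) + (fqsymUnital K).prec x y ⊗ₜ[K] (fqsymHopf K).one := by
  refine fqsym_eq_of_words 0 (f := (fqsymUnital K).dprec ∘ₗ (fqsymUnital K).prec.flip y)
    (g := (TensorProduct.map₂ (fqsymHopf K).mul (fqsymUnital K).prec).flip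
      ((fqsymUnital K).dprec y) ∘ₗ (fqsymHopf K).comul +
      (TensorProduct.mk K _ _).flip (fqsymHopf K).one ∘ₗ (fqsymUnital K).prec.flip y)
    (fun L _ a ha => ?_) x
  refine fqsym_eq_of_words_of_counit L
    (f := (fqsymUnital K).dprec ∘ₗ (fqsymUnital K).prec (wstd K (𝐞 a)))
    (g := TensorProduct.map₂ (fqsymHopf K).mul (fqsymUnital K).prec
      ((fqsymHopf K).comul (wstd K (𝐞 a))) ∘ₗ (fqsymUnital K).dprec +
      (TensorProduct.mk K _ _).flip (fqsymHopf K).one ∘ₗ (fqsymUnital K).prec (wstd K (𝐞 a)))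
    (fun b hb M hM hmax => ?_) hy
  obtain ⟨h1, h2, h3⟩ := max_append (goodWords_Iio ha) hb hM hmax
  rw [LinearMap.comp_apply, LinearMap.add_apply, LinearMap.comp_apply, LinearMap.comp_apply,
    fqsym_prec_good (goodWords_Iio ha) hb,
    fqsym_dprec_wstd (nodup_append_of_good (goodWords_Iio ha) hb) h1 h2
      (wprec_mem_supported a b), wcomul_wprec,
    map_add, map_add, LinearMap.rTensor_tmul, wmem_wprec hM,
    rTensor_wmem_map₂ h3, fqsym_comul_single ha.1, fqsym_dprec_single hb.1 hM hmax,
    map_wstd_map₂ (goodWords_Iio ha) hb (fun _ hc _ hd => fqsym_prec_good hc hd) (wmem_eq_or M),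
    fqsym_one]
  rfl

theorem fqsymUnital_isBidendriform : (fqsymUnital K).IsBidendriform := by
  have dprec_one : (fqsymUnital K).dprec (fqsymUnital K).one = 0 := by
    classical
    change (fqsymUnital K).dprec (Finsupp.single ⟨0, 1⟩ 1) = 0
    simp only [fqsymUnital, Finsupp.linearCombination_single, one_smul]
    refine Finset.sum_eq_zero fun i hi => ?_
    have h1 := (Finset.mem_filter.1 hi).2.1
    have h2 : (i : ℕ) < 0 + 1 := i.2
    omega
  have comul_one : (fqsymHopf K).comul (fqsymHopf K).one =
      (fqsymHopf K).one ⊗ₜ[K] (fqsymHopf K).one := by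
    rw [fqsym_one, fqsym_comul_single List.nodup_nil, wcomul_nil, TensorProduct.map_tmul]
  -- An identity of linear maps on `FQSym` follows from its values at `1` and at the words.
  have split : ∀ {M : Type u} [AddCommGroup M] [Module K M] {f g : FQSym K →ₗ[K] M},
      f (fqsymHopf K).one = g (fqsymHopf K).one →
      (∀ a ∈ goodWords (Set.Ici 0), ∀ M ∈ a, (∀ x ∈ a, x ≤ M) →
        f (wstd K (𝐞 a)) = g (wstd K (𝐞 a))) → ∀ x, f x = g x := by
    intro M _ _ f g h1 h2 x
    have h3 := fqsym_eq_of_words_of_counit (f := f) (g := g) 0 h2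
      (x := x - (fqsymHopf K).counit x • (fqsymHopf K).one)
      (by rw [map_sub, map_smul, fqsym_one, fqsym_counit]; simp)
    rw [map_sub, map_sub, map_smul, map_smul, h1] at h3
    exact sub_left_injective h3
  refine
    { one_mul := fun x => ?_, mul_one := fun x => ?_, mul_assoc := fqsym_mul_assoc
      coassoc := fqsym_coassoc, rTensor_counit_comul := fun x => ?_
      lTensor_counit_comul := fun x => ?_, comul_one := comul_one
      comul_mul := fun x y => ?_, counit_one := ?_, counit_mul := fun x y => ?_
      prec_one := fun x => ?_, one_prec := fun x => ?_, counit_prec := fun x y => ?_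
      prec_prec := fqsym_prec_prec, mul_prec := fqsym_mul_prec, dprec_one := dprec_one
      rTensor_counit_dprec := fun x => ?_, lTensor_counit_dprec := fun x => ?_
      dprec_dprec := fun x => ?_, dsucc_dprec := fun x => ?_, dprec_mul := fun x y hy => ?_
      comul_prec := fun x y => ?_, dprec_prec := fun x y hy => ?_ }
  · refine fqsym_eq_of_words 0 (f := (fqsymHopf K).mul (fqsymHopf K).one) (g := LinearMap.id)
      (fun L _ a ha => ?_) x
    rw [fqsym_one, fqsym_mul_good (nil_mem_goodWords _) (goodWords_Ici ha), nil_wmul]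
    rfl
  · refine fqsym_eq_of_words 0 (f := (fqsymHopf K).mul.flip (fqsymHopf K).one)
      (g := LinearMap.id) (fun L _ a ha => ?_) x
    rw [LinearMap.flip_apply, fqsym_one,
      fqsym_mul_good (goodWords_Iio ha) (nil_mem_goodWords _), wmul_nil]
    rfl
  · refine fqsym_eq_of_words 0 (f := (fqsymHopf K).counit.rTensor _ ∘ₗ (fqsymHopf K).comul)
      (g := TensorProduct.mk K _ _ 1) (fun L _ a ha => ?_) x
    have h : ∀ z, (fqsymHopf K).counit.rTensor _ (SS z) =
        (wstd K).lTensor K ((Finsupp.lapply (R := K) []).rTensor _ z) := by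
      intro z
      induction z with
      | zero => simp
      | add x y hx hy => simp only [map_add, hx, hy]
      | tmul x y => simp [fqsym_counit]
    rw [LinearMap.comp_apply, fqsym_comul_single ha.1, h, rTensor_lapply_wcomul]
    simp
  · refine fqsym_eq_of_words 0 (f := (fqsymHopf K).counit.lTensor _ ∘ₗ (fqsymHopf K).comul)
      (g := (TensorProduct.mk K _ _).flip 1) (fun L _ a ha => ?_) x
    have h : ∀ z, (fqsymHopf K).counit.lTensor _ (SS z) =
        (wstd K).rTensor K ((Finsupp.lapply (R := K) []).lTensor _ z) := by
      intro z
      induction z with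
      | zero => simp
      | add x y hx hy => simp only [map_add, hx, hy]
      | tmul x y => simp [fqsym_counit]
    rw [LinearMap.comp_apply, fqsym_comul_single ha.1, h, lTensor_lapply_wcomul]
    simp
  · exact fqsym_comul_mul x y
  · change (fqsymHopf K).counit (fqsymHopf K).one = 1
    rw [fqsym_one, fqsym_counit]
    simp
  · refine fqsym_eq_of_words 0 (f := (fqsymHopf K).counit ∘ₗ (fqsymHopf K).mul.flip y)
      (g := (fqsymHopf K).counit y • (fqsymHopf K).counit) (fun L _ a ha => ?_) x |>.trans
        (mul_comm _ _)
    refine fqsym_eq_of_words L (f := (fqsymHopf K).counit ∘ₗ (fqsymHopf K).mul (wstd K (𝐞 a)))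
      (g := (fqsymHopf K).counit (wstd K (𝐞 a)) • (fqsymHopf K).counit)
      (fun P _ b hb => ?_) y |>.trans (mul_comm _ _)
    rw [LinearMap.comp_apply, fqsym_mul_good (goodWords_Iio ha) (goodWords_Ici hb),
      LinearMap.smul_apply, fqsym_counit,
      fqsym_counit, fqsym_counit, lapply_wmul]
    rfl
  · refine fqsym_eq_of_words 0 (f := (fqsymUnital K).prec.flip (fqsymHopf K).one)
      (g := LinearMap.id - (fqsymHopf K).counit.smulRight (fqsymHopf K).one)
      (fun L _ a ha => ?_) x
    rw [LinearMap.flip_apply, fqsym_one,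
      fqsym_prec_good (goodWords_Iio ha) (nil_mem_goodWords _), wprec_nil]
    simp only [map_sub, map_smul, LinearMap.sub_apply, LinearMap.id_apply,
      LinearMap.smulRight_apply, fqsym_counit]
  · refine fqsym_eq_of_words 0 (f := (fqsymUnital K).prec (fqsymHopf K).one)
      (g := 0) (fun L _ a ha => ?_) x
    rw [fqsym_one, fqsym_prec_good (nil_mem_goodWords _) (goodWords_Ici ha), nil_wprec]
    simp
  · refine fqsym_eq_of_words 0 (f := (fqsymHopf K).counit ∘ₗ (fqsymUnital K).prec.flip y)
      (g := 0) (fun L _ a ha => ?_) x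
    refine fqsym_eq_of_words L (f := (fqsymHopf K).counit ∘ₗ (fqsymUnital K).prec (wstd K (𝐞 a)))
      (g := 0) (fun P _ b hb => ?_) y
    rw [LinearMap.comp_apply, fqsym_prec_good (goodWords_Iio ha) (goodWords_Ici hb),
      fqsym_counit, lapply_wprec]
    rfl
  · refine split (f := (fqsymHopf K).counit.rTensor _ ∘ₗ (fqsymUnital K).dprec) (g := 0)
      ?_ (fun a ha M hM hmax => ?_) x
    · rw [LinearMap.comp_apply]
      erw [dprec_one]
      simp
    · rw [LinearMap.comp_apply, fqsym_dprec_single ha.1 hM hmax]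
      refine eqOn_wcomul_single (f := (fqsymHopf K).counit.rTensor _ ∘ₗ SS ∘ₗ (wmem K M).rTensor _)
        (g := 0) fun b c hbc => ?_
      simp only [LinearMap.comp_apply, LinearMap.rTensor_tmul, TensorProduct.map_tmul,
        fqsym_counit]
      by_cases h : M ∈ b
      · rw [wmem_single_of_mem h, Finsupp.lapply_apply, Finsupp.single_eq_of_ne]
        · simp
        · rintro rfl
          simp at h
      · rw [wmem_single_of_not_mem h]
        simp
  · refine split (M := FQSym K ⊗[K] K)
      (f := (fqsymHopf K).counit.lTensor _ ∘ₗ (fqsymUnital K).dprec)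
      (g := (TensorProduct.mk K (FQSym K) K).flip 1 ∘ₗ
        (LinearMap.id - (fqsymHopf K).counit.smulRight (fqsymHopf K).one))
      ?_ (fun a ha M hM hmax => ?_) x
    · rw [LinearMap.comp_apply]
      erw [dprec_one]
      simp [fqsym_one, fqsym_counit]
    · have h : ∀ z, (fqsymHopf K).counit.lTensor _ (SS z) =
          (wstd K).rTensor K ((Finsupp.lapply (R := K) []).lTensor _ z) := by
        intro z
        induction z with
        | zero => simp
        | add x y hx hy => simp only [map_add, hx, hy]
        | tmul x y => simp [fqsym_counit]
      have h' : (Finsupp.lapply (R := K) []).lTensor _ ((wmem K M).rTensor _ (wcomul K (𝐞 a))) =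
          (wmem K M).rTensor _ ((Finsupp.lapply (R := K) []).lTensor _ (wcomul K (𝐞 a))) := by
        generalize wcomul K (𝐞 a) = z
        induction z with
        | zero => simp
        | add x y hx hy => simp only [map_add, hx, hy]
        | tmul x y => simp
      have hne : a ≠ [] := List.ne_nil_of_mem hM
      rw [LinearMap.comp_apply, fqsym_dprec_single ha.1 hM hmax, h, h', lTensor_lapply_wcomul]
      simp [wmem_single_of_mem hM, fqsym_counit, Finsupp.single_eq_of_ne hne.symm]
  · refine split (M := FQSym K ⊗[K] (FQSym K ⊗[K] FQSym K))
      (f := (TensorProduct.assoc K _ _ _).toLinearMap ∘ₗ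
        (fqsymUnital K).dprec.rTensor _ ∘ₗ (fqsymUnital K).dprec)
      (g := (fqsymHopf K).comul.lTensor _ ∘ₗ (fqsymUnital K).dprec)
      ?_ (fun a ha M hM hmax => fqsym_dprec_dprec ha.1 hM hmax) x
    have d1 : (fqsymUnital K).dprec (fqsymHopf K).one = 0 := dprec_one
    simp only [LinearMap.comp_apply, d1]
    simp
  · refine split (M := FQSym K ⊗[K] (FQSym K ⊗[K] FQSym K))
      (f := (TensorProduct.assoc K _ _ _).toLinearMap ∘ₗ
        (fqsymUnital K).dsucc.rTensor _ ∘ₗ (fqsymUnital K).dprec)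
      (g := (fqsymUnital K).dprec.lTensor _ ∘ₗ (fqsymUnital K).dsucc)
      ?_ (fun a ha M hM hmax => fqsym_dsucc_dprec ha.1 hM hmax) x
    have d1 : (fqsymUnital K).dprec (fqsymHopf K).one = 0 := dprec_one
    simp only [LinearMap.comp_apply, fqsym_dsucc_apply, d1, comul_one]
    simp [d1]
  · exact fqsym_dprec_mul x hy
  · exact fqsym_comul_prec x y
  · exact fqsym_dprec_prec x hy

end FQSymAxioms

/-! ### Augmentation ideals with a basis -/

section BasisAugmentation

variable {K : Type u} [Field K] {X : Type v}

/-- The inclusion of the span of a subset of the basis. -/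
def subsetIncl (K : Type u) [Field K] {X : Type v} (s : Set X) : (s →₀ K) →ₗ[K] (X →₀ K) :=
  Finsupp.lmapDomain K K Subtype.val

theorem subsetIncl_single (s : Set X) (x : s) (r : K) :
    subsetIncl K s (Finsupp.single x r) = Finsupp.single x.1 r := by
  simp [subsetIncl]

theorem lsubtypeDomain_single_of_mem {s : Set X} {x : X} (hx : x ∈ s) (r : K) :
    Finsupp.lsubtypeDomain (R := K) s (Finsupp.single x r) = Finsupp.single ⟨x, hx⟩ r := by
  classical
  ext y
  change (Finsupp.single x r) y.1 = _
  simp [Finsupp.single_apply, Subtype.ext_iff]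

theorem lsubtypeDomain_single_of_notMem {s : Set X} {x : X} (hx : x ∉ s) (r : K) :
    Finsupp.lsubtypeDomain (R := K) s (Finsupp.single x r) = 0 := by
  classical
  ext y
  change (Finsupp.single x r) y.1 = 0
  rw [Finsupp.single_eq_of_ne]
  rintro rfl
  exact hx y.2

/-- If the basis consists of the unit and of elements of counit `0`, then the latter are a basis of
the augmentation ideal. -/
theorem isAugmentation_of_basis {S : HopfOps K (X →₀ K)} {s : Set X} {x₀ : X}
    (hs : ∀ x, x ∈ s ↔ x ≠ x₀) (h1 : S.one = Finsupp.single x₀ 1)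
    (hc₀ : S.counit (Finsupp.single x₀ 1) = 1)
    (hc : ∀ x ∈ s, S.counit (Finsupp.single x 1) = 0) :
    S.IsAugmentation (subsetIncl K s) (Finsupp.lsubtypeDomain s) := by
  have hx₀ : x₀ ∉ s := fun h => (hs x₀).1 h rfl
  constructor
  · refine fun a => eq_of_eqOn_basis
      (f := Finsupp.lsubtypeDomain s ∘ₗ subsetIncl K s) (g := LinearMap.id) (fun x => ?_) a
    rw [LinearMap.comp_apply, subsetIncl_single, lsubtypeDomain_single_of_mem x.2]
    rfl
  · refine fun a => eq_of_eqOn_basis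
      (f := subsetIncl K s ∘ₗ Finsupp.lsubtypeDomain s)
      (g := LinearMap.id - S.counit.smulRight S.one) (fun x => ?_) a
    by_cases hx : x ∈ s
    · simp only [LinearMap.comp_apply, LinearMap.sub_apply, LinearMap.id_apply,
        LinearMap.smulRight_apply, hc x hx]
      rw [lsubtypeDomain_single_of_mem hx, subsetIncl_single]
      simp
    · obtain rfl : x = x₀ := by
        by_contra h
        exact hx ((hs x).2 h)
      simp only [LinearMap.comp_apply, LinearMap.sub_apply, LinearMap.id_apply,
        LinearMap.smulRight_apply, hc₀]
      rw [lsubtypeDomain_single_of_notMem hx, map_zero, h1, one_smul, sub_self]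
  · refine fun a => eq_of_eqOn_basis (f := S.counit ∘ₗ subsetIncl K s) (g := 0) (fun x => ?_) a
    rw [LinearMap.comp_apply, subsetIncl_single, hc x.1 x.2, LinearMap.zero_apply]
  · rw [h1, lsubtypeDomain_single_of_notMem hx₀]

theorem lsubtypeDomain_mem_gradedPart {deg : X → ℕ} (s : Set X) {n : ℕ} {a : X →₀ K}
    (ha : a ∈ gradedPart K deg n) :
    Finsupp.lsubtypeDomain (R := K) s a ∈ gradedPart K (fun x : s => deg x.1) n := by
  rw [gradedPart_eq_supported, Finsupp.mem_supported] at ha ⊢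
  intro x hx
  have h : (Finsupp.lsubtypeDomain (R := K) s a) x ≠ 0 :=
    Finsupp.mem_support_iff.1 (Finset.mem_coe.1 hx)
  exact ha (Finset.mem_coe.2 (Finsupp.mem_support_iff.2 h))

theorem subsetIncl_mem_gradedPart {deg : X → ℕ} (s : Set X) {n : ℕ} {a : s →₀ K}
    (ha : a ∈ gradedPart K (fun x : s => deg x.1) n) : subsetIncl K s a ∈ gradedPart K deg n := by
  refine (Submodule.span_le (p := (gradedPart K deg n).comap (subsetIncl K s))).2 ?_ ha
  rintro _ ⟨x, rfl, rfl⟩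
  rw [SetLike.mem_coe, Submodule.mem_comap, subsetIncl_single]
  exact single_mem_gradedPart deg x.1

theorem linearMap_mem_of_basis {N : Type w} [AddCommMonoid N] [Module K N] {deg : X → ℕ} {n : ℕ}
    {f : (X →₀ K) →ₗ[K] N} {S : Submodule K N}
    (h : ∀ x, deg x = n → f (Finsupp.single x 1) ∈ S) : ∀ a ∈ gradedPart K deg n, f a ∈ S := by
  intro a ha
  refine (Submodule.span_le (p := S.comap f)).2 ?_ ha
  rintro _ ⟨x, hx, rfl⟩
  exact h x hx

theorem linearMap_mem_of_basis₂ {N : Type w} [AddCommMonoid N] [Module K N] {deg : X → ℕ}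
    {i j : ℕ} {f : (X →₀ K) →ₗ[K] (X →₀ K) →ₗ[K] N} {S : Submodule K N}
    (h : ∀ x y, deg x = i → deg y = j → f (Finsupp.single x 1) (Finsupp.single y 1) ∈ S) :
    ∀ a ∈ gradedPart K deg i, ∀ b ∈ gradedPart K deg j, f a b ∈ S := by
  intro a ha b hb
  refine linearMap_mem_of_basis (f := f.flip b) (fun x hx => ?_) a ha
  exact linearMap_mem_of_basis (f := f (Finsupp.single x 1)) (fun y hy => h x y hx hy) b hb

theorem BidendOps.eq_of_eq {A : Type w} [AddCommGroup A] [Module K A] {S T : BidendOps K A}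
    (h1 : S.prec = T.prec) (h2 : S.succ = T.succ) (h3 : S.dprec = T.dprec)
    (h4 : S.dsucc = T.dsucc) : S = T := by
  cases S
  cases T
  simp_all

theorem UnitalOps.restrict_succ_apply {H : Type v} [AddCommGroup H] [Module K H] {A : Type w}
    [AddCommGroup A] [Module K A] (T : UnitalOps K H) (i : A →ₗ[K] H) (p : H →ₗ[K] A) (a b : A) :
    (T.restrict i p).succ a b = p (T.mul (i a) (i b)) - p (T.prec (i a) (i b)) := by
  simp [UnitalOps.restrict]

theorem UnitalOps.restrict_dsucc_apply {H : Type v} [AddCommGroup H] [Module K H] {A : Type w}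
    [AddCommGroup A] [Module K A] (T : UnitalOps K H) (i : A →ₗ[K] H) (p : H →ₗ[K] A) (a : A) :
    (T.restrict i p).dsucc a =
      TensorProduct.map p p (T.comul (i a)) - TensorProduct.map p p (T.dprec (i a)) := by
  simp [UnitalOps.restrict]

theorem bilin_ext {M : Type w} [AddCommMonoid M] [Module K M]
    {f g : (X →₀ K) →ₗ[K] (X →₀ K) →ₗ[K] M}
    (h : ∀ x y, f (Finsupp.single x 1) (Finsupp.single y 1) =
      g (Finsupp.single x 1) (Finsupp.single y 1)) : f = g := by
  ext x y
  exact h x y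

end BasisAugmentation

/-! ### The grading of `FQSym` and its augmentation ideal -/

section FQSymGraded

variable {K : Type u} [Field K]

theorem fqsym_isConnectedGraded : (fqsymHopf K).IsConnectedGraded (fqsymDegree K) := by
  classical
  constructor
  · exact single_mem_gradedPart (K := K) (X := AllPerm) Sigma.fst ⟨0, 1⟩
  · intro i j
    refine linearMap_mem_of_basis₂ (X := AllPerm) (deg := Sigma.fst) ?_
    rintro x y rfl rfl
    simp only [fqsymHopf, bilin_single]
    refine Submodule.sum_mem _ fun ζ _ => ?_
    exact single_mem_gradedPart (K := K) (X := AllPerm) Sigma.fst (shufflePerm x y ζ)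
  · intro n
    refine linearMap_mem_of_basis (X := AllPerm) (deg := Sigma.fst) ?_
    rintro x rfl
    simp only [fqsymHopf, Finsupp.linearCombination_single, one_smul]
    refine Submodule.sum_mem _ fun i _ => ?_
    refine tmul_mem_tensorDegree (i := i) (j := x.1 - i) (by omega)
      (single_mem_gradedPart (K := K) (X := AllPerm) Sigma.fst (stLeft x i))
      (single_mem_gradedPart (K := K) (X := AllPerm) Sigma.fst (stRight x i))
  · intro n hn
    refine linearMap_eqOn_gradedPart (X := AllPerm) (deg := Sigma.fst) (g := 0) ?_
    rintro x rfl
    simp [fqsymHopf, hn]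
  · refine linearMap_eqOn_gradedPart (X := AllPerm) (deg := Sigma.fst) (f := LinearMap.id)
      (g := (fqsymHopf K).counit.smulRight (fqsymHopf K).one) ?_
    rintro ⟨n, σ⟩ rfl
    obtain rfl : σ = 1 := Subsingleton.elim _ _
    simp [fqsymHopf]

theorem fqsym_isGradedHopfAlgebra : (fqsymHopf K).IsGradedHopfAlgebra (fqsymDegree K) :=
  fqsymUnital_isBidendriform.toIsBialgebra.isGradedHopfAlgebra_of_connected
    (deg := (Sigma.fst : AllPerm → ℕ)) fqsym_isConnectedGraded

theorem mem_posPerm_iff (u : AllPerm) : u ∈ posPerm ↔ u ≠ ⟨0, 1⟩ := by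
  obtain ⟨n, σ⟩ := u
  change 1 ≤ n ↔ _
  constructor
  · rintro h h'
    simp only [Sigma.mk.injEq] at h'
    omega
  · intro h
    by_contra hn
    obtain rfl : n = 0 := by omega
    exact h (by rw [Subsingleton.elim σ 1])

theorem fqsym_isAugmentation :
    (fqsymUnital K).IsAugmentation (subsetIncl K posPerm) (fqsymProj K) := by
  refine isAugmentation_of_basis mem_posPerm_iff rfl ?_ fun u hu => ?_
  · simp [fqsymUnital, fqsymHopf]
  · have : u.1 ≠ 0 := Nat.one_le_iff_ne_zero.1 hu
    simp [fqsymUnital, fqsymHopf, this]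

theorem fqsymProj_eq_zero {u : AllPerm} (h : u.1 = 0) :
    fqsymProj K (Finsupp.single u 1) = 0 :=
  lsubtypeDomain_single_of_notMem (s := posPerm) (fun hu : 1 ≤ u.1 => by omega) 1

theorem exists_max (u : AllPerm) (hu : 1 ≤ u.1) : ∃ k : Fin u.1, (u.2 k : ℕ) + 1 = u.1 := by
  refine ⟨u.2.symm ⟨u.1 - 1, by omega⟩, ?_⟩
  rw [Equiv.apply_symm_apply]
  change u.1 - 1 + 1 = u.1
  omega

/-- A shuffle satisfies exactly one of the two conditions that define `≺` and `≻`, and likewise for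
cuts, so that `≻` and `Δ_≻` are the differences of the full operations and of `≺` and `Δ_≺`. -/
theorem fqsymBidend_eq_restrict :
    fqsymBidend K = (fqsymUnital K).restrict (subsetIncl K posPerm) (fqsymProj K) := by
  classical
  have hprec : (fqsymBidend K).prec =
      ((fqsymUnital K).restrict (subsetIncl K posPerm) (fqsymProj K)).prec := by
    refine bilin_ext fun u v => ?_
    have hu : 1 ≤ u.1.1 := u.2
    simp only [fqsymBidend, UnitalOps.restrict, LinearMap.compr₂_apply, LinearMap.compl₁₂_apply,
      subsetIncl_single, fqsymUnital, bilin_single, map_sum, hu, true_and]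
  refine BidendOps.eq_of_eq hprec ?_ ?_ ?_
  · refine bilin_ext fun u v => ?_
    have hu : 1 ≤ u.1.1 := u.2
    rw [UnitalOps.restrict_succ_apply]
    simp only [fqsymBidend, subsetIncl_single, fqsymUnital, fqsymHopf, bilin_single, map_sum, hu,
      true_and]
    rw [Finset.sum_filter, Finset.sum_filter, ← Finset.sum_sub_distrib]
    refine Finset.sum_congr rfl fun ζ hζ => ?_
    let l₀ : Fin (u.1.1 + v.1.1) := ⟨u.1.1 + v.1.1 - 1, by omega⟩
    have hl₀ : (l₀ : ℕ) + 1 = u.1.1 + v.1.1 := by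
      change u.1.1 + v.1.1 - 1 + 1 = _
      omega
    have hl : ∀ k, (∀ l : Fin (u.1.1 + v.1.1), (l : ℕ) + 1 = u.1.1 + v.1.1 →
        (ζ⁻¹ l : ℕ) + 1 = k) ↔ (ζ⁻¹ l₀ : ℕ) + 1 = k := by
      refine fun k => ⟨fun h => h l₀ hl₀, fun h l hl => ?_⟩
      obtain rfl : l = l₀ := by
        ext
        omega
      exact h
    have hv : 1 ≤ v.1.1 := v.2
    rw [if_congr (hl _) rfl rfl, if_congr (hl _) rfl rfl]
    rcases shuffle_last hζ hl₀ with h | h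
    · rw [if_neg (by omega), if_pos h.2, sub_self]
    · rw [if_pos h.2, if_neg (by omega), sub_zero]
  · refine Finsupp.lhom_ext' fun u => LinearMap.ext_ring ?_
    have hu : 1 ≤ u.1.1 := u.2
    simp only [LinearMap.comp_apply, Finsupp.lsingle_apply, fqsymBidend, UnitalOps.restrict,
      subsetIncl_single, fqsymUnital, Finsupp.linearCombination_single, one_smul, map_sum,
      TensorProduct.map_tmul]
    rw [Finset.sum_filter, Finset.sum_filter]
    refine Finset.sum_congr rfl fun i _ => ?_
    obtain ⟨k, hk⟩ := exists_max u.1 hu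
    by_cases hi : (i : ℕ) < u.1.1
    · refine if_congr (and_congr_left fun h => ?_) rfl rfl
      have := h k hk
      omega
    · rw [if_neg (fun h => hi h.1), fqsymProj_eq_zero (u := stRight u.1 i)
        (by change u.1.1 - i = 0; omega), TensorProduct.tmul_zero, ite_self]
  · refine Finsupp.lhom_ext' fun u => LinearMap.ext_ring ?_
    have hu : 1 ≤ u.1.1 := u.2
    rw [LinearMap.comp_apply, LinearMap.comp_apply, UnitalOps.restrict_dsucc_apply]
    simp only [Finsupp.lsingle_apply, fqsymBidend, fqsymHopf,
      subsetIncl_single, fqsymUnital, Finsupp.linearCombination_single, one_smul, map_sum,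
      TensorProduct.map_tmul]
    rw [Finset.sum_filter, Finset.sum_filter]
    refine eq_sub_iff_add_eq.2 ?_
    rw [← Finset.sum_add_distrib]
    refine Finset.sum_congr rfl fun i _ => ?_
    obtain ⟨k, hk⟩ := exists_max u.1 hu
    have hl : ∀ P : Fin u.1.1 → Prop, (∀ l : Fin u.1.1, (u.1.2 l : ℕ) + 1 = u.1.1 → P l) ↔
        P k := by
      refine fun P => ⟨fun h => h k hk, fun h l hl => ?_⟩
      obtain rfl : l = k := by
        apply u.1.2.injective
        ext
        omega
      exact h
    by_cases hi : 1 ≤ (i : ℕ)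
    · rw [if_congr (and_congr_right fun _ => hl _) rfl rfl,
        if_congr (and_congr_right fun _ => hl _) rfl rfl]
      by_cases h : (k : ℕ) + 1 ≤ i
      · rw [if_neg (by omega), if_pos ⟨hi, h⟩, zero_add]
      · rw [if_pos ⟨hi, by omega⟩, if_neg (by omega), add_zero]
    · rw [if_neg (fun h => hi h.1), if_neg (fun h => hi h.1), fqsymProj_eq_zero (u := stLeft u.1 i)
        (by change (i : ℕ) = 0; omega), TensorProduct.zero_tmul, add_zero]

theorem fqsymBidend_isGraded :
    (fqsymBidend K).IsGradedBidendriformBialgebra (fqsymPlusDegree K) := by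
  classical
  have proj_mem : ∀ u : AllPerm, fqsymProj K (Finsupp.single u 1) ∈ fqsymPlusDegree K u.1 :=
    fun u => lsubtypeDomain_mem_gradedPart (deg := (Sigma.fst : AllPerm → ℕ)) posPerm
      (single_mem_gradedPart Sigma.fst u)
  have tensor_mem : ∀ (u : AllPerm) (i : Fin (u.1 + 1)),
      fqsymProj K (Finsupp.single (stLeft u i) 1) ⊗ₜ[K]
        fqsymProj K (Finsupp.single (stRight u i) 1) ∈ tensorDegree (fqsymPlusDegree K) u.1 :=
    fun u i => tmul_mem_tensorDegree (i := i) (j := u.1 - i) (by omega)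
      (proj_mem (stLeft u i)) (proj_mem (stRight u i))
  refine ⟨?_, isInternal_gradedPart fun u : posPerm => u.1.1, ?_, ?_, ?_, ?_⟩
  · rw [fqsymBidend_eq_restrict]
    exact fqsymUnital_isBidendriform.isBidendriformBialgebra fqsym_isAugmentation
  · intro i j
    refine linearMap_mem_of_basis₂ (deg := fun u : posPerm => u.1.1) ?_
    rintro x y rfl rfl
    simp only [fqsymBidend, bilin_single]
    exact Submodule.sum_mem _ fun ζ _ => proj_mem (shufflePerm x.1 y.1 ζ)
  · intro i j
    refine linearMap_mem_of_basis₂ (deg := fun u : posPerm => u.1.1) ?_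
    rintro x y rfl rfl
    simp only [fqsymBidend, bilin_single]
    exact Submodule.sum_mem _ fun ζ _ => proj_mem (shufflePerm x.1 y.1 ζ)
  · intro n
    refine linearMap_mem_of_basis (deg := fun u : posPerm => u.1.1) ?_
    rintro x rfl
    simp only [fqsymBidend, Finsupp.linearCombination_single, one_smul]
    exact Submodule.sum_mem _ fun i _ => tensor_mem x.1 i
  · intro n
    refine linearMap_mem_of_basis (deg := fun u : posPerm => u.1.1) ?_
    rintro x rfl
    simp only [fqsymBidend, Finsupp.linearCombination_single, one_smul]
    exact Submodule.sum_mem _ fun i _ => tensor_mem x.1 i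

end FQSymGraded

/-! ### A rigidity theorem for graded modules and comodules -/

section Rigidity

variable {K : Type u} [Field K] {X : Type v} {deg : X → ℕ}

/-- The contraction of the left factor of a tensor with the coordinate of the basis element `y`. -/
def contractLeft (K : Type u) [Field K] {X : Type v} (y : X) :
    (X →₀ K) ⊗[K] (X →₀ K) →ₗ[K] (X →₀ K) :=
  (TensorProduct.lid K _).toLinearMap ∘ₗ (Finsupp.lapply y).rTensor _

theorem contractLeft_tmul (y : X) (a b : X →₀ K) : contractLeft K y (a ⊗ₜ[K] b) = a y • b := by
  simp [contractLeft]

theorem gradedPart_zero (hdeg : ∀ x, deg x ≠ 0) : gradedPart K deg 0 = ⊥ := by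
  rw [gradedPart_eq_supported, eq_bot_iff]
  intro f hf
  rw [Finsupp.mem_supported] at hf
  rw [Submodule.mem_bot, ← Finsupp.support_eq_empty, Finset.eq_empty_iff_forall_notMem]
  exact fun x hx => hdeg x (hf hx)

theorem eqOn_tensorDegree_of_pos {N : Type*} [AddCommGroup N] [Module K N]
    (hdeg : ∀ x, deg x ≠ 0) {n : ℕ} {f g : (X →₀ K) ⊗[K] (X →₀ K) →ₗ[K] N}
    (h : ∀ i j, i + j = n → i < n → j < n → ∀ a ∈ gradedPart K deg i, ∀ b ∈ gradedPart K deg j,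
      f (a ⊗ₜ[K] b) = g (a ⊗ₜ[K] b)) :
    ∀ z ∈ tensorDegree (gradedPart K deg) n, f z = g z := by
  refine eqOn_tensorDegree fun i j hij a ha b hb => ?_
  by_cases hi : i = 0
  · subst hi
    rw [gradedPart_zero hdeg, Submodule.mem_bot] at ha
    simp [ha]
  by_cases hj : j = 0
  · subst hj
    rw [gradedPart_zero hdeg, Submodule.mem_bot] at hb
    simp [hb]
  exact h i j hij (by omega) (by omega) a ha b hb

theorem contractLeft_mem {n : ℕ} {z : (X →₀ K) ⊗[K] (X →₀ K)}
    (hz : z ∈ tensorDegree (gradedPart K deg) n) (y : X) :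
    contractLeft K y z ∈ gradedPart K deg (n - deg y) := by
  refine (tensorDegree_le (S := (gradedPart K deg (n - deg y)).comap (contractLeft K y)) ?_) hz
  intro i j hij a ha b hb
  rw [Submodule.mem_comap, contractLeft_tmul]
  by_cases hy : deg y = i
  · have : n - deg y = j := by omega
    rw [this]
    exact Submodule.smul_mem _ _ hb
  · rw [apply_eq_zero_of_mem_gradedPart ha hy, zero_smul]
    exact Submodule.zero_mem _

/-- A left action `act` and a left coaction `ρ` of the graded space `A` with basis `X` on itself,
where the coaction is coassociative with respect to `δ`, and where the action of `A` on the
elements annihilated by `ρ` is compatible with `ρ`. -/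
structure IsRigid (deg : X → ℕ) (act : (X →₀ K) →ₗ[K] (X →₀ K) →ₗ[K] (X →₀ K))
    (ρ δ : (X →₀ K) →ₗ[K] (X →₀ K) ⊗[K] (X →₀ K)) : Prop where
  deg_ne : ∀ x, deg x ≠ 0
  act_mem : ∀ i j, ∀ a ∈ gradedPart K deg i, ∀ b ∈ gradedPart K deg j,
    act a b ∈ gradedPart K deg (i + j)
  coact_mem : ∀ n, ∀ a ∈ gradedPart K deg n, ρ a ∈ tensorDegree (gradedPart K deg) n
  delta_mem : ∀ n, ∀ a ∈ gradedPart K deg n, δ a ∈ tensorDegree (gradedPart K deg) n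
  coassoc : ∀ x, TensorProduct.assoc K _ _ _ (δ.rTensor _ (ρ x)) = ρ.lTensor _ (ρ x)
  coact_act : ∀ a m, ρ m = 0 → ρ (act a m) = (act.flip m).lTensor _ (δ a) + a ⊗ₜ[K] m

variable {act : (X →₀ K) →ₗ[K] (X →₀ K) →ₗ[K] (X →₀ K)}
  {ρ δ : (X →₀ K) →ₗ[K] (X →₀ K) ⊗[K] (X →₀ K)}

/-- There is a projection `P` onto the elements annihilated by the coaction, which solves the
equation `P = id - act (id ⊗ P) ρ`. -/
theorem IsRigid.exists_projection (h : IsRigid deg act ρ δ) : ∃ P : (X →₀ K) →ₗ[K] (X →₀ K),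
    (∀ x, x = P x + TensorProduct.lift act (P.lTensor _ (ρ x))) ∧ (∀ x, ρ (P x) = 0) ∧
    (∀ m, ρ m = 0 → P m = m) ∧ ∀ a m, ρ m = 0 → P (act a m) = 0 := by
  obtain ⟨P, hP⟩ := exists_fixedPoint (K := K) deg
    (fun P : (X →₀ K) →ₗ[K] (X →₀ K) =>
      LinearMap.id - TensorProduct.lift act ∘ₗ P.lTensor _ ∘ₗ ρ) (by
    intro n f g hfg x hx
    simp only [LinearMap.sub_apply, LinearMap.comp_apply]
    congr 1
    refine eqOn_tensorDegree_of_pos (f := TensorProduct.lift act ∘ₗ f.lTensor _)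
      (g := TensorProduct.lift act ∘ₗ g.lTensor _) h.deg_ne ?_ _ (h.coact_mem n x hx)
    intro i j hij hi hj a ha b hb
    simp only [LinearMap.comp_apply, LinearMap.lTensor_tmul, hfg j hj b hb])
  set T : (X →₀ K) ⊗[K] (X →₀ K) →ₗ[K] (X →₀ K) := TensorProduct.lift act ∘ₗ P.lTensor _ with hT
  have hP' : ∀ x, P x = x - T (ρ x) := fun x => LinearMap.congr_fun hP x
  have hid : T ∘ₗ ρ + P = LinearMap.id := by
    ext1 x
    refine LinearMap.ext_ring ?_
    simp [hP']
  -- By induction, `P` has its values in the kernel of `ρ` in lower degrees, where the compatibility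
  -- of the action and the coaction applies; coassociativity then gives `ρ (T (ρ x)) = ρ x`.
  have hcomp : ρ ∘ₗ P = 0 := by
    refine linearMap_ext_gradedPart (deg := deg) fun n => ?_
    induction n using Nat.strong_induction_on with
    | _ n ih =>
      intro x hx
      have h1 : ρ (T (ρ x)) = T.lTensor _ (TensorProduct.assoc K _ _ _ (δ.rTensor _ (ρ x))) +
          P.lTensor _ (ρ x) := by
        refine eqOn_tensorDegree_of_pos (N := (X →₀ K) ⊗[K] (X →₀ K)) (f := ρ ∘ₗ T)
          (g := T.lTensor _ ∘ₗ (TensorProduct.assoc K _ _ _).toLinearMap ∘ₗ δ.rTensor _ +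
            P.lTensor _) h.deg_ne ?_ _ (h.coact_mem n x hx)
        intro i j hij hi hj a ha b hb
        have hb' : ρ (P b) = 0 := ih j hj b hb
        simp only [LinearMap.comp_apply, LinearMap.add_apply, LinearMap.lTensor_tmul,
          LinearMap.rTensor_tmul, LinearEquiv.coe_coe, hT, TensorProduct.lift.tmul,
          h.coact_act _ _ hb']
        congr 1
        generalize δ a = z
        induction z with
        | zero => simp
        | add x y hx hy => simp only [map_add, TensorProduct.add_tmul, hx, hy]
        | tmul x y => simp
      have h2 : T.lTensor _ (ρ.lTensor _ (ρ x)) + P.lTensor _ (ρ x) = ρ x := by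
        rw [← LinearMap.comp_apply, ← LinearMap.lTensor_comp, ← LinearMap.add_apply,
          ← LinearMap.lTensor_add, hid, LinearMap.lTensor_id, LinearMap.id_apply]
      rw [LinearMap.comp_apply, hP', map_sub, h1, h.coassoc, h2, sub_self, LinearMap.zero_apply]
  have hker : ∀ x, ρ (P x) = 0 := LinearMap.congr_fun hcomp
  have hfix : ∀ m, ρ m = 0 → P m = m := fun m hm => by rw [hP', hm, map_zero, sub_zero]
  refine ⟨P, fun x => ?_, hker, hfix, fun a m hm => ?_⟩
  · have := LinearMap.congr_fun hid x
    rw [LinearMap.add_apply, add_comm] at this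
    exact this.symm
  · have key : ∀ n, ∀ a ∈ gradedPart K deg n, (P ∘ₗ act.flip m) a = (0 : _ →ₗ[K] _) a := by
      intro n
      induction n using Nat.strong_induction_on with
      | _ n ih =>
        intro a ha
        have h1 : T ((act.flip m).lTensor _ (δ a)) = 0 := by
          refine eqOn_tensorDegree_of_pos (f := T ∘ₗ (act.flip m).lTensor _) (g := 0)
            h.deg_ne ?_ _ (h.delta_mem n a ha)
          intro i j hij hi hj a' ha' b hb
          have hb' : P (act b m) = 0 := ih j hj b hb
          simp [hT, hb']
        have h2 : T (a ⊗ₜ[K] m) = act a m := by simp [hT, hfix m hm]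
        rw [LinearMap.comp_apply, LinearMap.flip_apply, hP', h.coact_act _ _ hm, map_add, h1, h2,
          zero_add, sub_self, LinearMap.zero_apply]
    exact LinearMap.congr_fun (linearMap_ext_gradedPart key) a

/-- As all degrees are positive, the left factors of a tensor of degree `n` involve only basis
elements of degree less than `n`. -/
theorem IsRigid.lift_eq_sum (h : IsRigid deg act ρ δ) (P : (X →₀ K) →ₗ[K] (X →₀ K)) {n : ℕ}
    [Fintype {y // deg y < n}] :
    ∀ z ∈ tensorDegree (gradedPart K deg) n, TensorProduct.lift act (P.lTensor _ z) =
      ∑ y : {y // deg y < n}, act (Finsupp.single y.1 1) (P (contractLeft K y.1 z)) := by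
  classical
  intro z hz
  have := eqOn_tensorDegree_of_pos (f := TensorProduct.lift act ∘ₗ P.lTensor _)
    (g := ∑ y : {y // deg y < n}, act (Finsupp.single y.1 1) ∘ₗ P ∘ₗ contractLeft K y.1)
    h.deg_ne (n := n) (fun i j hij hi hj a ha b hb => ?_) z hz
  · simpa using this
  refine linearMap_eqOn_gradedPart (f := (TensorProduct.lift act ∘ₗ P.lTensor _) ∘ₗ
    (TensorProduct.mk K _ _).flip b) (g := (∑ y : {y // deg y < n},
      act (Finsupp.single y.1 1) ∘ₗ P ∘ₗ contractLeft K y.1) ∘ₗ (TensorProduct.mk K _ _).flip b)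
    (n := i) (fun x hx => ?_) a ha
  simp only [LinearMap.comp_apply, LinearMap.flip_apply, TensorProduct.mk_apply,
    LinearMap.lTensor_tmul, TensorProduct.lift.tmul, LinearMap.sum_apply, contractLeft_tmul]
  rw [Finset.sum_eq_single (⟨x, by omega⟩ : {y // deg y < n})]
  · simp
  · intro y _ hy
    rw [Finsupp.single_eq_of_ne (fun hxy => hy (Subtype.ext hxy)), zero_smul, map_zero, map_zero]
  · simp

theorem finite_deg_lt (hfin : ∀ n, {x | deg x = n}.Finite) (n : ℕ) : Finite {y // deg y < n} :=
  ((Set.finite_Iio n).biUnion fun i _ => hfin i).subset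
    (fun y (hy : deg y < n) => Set.mem_biUnion (Set.mem_Iio.2 hy) rfl)

theorem IsRigid.projection_mem (h : IsRigid deg act ρ δ) {P : (X →₀ K) →ₗ[K] (X →₀ K)}
    (hP : ∀ x, x = P x + TensorProduct.lift act (P.lTensor _ (ρ x)))
    (hfin : ∀ n, {x | deg x = n}.Finite) {C : Submodule K (X →₀ K)}
    (hact : ∀ a, ∀ m ∈ C, act a m ∈ C) (hcoact : ∀ x ∈ C, ∀ y, contractLeft K y (ρ x) ∈ C)
    (n : ℕ) : ∀ x ∈ C ⊓ gradedPart K deg n, P x ∈ C ⊓ gradedPart K deg n := by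
  induction n using Nat.strong_induction_on with
  | _ n ih =>
    intro x hx
    have := finite_deg_lt hfin n
    have := Fintype.ofFinite {y // deg y < n}
    have h1 : P x = x - TensorProduct.lift act (P.lTensor _ (ρ x)) :=
      eq_sub_of_add_eq (hP x).symm
    rw [h1, h.lift_eq_sum P _ (h.coact_mem n x hx.2)]
    refine Submodule.sub_mem _ hx (Submodule.sum_mem _ fun y _ => ?_)
    have hy := h.deg_ne y.1
    have h2 := ih (n - deg y.1) (by have := y.2; omega) _
      ⟨hcoact x hx.1 y.1, contractLeft_mem (h.coact_mem n x hx.2) y.1⟩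
    refine ⟨hact _ _ h2.1, ?_⟩
    have h3 := h.act_mem _ _ _ (single_mem_gradedPart deg y.1) _ h2.2
    rwa [Nat.add_sub_cancel' y.2.le] at h3

/-- Each element of degree `n` of `C` is the sum of an element annihilated by the coaction and of
elements `y · m`, where `m` is annihilated by the coaction. -/
theorem IsRigid.mem_of_generators (h : IsRigid deg act ρ δ)
    (hfin : ∀ n, {x | deg x = n}.Finite) {C : Submodule K (X →₀ K)}
    (hact : ∀ a, ∀ m ∈ C, act a m ∈ C) (hcoact : ∀ x ∈ C, ∀ y, contractLeft K y (ρ x) ∈ C)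
    {n : ℕ} {W : Submodule K (X →₀ K)}
    (h1 : ∀ m ∈ C ⊓ gradedPart K deg n, ρ m = 0 → m ∈ W)
    (h2 : ∀ y, deg y < n → ∀ m ∈ C ⊓ gradedPart K deg (n - deg y), ρ m = 0 →
      act (Finsupp.single y 1) m ∈ W) : ∀ x ∈ C ⊓ gradedPart K deg n, x ∈ W := by
  intro x hx
  obtain ⟨P, hP, hker, -, -⟩ := h.exists_projection
  have hmem := h.projection_mem hP hfin hact hcoact
  have := finite_deg_lt hfin n
  have := Fintype.ofFinite {y // deg y < n}
  rw [hP x, h.lift_eq_sum P _ (h.coact_mem n x hx.2)]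
  refine W.add_mem (h1 _ (hmem n x hx) (hker x)) (W.sum_mem fun y _ => ?_)
  exact h2 y.1 y.2 _ (hmem _ _
    ⟨hcoact x hx.1 y.1, contractLeft_mem (h.coact_mem n x hx.2) y.1⟩) (hker _)

theorem finiteDimensional_gradedPart (hfin : ∀ n, {x | deg x = n}.Finite) (n : ℕ) :
    FiniteDimensional K (gradedPart K deg n) := by
  refine FiniteDimensional.span_of_finite K ?_
  refine ((hfin n).image fun x => Finsupp.single x (1 : K)).subset ?_
  rintro _ ⟨x, hx, rfl⟩
  exact ⟨x, hx, rfl⟩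

/-- The dimensions of `C` are those of the free module generated by the elements of `C` that the
coaction annihilates. -/
theorem IsRigid.finrank_eq (h : IsRigid deg act ρ δ)
    (hfin : ∀ n, {x | deg x = n}.Finite) {C : Submodule K (X →₀ K)}
    (hact : ∀ a, ∀ m ∈ C, act a m ∈ C) (hcoact : ∀ x ∈ C, ∀ y, contractLeft K y (ρ x) ∈ C)
    (n : ℕ) [Fintype {y // deg y < n}] :
    Module.finrank K ↥(C ⊓ gradedPart K deg n) =
      Module.finrank K ↥(C ⊓ LinearMap.ker ρ ⊓ gradedPart K deg n) + ∑ y : {y // deg y < n},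
        Module.finrank K ↥(C ⊓ LinearMap.ker ρ ⊓ gradedPart K deg (n - deg y.1)) := by
  classical
  obtain ⟨P, hP, hker, hfix, hzero⟩ := h.exists_projection
  have hmem := h.projection_mem hP hfin hact hcoact
  have fd : ∀ n, FiniteDimensional K ↥(C ⊓ LinearMap.ker ρ ⊓ gradedPart K deg n) := fun n =>
    have := finiteDimensional_gradedPart (K := K) hfin n
    Submodule.finiteDimensional_of_le (inf_le_right : _ ≤ gradedPart K deg n)
  set E : ℕ → Submodule K (X →₀ K) := fun n => C ⊓ LinearMap.ker ρ ⊓ gradedPart K deg n with hE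
  -- The map `β` sends `(u, v)` to `u + ∑ y · v y`, where `y` runs over the basis elements.
  let β : (E n × ((y : {y // deg y < n}) → E (n - deg y.1))) →ₗ[K] (X →₀ K) :=
    (E n).subtype.coprod (LinearMap.lsum K _ K fun y : {y // deg y < n} =>
      act (Finsupp.single y.1 1) ∘ₗ (E (n - deg y.1)).subtype)
  have hβ : ∀ u v, β (u, v) =
      u.1 + ∑ y : {y // deg y < n}, act (Finsupp.single y.1 1) (v y).1 := by
    intro u v
    simp [β, LinearMap.lsum_apply]
  have free : ∀ n, Module.Free K (E n) := fun n => Module.Free.of_divisionRing K ↥(E n)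
  have hinj : Function.Injective β := by
    rw [injective_iff_map_eq_zero]
    rintro ⟨u, v⟩ huv
    rw [hβ] at huv
    -- The projection `P` recovers `u`, and `(id ⊗ P) ρ` recovers `∑ y ⊗ v y`.
    have hu : u = 0 := by
      have := congrArg P huv
      rw [map_add, map_sum, Finset.sum_eq_zero fun y _ => hzero _ _ (v y).2.1.2,
        hfix _ u.2.1.2, map_zero, add_zero] at this
      exact Subtype.ext this
    have hv : v = 0 := by
      have h0 := congrArg (fun x => P.lTensor _ (ρ x)) huv
      have h3 : ∀ y : {y // deg y < n}, P.lTensor _ (ρ (act (Finsupp.single y.1 1) (v y).1)) =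
          Finsupp.single y.1 1 ⊗ₜ[K] (v y).1 := by
        intro y
        have hm : ρ (v y).1 = 0 := (v y).2.1.2
        have h4 : ∀ z : (X →₀ K) ⊗[K] (X →₀ K),
            P.lTensor _ ((act.flip (v y).1).lTensor _ z) = 0 := by
          intro z
          induction z with
          | zero => simp
          | add x y hx hy => simp only [map_add, hx, hy, add_zero]
          | tmul a b => simp [hzero _ _ hm]
        rw [h.coact_act _ _ hm, map_add, h4, zero_add, LinearMap.lTensor_tmul, hfix _ hm]
      simp only [hu, ZeroMemClass.coe_zero, zero_add, map_sum, h3, map_zero] at h0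
      funext y
      have h5 := congrArg (contractLeft K y.1) h0
      rw [map_sum, map_zero, Finset.sum_eq_single y] at h5
      · rw [contractLeft_tmul] at h5
        exact Subtype.ext (by simpa using h5)
      · intro y' _ hy'
        rw [contractLeft_tmul, Finsupp.single_eq_of_ne (fun hxy => hy' (Subtype.ext hxy.symm)),
          zero_smul]
      · simp
    rw [hu, hv]
    rfl
  have hrange : LinearMap.range β = C ⊓ gradedPart K deg n := by
    refine le_antisymm ?_ fun x hx => ?_
    · rintro _ ⟨⟨u, v⟩, rfl⟩
      rw [hβ]
      refine Submodule.add_mem _ ⟨u.2.1.1, u.2.2⟩ (Submodule.sum_mem _ fun y _ => ?_)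
      refine ⟨hact _ _ (v y).2.1.1, ?_⟩
      have h3 := h.act_mem _ _ _ (single_mem_gradedPart deg y.1) _ (v y).2.2
      rwa [Nat.add_sub_cancel' y.2.le] at h3
    · have hE' : ∀ m, ∀ x ∈ C ⊓ gradedPart K deg m, P x ∈ E m := fun m x hx =>
        ⟨⟨(hmem m x hx).1, hker x⟩, (hmem m x hx).2⟩
      refine ⟨(⟨P x, hE' n x hx⟩, fun y => ⟨P (contractLeft K y.1 (ρ x)), hE' _ _
        ⟨hcoact x hx.1 y.1, contractLeft_mem (h.coact_mem n x hx.2) y.1⟩⟩), ?_⟩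
      rw [hβ]
      have h3 := hP x
      rw [h.lift_eq_sum P _ (h.coact_mem n x hx.2)] at h3
      exact h3.symm
  rw [← hrange, LinearMap.finrank_range_of_inj hinj, Module.finrank_prod,
    Module.finrank_pi_fintype]

end Rigidity

/-! ### Totally primitive elements of a bidendriform bialgebra -/

section TotallyPrimitive

variable {K : Type u} [Field K] {X : Type v} {deg : X → ℕ} {S : BidendOps K (X →₀ K)}

/-- The space of the totally primitive elements. -/
def BidendOps.primTot {A : Type w} [AddCommGroup A] [Module K A] (S : BidendOps K A) :
    Submodule K A :=
  LinearMap.ker S.dprec ⊓ LinearMap.ker S.dsucc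

theorem comm_mem_tensorDegree {A : Type w} [AddCommGroup A] [Module K A]
    {𝒜 : ℕ → Submodule K A} {n : ℕ} {z : A ⊗[K] A} (hz : z ∈ tensorDegree 𝒜 n) :
    TensorProduct.comm K A A z ∈ tensorDegree 𝒜 n := by
  refine (tensorDegree_le (S := (tensorDegree 𝒜 n).comap
    (TensorProduct.comm K A A).toLinearMap) ?_) hz
  intro i j hij a ha b hb
  exact tmul_mem_tensorDegree (by omega) hb ha

theorem BidendOps.IsBidendriformBialgebra.dprec_mul_of_dprec_eq_zero {A : Type w}
    [AddCommGroup A] [Module K A] {S : BidendOps K A} (hS : S.IsBidendriformBialgebra) (a : A)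
    {m : A} (hm : S.dprec m = 0) :
    S.dprec (S.mul a m) = (S.mul.flip m).rTensor A (S.dred a) + m ⊗ₜ[K] a := by
  rw [BidendOps.mul, LinearMap.add_apply, LinearMap.add_apply, map_add, hS.dprec_succ,
    hS.dprec_prec, hm]
  simp only [map_zero, add_zero, zero_add]
  rfl

/-- A bidendriform bialgebra is a free module, for its product, over the elements `m` such that
`Δ_≺(m) = 0`. -/
theorem BidendOps.IsGradedBidendriformBialgebra.isRigid_mul
    (hS : S.IsGradedBidendriformBialgebra (gradedPart K deg)) (hdeg : ∀ x, deg x ≠ 0) :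
    IsRigid deg S.mul ((TensorProduct.comm K _ _).toLinearMap ∘ₗ S.dprec)
      ((TensorProduct.comm K _ _).toLinearMap ∘ₗ S.dred) := by
  refine ⟨hdeg, fun i j a ha b hb => ?_, fun n a ha => ?_, fun n a ha => ?_, fun x => ?_,
    fun a m hm => ?_⟩
  · exact Submodule.add_mem _ (hS.prec_mem i j a ha b hb) (hS.succ_mem i j a ha b hb)
  · exact comm_mem_tensorDegree (hS.dprec_mem n a ha)
  · exact comm_mem_tensorDegree
      (Submodule.add_mem _ (hS.dprec_mem n a ha) (hS.dsucc_mem n a ha))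
  · -- Both sides are obtained from the axiom for `Δ_≺` by reversing the order of the factors.
    let rev : (X →₀ K) ⊗[K] ((X →₀ K) ⊗[K] (X →₀ K)) →ₗ[K]
        (X →₀ K) ⊗[K] ((X →₀ K) ⊗[K] (X →₀ K)) :=
      (TensorProduct.assoc K _ _ _).toLinearMap ∘ₗ
        (TensorProduct.comm K (X →₀ K) ((X →₀ K) ⊗[K] (X →₀ K))).toLinearMap ∘ₗ
        (TensorProduct.comm K (X →₀ K) (X →₀ K)).toLinearMap.lTensor _
    have h1 : ∀ z, TensorProduct.assoc K _ _ _
        (((TensorProduct.comm K _ _).toLinearMap ∘ₗ S.dred).rTensor _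
          (TensorProduct.comm K _ _ z)) = rev (S.dred.lTensor _ z) := by
      intro z
      induction z with
      | zero => simp
      | add x y hx hy => simp only [map_add, hx, hy]
      | tmul a b => simp [rev]
    have h2 : ∀ z, ((TensorProduct.comm K _ _).toLinearMap ∘ₗ S.dprec).lTensor _
          (TensorProduct.comm K _ _ z) =
        rev (TensorProduct.assoc K _ _ _ (S.dprec.rTensor _ z)) := by
      intro z
      induction z with
      | zero => simp
      | add x y hx hy => simp only [map_add, hx, hy]
      | tmul a b =>
        simp only [TensorProduct.comm_tmul, LinearMap.lTensor_tmul, LinearMap.rTensor_tmul,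
          LinearMap.comp_apply, LinearEquiv.coe_coe]
        generalize S.dprec a = y
        induction y with
        | zero => simp
        | add x y hx hy => simp only [map_add, TensorProduct.add_tmul, TensorProduct.tmul_add,
            hx, hy]
        | tmul c d => simp [rev]
    have h3 := hS.bidendriform.coalgebra.dprec_dprec x
    exact (h1 _).trans ((congrArg rev h3.symm).trans (h2 _).symm)
  · have hm' : S.dprec m = 0 := (TensorProduct.comm K _ _).map_eq_zero_iff.1 hm
    rw [LinearMap.comp_apply, hS.bidendriform.dprec_mul_of_dprec_eq_zero a hm', map_add,
      LinearMap.comp_apply]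
    simp only [LinearEquiv.coe_coe, TensorProduct.comm_tmul]
    congr 1
    generalize S.dred a = z
    induction z with
    | zero => simp
    | add x y hx hy => simp only [map_add, hx, hy]
    | tmul a b => simp

/-- A bidendriform bialgebra is a module for `≻`; the elements `m` such that `Δ_≺(m) = 0` are a
free submodule over the totally primitive elements. -/
theorem BidendOps.IsGradedBidendriformBialgebra.isRigid_succ
    (hS : S.IsGradedBidendriformBialgebra (gradedPart K deg)) (hdeg : ∀ x, deg x ≠ 0) :
    IsRigid deg S.succ S.dsucc S.dred := by
  refine ⟨hdeg, hS.succ_mem, hS.dsucc_mem, fun n a ha => ?_, fun x => ?_,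
    fun a m hm => ?_⟩
  · exact Submodule.add_mem _ (hS.dprec_mem n a ha) (hS.dsucc_mem n a ha)
  · exact hS.bidendriform.coalgebra.dsucc_dsucc x
  · rw [hS.bidendriform.dsucc_succ, hm]
    simp

theorem BidendOps.IsGradedBidendriformBialgebra.contractLeft_dsucc_mem
    (hS : S.IsGradedBidendriformBialgebra (gradedPart K deg)) :
    ∀ x ∈ LinearMap.ker S.dprec, ∀ y, contractLeft K y (S.dsucc x) ∈ LinearMap.ker S.dprec := by
  intro x hx y
  rw [LinearMap.mem_ker] at hx ⊢
  have h1 : ∀ z : (X →₀ K) ⊗[K] (X →₀ K), S.dprec (contractLeft K y z) =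
      TensorProduct.lid K _ ((Finsupp.lapply y).rTensor _ (S.dprec.lTensor _ z)) := by
    intro z
    induction z with
    | zero => simp
    | add x y hx hy => simp only [map_add, hx, hy]
    | tmul a b => simp [contractLeft_tmul]
  rw [h1, ← hS.bidendriform.coalgebra.dsucc_dprec, hx]
  simp

theorem BidendOps.IsGradedBidendriformBialgebra.succ_mem_ker_dprec
    (hS : S.IsGradedBidendriformBialgebra (gradedPart K deg)) :
    ∀ a, ∀ m ∈ LinearMap.ker S.dprec, S.succ a m ∈ LinearMap.ker S.dprec := by
  intro a m hm
  rw [LinearMap.mem_ker] at hm ⊢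
  rw [hS.bidendriform.dprec_succ, hm]
  simp

theorem ker_comm_comp (f : (X →₀ K) →ₗ[K] (X →₀ K) ⊗[K] (X →₀ K)) :
    LinearMap.ker ((TensorProduct.comm K _ _).toLinearMap ∘ₗ f) = LinearMap.ker f :=
  LinearEquiv.ker_comp _ _

/-- A graded connected bidendriform bialgebra is generated by its totally primitive elements. -/
theorem BidendOps.IsGradedBidendriformBialgebra.eq_top_of_primTot_le
    (hS : S.IsGradedBidendriformBialgebra (gradedPart K deg)) (hdeg : ∀ x, deg x ≠ 0)
    (hfin : ∀ n, {x | deg x = n}.Finite) {W : Submodule K (X →₀ K)}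
    (hV : ∀ n, S.primTot ⊓ gradedPart K deg n ≤ W)
    (hmul : ∀ a ∈ W, ∀ b ∈ W, S.mul a b ∈ W) (hsucc : ∀ a ∈ W, ∀ b ∈ W, S.succ a b ∈ W) :
    W = ⊤ := by
  have key : ∀ n, gradedPart K deg n ≤ W := by
    intro n
    induction n using Nat.strong_induction_on with
    | _ n ih =>
      have single_mem : ∀ y, deg y < n → Finsupp.single y (1 : K) ∈ W := fun y hy =>
        ih _ hy (single_mem_gradedPart deg y)
      have hU : ∀ x ∈ LinearMap.ker S.dprec ⊓ gradedPart K deg n, x ∈ W := by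
        refine (hS.isRigid_succ hdeg).mem_of_generators hfin hS.succ_mem_ker_dprec
          hS.contractLeft_dsucc_mem (fun m hm hm' => hV n ⟨⟨hm.1, hm'⟩, hm.2⟩)
          fun y hy m hm hm' => ?_
        have := hdeg y
        exact hsucc _ (single_mem y hy) _ (ih (n - deg y) (by omega) hm.2)
      intro x hx
      refine (hS.isRigid_mul hdeg).mem_of_generators hfin (C := ⊤) (fun _ _ _ => trivial)
        (fun _ _ _ => trivial) (fun m hm hm' => hU m ⟨?_, hm.2⟩) (fun y hy m hm hm' => ?_) x
        ⟨trivial, hx⟩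
      · rwa [← LinearMap.mem_ker, ker_comm_comp] at hm'
      · have := hdeg y
        exact hmul _ (single_mem y hy) _ (ih (n - deg y) (by omega) hm.2)
  rw [eq_top_iff, ← iSup_gradedPart deg]
  exact iSup_le key

/-- The Hilbert series of a family of subspaces. -/
def hilbertSeries {A : Type w} [AddCommGroup A] [Module K A] (E : ℕ → Submodule K A) :
    PowerSeries ℚ :=
  PowerSeries.mk fun n => (Module.finrank K (E n) : ℚ)

theorem sum_deg_lt (n : ℕ) [Fintype {y // deg y < n}] (g : ℕ → ℚ) (hg : g 0 = 0) :
    ∑ y : {y // deg y < n}, g (n - deg y.1) =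
      ∑ p ∈ Finset.HasAntidiagonal.antidiagonal n, ({x | deg x = p.1}.ncard : ℚ) * g p.2 := by
  classical
  rw [Finset.Nat.sum_antidiagonal_eq_sum_range_succ
    (fun i j => ({x | deg x = i}.ncard : ℚ) * g j), Finset.sum_range_succ, Nat.sub_self, hg,
    mul_zero, add_zero]
  rw [← Finset.sum_fiberwise_of_maps_to (g := fun y : {y // deg y < n} => deg y.1)
    (t := Finset.range n) (fun y _ => Finset.mem_range.2 y.2)]
  refine Finset.sum_congr rfl fun i hi => ?_
  rw [Finset.sum_congr rfl (g := fun _ => g (n - i))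
    (fun y hy => by rw [(Finset.mem_filter.1 hy).2]), Finset.sum_const, nsmul_eq_mul]
  congr 2
  rw [← Set.ncard_coe_finset, ← Set.ncard_image_of_injective _ Subtype.val_injective]
  congr 1
  ext x
  simp only [Set.mem_image, Finset.mem_coe, Finset.mem_filter, Finset.mem_univ, true_and,
    Subtype.exists, exists_and_left, exists_prop, exists_eq_right_right]
  constructor
  · exact fun h => h.1
  · exact fun h => ⟨h, by rw [show deg x = i from h]; exact Finset.mem_range.1 hi⟩

theorem finrank_gradedPart (hfin : ∀ n, {x | deg x = n}.Finite) (n : ℕ) :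
    Module.finrank K (gradedPart K deg n) = {x | deg x = n}.ncard := by
  have := (hfin n).fintype
  rw [gradedPart_eq_supported, (Finsupp.supportedEquivFinsupp {x | deg x = n}).finrank_eq,
    Module.finrank_finsupp_self, ← Nat.card_eq_fintype_card]
  rfl

/-- The Hilbert series of a rigid module is the product of that of the basis, with `1` added, and
of that of the space of the elements annihilated by the coaction. -/
theorem IsRigid.hilbertSeries_eq {act : (X →₀ K) →ₗ[K] (X →₀ K) →ₗ[K] (X →₀ K)}
    {ρ δ : (X →₀ K) →ₗ[K] (X →₀ K) ⊗[K] (X →₀ K)} (h : IsRigid deg act ρ δ)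
    (hfin : ∀ n, {x | deg x = n}.Finite) {C : Submodule K (X →₀ K)}
    (hact : ∀ a, ∀ m ∈ C, act a m ∈ C) (hcoact : ∀ x ∈ C, ∀ y, contractLeft K y (ρ x) ∈ C) :
    hilbertSeries (fun n => C ⊓ gradedPart K deg n) =
      (1 + hilbertSeries (gradedPart K deg)) *
        hilbertSeries (fun n => C ⊓ LinearMap.ker ρ ⊓ gradedPart K deg n) := by
  ext n
  have := finite_deg_lt hfin n
  have := Fintype.ofFinite {y // deg y < n}
  rw [add_mul, one_mul, map_add, PowerSeries.coeff_mul]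
  simp only [hilbertSeries, PowerSeries.coeff_mk, finrank_gradedPart hfin]
  rw [← sum_deg_lt n (fun j => (Module.finrank K
    ↥(C ⊓ LinearMap.ker ρ ⊓ gradedPart K deg j) : ℚ))]
  · rw [h.finrank_eq hfin hact hcoact n]
    push_cast
    rfl
  · rw [gradedPart_zero h.deg_ne, inf_bot_eq]
    simp

theorem BidendOps.IsGradedBidendriformBialgebra.hilbertSeries_primTot
    (hS : S.IsGradedBidendriformBialgebra (gradedPart K deg)) (hdeg : ∀ x, deg x ≠ 0)
    (hfin : ∀ n, {x | deg x = n}.Finite) : hilbertSeries (gradedPart K deg) =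
      (1 + hilbertSeries (gradedPart K deg)) ^ 2 *
        hilbertSeries (fun n => S.primTot ⊓ gradedPart K deg n) := by
  have h1 := (hS.isRigid_mul hdeg).hilbertSeries_eq hfin (C := ⊤) (fun _ _ _ => trivial)
    (fun _ _ _ => trivial)
  have h2 := (hS.isRigid_succ hdeg).hilbertSeries_eq hfin hS.succ_mem_ker_dprec
    hS.contractLeft_dsucc_mem
  simp only [top_inf_eq, ker_comm_comp] at h1
  rw [sq, mul_assoc]
  refine h1.trans ?_
  congr 1

end TotallyPrimitive

/-! ### The universal property of planar decorated trees -/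

section TreeHom

variable {K : Type u} [Field K] {H : Type w} [AddCommGroup H] [Module K H] {D : Type v}

mutual

/-- The image of a tree under the morphism that maps the vertex decorated by `d` to `q d`. -/
def UnitalOps.treeHom (T : UnitalOps K H) (q : D → H) : PTree D → H
  | .node d F => T.prec (q d) (T.forestHom q F)

/-- The image of a forest under the morphism that maps the vertex decorated by `d` to `q d`. -/
def UnitalOps.forestHom (T : UnitalOps K H) (q : D → H) : List (PTree D) → H
  | [] => T.one
  | t :: F => T.mul (T.treeHom q t) (T.forestHom q F)

end

/-- The morphism from `HTree K D` that maps the vertex decorated by `d` to `q d`. -/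
def UnitalOps.hom (T : UnitalOps K H) (q : D → H) : HTree K D →ₗ[K] H :=
  Finsupp.linearCombination K (T.forestHom q)

variable (K) in
/-- The Hopf algebra operations of `HTree K D` and the extensions of `≺` and `Δ_≺`. -/
def htreeUnital (D : Type v) : UnitalOps K (HTree K D) where
  toHopfOps := htreeHopf K D
  prec := bilin K (forestPrec K)
  dprec := Finsupp.linearCombination K fun F =>
    (((forestCuts F).filter fun c => c.right).map fun c =>
      Finsupp.single c.P 1 ⊗ₜ[K] Finsupp.single c.R 1).sum

/-- The element `x` of the augmentation ideal is totally primitive. -/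
structure UnitalOps.IsTotallyPrimitive (T : UnitalOps K H) (x : H) : Prop where
  counit_eq : T.counit x = 0
  comul_eq : T.comul x = x ⊗ₜ[K] T.one + T.one ⊗ₜ[K] x
  dprec_eq : T.dprec x = x ⊗ₜ[K] T.one

variable {T : UnitalOps K H} {q : D → H}

theorem UnitalOps.hom_single (F : Forest D) :
    T.hom q (Finsupp.single F 1) = T.forestHom q F := by
  simp [UnitalOps.hom]

theorem UnitalOps.IsBidendriform.forestHom_append (hT : T.IsBidendriform) (F G : Forest D) :
    T.forestHom q (F ++ G) = T.mul (T.forestHom q F) (T.forestHom q G) := by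
  induction F with
  | nil => rw [List.nil_append, UnitalOps.forestHom, hT.one_mul]
  | cons t F ih =>
    rw [List.cons_append, UnitalOps.forestHom, UnitalOps.forestHom, ih, hT.mul_assoc]

theorem UnitalOps.IsBidendriform.forestHom_tree (hT : T.IsBidendriform) (t : PTree D) :
    T.forestHom q [t] = T.treeHom q t := by
  rw [UnitalOps.forestHom, UnitalOps.forestHom, hT.mul_one]

theorem UnitalOps.IsBidendriform.hom_mul (hT : T.IsBidendriform) (x y : HTree K D) :
    T.hom q ((htreeHopf K D).mul x y) = T.mul (T.hom q x) (T.hom q y) := by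
  have : (htreeHopf K D).mul.compr₂ (T.hom q) = T.mul.compl₁₂ (T.hom q) (T.hom q) := by
    refine bilin_ext fun F G => ?_
    simp only [LinearMap.compr₂_apply, LinearMap.compl₁₂_apply, htreeHopf, bilin_single,
      UnitalOps.hom_single]
    exact hT.forestHom_append F G
  exact LinearMap.congr_fun₂ this x y

/-- The recursion that defines `F ≺ G` for forests holds in each bidendriform bialgebra. -/
theorem UnitalOps.IsBidendriform.hom_forestPrec (hT : T.IsBidendriform) (F G : Forest D) :
    T.hom q (forestPrec K F G) = T.prec (T.forestHom q F) (T.forestHom q G) := by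
  have h1 : ∀ (t : PTree D) (z : HTree K D),
      T.hom q (Finsupp.mapDomain (fun X => t :: X) z) = T.mul (T.treeHom q t) (T.hom q z) := by
    intro t z
    refine eq_of_eqOn_basis (f := T.hom q ∘ₗ Finsupp.lmapDomain K K (fun X => t :: X))
      (g := T.mul (T.treeHom q t) ∘ₗ T.hom q) (fun F => ?_) z
    simp only [LinearMap.comp_apply, Finsupp.lmapDomain_apply, Finsupp.mapDomain_single,
      UnitalOps.hom_single, UnitalOps.forestHom]
  have h2 : ∀ (d : D) (H' : Forest D) (z : HTree K D),
      T.hom q (Finsupp.mapDomain (fun X => [.node d (H' ++ X)]) z) =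
        T.prec (q d) (T.mul (T.forestHom q H') (T.hom q z)) := by
    intro d H' z
    refine eq_of_eqOn_basis
      (f := T.hom q ∘ₗ Finsupp.lmapDomain K K (fun X => [PTree.node d (H' ++ X)]))
      (g := T.prec (q d) ∘ₗ T.mul (T.forestHom q H') ∘ₗ T.hom q) (fun F => ?_) z
    simp only [LinearMap.comp_apply, Finsupp.lmapDomain_apply, Finsupp.mapDomain_single,
      UnitalOps.hom_single]
    rw [hT.forestHom_tree, UnitalOps.treeHom, hT.forestHom_append]
  induction F with
  | nil => rw [forestPrec, map_zero, UnitalOps.forestHom, hT.one_prec]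
  | cons t F ih =>
    obtain ⟨d, H'⟩ := t
    rw [forestPrec, map_sub, map_add, h1, h2, ih, UnitalOps.hom_single, hT.forestHom_tree,
      UnitalOps.forestHom, hT.mul_prec, UnitalOps.treeHom, UnitalOps.treeHom,
      hT.forestHom_append, hT.forestHom_append, hT.prec_prec, hT.prec_prec, hT.mul_assoc]
    abel

theorem UnitalOps.IsBidendriform.hom_prec (hT : T.IsBidendriform) (x y : HTree K D) :
    T.hom q ((htreeUnital K D).prec x y) = T.prec (T.hom q x) (T.hom q y) := by
  have : (htreeUnital K D).prec.compr₂ (T.hom q) = T.prec.compl₁₂ (T.hom q) (T.hom q) := by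
    refine bilin_ext fun F G => ?_
    simp only [LinearMap.compr₂_apply, LinearMap.compl₁₂_apply, htreeUnital, bilin_single,
      UnitalOps.hom_single]
    exact hT.hom_forestPrec F G
  exact LinearMap.congr_fun₂ this x y

theorem UnitalOps.hom_one : T.hom q (htreeHopf K D).one = T.one :=
  T.hom_single []

theorem UnitalOps.IsBidendriform.counit_forestHom (hT : T.IsBidendriform) {F : Forest D}
    (hF : F ≠ []) : T.counit (T.forestHom q F) = 0 := by
  rcases F with _ | ⟨⟨d, G⟩, F⟩
  · exact absurd rfl hF
  · rw [UnitalOps.forestHom, hT.counit_mul, UnitalOps.treeHom, hT.counit_prec, zero_mul]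

theorem UnitalOps.IsBidendriform.hom_counit (hT : T.IsBidendriform) (x : HTree K D) :
    T.counit (T.hom q x) = (htreeHopf K D).counit x := by
  refine eq_of_eqOn_basis (f := T.counit ∘ₗ T.hom q) (g := (htreeHopf K D).counit)
    (fun F => ?_) x
  rw [LinearMap.comp_apply, UnitalOps.hom_single]
  rcases F with _ | ⟨t, F⟩
  · rw [UnitalOps.forestHom, hT.counit_one]
    simp [htreeHopf]
  · rw [hT.counit_forestHom (List.cons_ne_nil _ _)]
    simp [htreeHopf]

/-! ### Coproducts of the images of forests -/

theorem UnitalOps.IsBidendriform.comul_prec_of_primitive (hT : T.IsBidendriform) {x : H}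
    (hx : T.IsTotallyPrimitive x) (y : H) :
    T.comul (T.prec x y) = T.prec x y ⊗ₜ[K] T.one + (T.prec x).lTensor H (T.comul y) := by
  have h : ∀ z, TensorProduct.map₂ T.mul T.prec (x ⊗ₜ[K] T.one + T.one ⊗ₜ[K] x) z =
      (T.prec x).lTensor H z := by
    intro z
    induction z with
    | zero => simp
    | add a b ha hb => rw [map_add, ha, hb, map_add]
    | tmul a b => simp [TensorProduct.map₂_apply_tmul, hT.one_prec, hT.one_mul]
  rw [hT.comul_prec, hx.comul_eq, h, add_comm]

theorem UnitalOps.IsBidendriform.dprec_prec_of_primitive (hT : T.IsBidendriform) {x : H}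
    (hx : T.IsTotallyPrimitive x) (y : H) :
    T.dprec (T.prec x y) = T.prec x y ⊗ₜ[K] T.one + (T.prec x).lTensor H (T.dprec y) := by
  have h : ∀ z, TensorProduct.map₂ T.mul T.prec (x ⊗ₜ[K] T.one + T.one ⊗ₜ[K] x) z =
      (T.prec x).lTensor H z := by
    intro z
    induction z with
    | zero => simp
    | add a b ha hb => rw [map_add, ha, hb, map_add]
    | tmul a b => simp [TensorProduct.map₂_apply_tmul, hT.one_prec, hT.one_mul]
  have h1 := hT.dprec_prec x (y - T.counit y • T.one)
    (by rw [map_sub, map_smul, hT.counit_one]; simp)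
  have h2 : T.prec x T.one = x := by rw [hT.prec_one, hx.counit_eq, zero_smul, sub_zero]
  rw [hx.comul_eq, h, map_sub, map_smul, map_sub, map_sub, map_smul, map_smul, h2, hx.dprec_eq,
    hT.dprec_one, smul_zero, sub_zero, TensorProduct.sub_tmul, TensorProduct.smul_tmul'] at h1
  rw [sub_eq_iff_eq_add.1 h1]
  abel

/-- The image under the morphism of `P^c ⊗ R^c`. -/
def UnitalOps.cutHom (T : UnitalOps K H) (q : D → H) (c : CutResult D) : H ⊗[K] H :=
  T.forestHom q c.P ⊗ₜ[K] T.forestHom q c.R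

/-- The image under the morphism of `P^c ⊗ R^c` if the cut `c` meets the rightmost path. -/
def UnitalOps.rightCutHom (T : UnitalOps K H) (q : D → H) (c : CutResult D) : H ⊗[K] H :=
  if c.right then T.cutHom q c else 0

theorem sum_map_flatMap {α : Type*} {β : Type*} {M : Type*} [AddCommMonoid M] (f : β → M)
    (g : α → List β) (l : List α) : ((l.flatMap g).map f).sum =
      (l.map fun a => ((g a).map f).sum).sum := by
  induction l with
  | nil => simp
  | cons a l ih => simp [ih]

theorem map₂_sum_sum {f g : H →ₗ[K] H →ₗ[K] H} {α : Type*} {β : Type*} (l : List α) (l' : List β)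
    (F : α → H ⊗[K] H) (G : β → H ⊗[K] H) :
    TensorProduct.map₂ f g (l.map F).sum (l'.map G).sum =
      (l.map fun a => (l'.map fun b => TensorProduct.map₂ f g (F a) (G b)).sum).sum := by
  induction l with
  | nil => simp
  | cons a l ih =>
    simp only [List.map_cons, List.sum_cons, map_add, LinearMap.add_apply, ih]
    rw [map_list_sum, List.map_map]
    rfl

theorem UnitalOps.IsBidendriform.map₂_cutHom (hT : T.IsBidendriform) (c c' : CutResult D)
    (b : Bool) : TensorProduct.map₂ T.mul T.mul (T.cutHom q c) (T.cutHom q c') =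
      T.cutHom q ⟨c.P ++ c'.P, c.R ++ c'.R, b⟩ := by
  simp only [UnitalOps.cutHom, TensorProduct.map₂_apply_tmul, TensorProduct.map_tmul,
    hT.forestHom_append]

mutual

theorem UnitalOps.IsBidendriform.comul_treeHom (hT : T.IsBidendriform)
    (hq : ∀ d, T.IsTotallyPrimitive (q d)) : ∀ t : PTree D,
    T.comul (T.treeHom q t) = ((treeCuts t).map (T.cutHom q)).sum
  | .node d F => by
    rw [UnitalOps.treeHom, hT.comul_prec_of_primitive (hq d), hT.comul_forestHom hq F, treeCuts,
      List.map_cons, List.sum_cons, map_list_sum, List.map_map, List.map_map]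
    congr 1
    · rw [UnitalOps.cutHom, hT.forestHom_tree, UnitalOps.treeHom, UnitalOps.forestHom]
    · congr 1
      refine List.map_congr_left fun c _ => ?_
      simp only [Function.comp_apply, UnitalOps.cutHom, LinearMap.lTensor_tmul, hT.forestHom_tree,
        UnitalOps.treeHom]

theorem UnitalOps.IsBidendriform.comul_forestHom (hT : T.IsBidendriform)
    (hq : ∀ d, T.IsTotallyPrimitive (q d)) : ∀ F : List (PTree D),
    T.comul (T.forestHom q F) = ((forestCuts F).map (T.cutHom q)).sum
  | [] => by
    rw [UnitalOps.forestHom, hT.comul_one, forestCuts]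
    simp [UnitalOps.cutHom, UnitalOps.forestHom]
  | t :: F => by
    rw [UnitalOps.forestHom, hT.comul_mul, hT.comul_treeHom hq t, hT.comul_forestHom hq F,
      map₂_sum_sum, forestCuts, sum_map_flatMap]
    congr 1
    refine List.map_congr_left fun c _ => ?_
    rw [List.map_map]
    congr 1
    refine List.map_congr_left fun c' _ => ?_
    exact hT.map₂_cutHom c c' _

end

mutual

theorem UnitalOps.IsBidendriform.dprec_treeHom (hT : T.IsBidendriform)
    (hq : ∀ d, T.IsTotallyPrimitive (q d)) : ∀ t : PTree D,
    T.dprec (T.treeHom q t) = ((treeCuts t).map (T.rightCutHom q)).sum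
  | .node d F => by
    rw [UnitalOps.treeHom, hT.dprec_prec_of_primitive (hq d), hT.dprec_forestHom hq F, treeCuts,
      List.map_cons, List.sum_cons, map_list_sum, List.map_map, List.map_map]
    congr 1
    · rw [UnitalOps.rightCutHom, if_pos rfl, UnitalOps.cutHom, hT.forestHom_tree,
        UnitalOps.treeHom, UnitalOps.forestHom]
    · congr 1
      refine List.map_congr_left fun c _ => ?_
      simp only [Function.comp_apply, UnitalOps.rightCutHom]
      split_ifs
      · simp only [UnitalOps.cutHom, LinearMap.lTensor_tmul, hT.forestHom_tree,
          UnitalOps.treeHom]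
      · rw [map_zero]

theorem UnitalOps.IsBidendriform.dprec_forestHom (hT : T.IsBidendriform)
    (hq : ∀ d, T.IsTotallyPrimitive (q d)) : ∀ F : List (PTree D),
    T.dprec (T.forestHom q F) = ((forestCuts F).map (T.rightCutHom q)).sum
  | [] => by
    rw [UnitalOps.forestHom, hT.dprec_one, forestCuts]
    simp [UnitalOps.rightCutHom]
  | [t] => by
    rw [hT.forestHom_tree, hT.dprec_treeHom hq t, forestCuts, sum_map_flatMap]
    congr 1
    refine List.map_congr_left fun c _ => ?_
    simp [forestCuts, UnitalOps.rightCutHom, UnitalOps.cutHom]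
  | t :: s :: F => by
    rw [UnitalOps.forestHom, hT.dprec_mul _ _ (hT.counit_forestHom (List.cons_ne_nil _ _)),
      hT.comul_treeHom hq t, hT.dprec_forestHom hq (s :: F), map₂_sum_sum]
    conv_rhs => rw [forestCuts, sum_map_flatMap]
    congr 1
    refine List.map_congr_left fun c _ => ?_
    rw [List.map_map]
    congr 1
    refine List.map_congr_left fun c' _ => ?_
    simp only [Function.comp_apply, UnitalOps.rightCutHom, List.isEmpty_cons, Bool.false_eq_true,
      if_false]
    split_ifs
    · exact hT.map₂_cutHom c c' _
    · rw [map_zero]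

end

/-- The coproduct given by the admissible cuts is that of the images of the forests. -/
theorem UnitalOps.IsBidendriform.hom_comul (hT : T.IsBidendriform)
    (hq : ∀ d, T.IsTotallyPrimitive (q d)) (x : HTree K D) : T.comul (T.hom q x) =
      TensorProduct.map (T.hom q) (T.hom q) ((htreeHopf K D).comul x) := by
  refine eq_of_eqOn_basis (f := T.comul ∘ₗ T.hom q)
    (g := TensorProduct.map (T.hom q) (T.hom q) ∘ₗ (htreeHopf K D).comul) (fun F => ?_) x
  rw [LinearMap.comp_apply, UnitalOps.hom_single, hT.comul_forestHom hq]
  simp only [LinearMap.comp_apply, htreeHopf, Finsupp.linearCombination_single, one_smul,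
    map_list_sum, List.map_map]
  congr 1
  refine List.map_congr_left fun c _ => ?_
  simp [UnitalOps.cutHom, UnitalOps.hom_single]

theorem UnitalOps.IsBidendriform.hom_dprec (hT : T.IsBidendriform)
    (hq : ∀ d, T.IsTotallyPrimitive (q d)) (x : HTree K D) : T.dprec (T.hom q x) =
      TensorProduct.map (T.hom q) (T.hom q) ((htreeUnital K D).dprec x) := by
  refine eq_of_eqOn_basis (f := T.dprec ∘ₗ T.hom q)
    (g := TensorProduct.map (T.hom q) (T.hom q) ∘ₗ (htreeUnital K D).dprec) (fun F => ?_) x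
  rw [LinearMap.comp_apply, UnitalOps.hom_single, hT.dprec_forestHom hq]
  simp only [LinearMap.comp_apply, htreeUnital, Finsupp.linearCombination_single, one_smul]
  induction forestCuts F with
  | nil => simp
  | cons c l ih =>
    rw [List.map_cons, List.sum_cons, ih, List.filter_cons, UnitalOps.rightCutHom]
    split_ifs
    · simp [UnitalOps.cutHom, UnitalOps.hom_single]
    · simp

theorem UnitalOps.forestHom_mem {𝒜 : ℕ → Submodule K H} {deg : D → ℕ} (h1 : T.one ∈ 𝒜 0)
    (hmul : ∀ i j, ∀ a ∈ 𝒜 i, ∀ b ∈ 𝒜 j, T.mul a b ∈ 𝒜 (i + j))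
    (hprec : ∀ i j, ∀ a ∈ 𝒜 i, ∀ b ∈ 𝒜 j, T.prec a b ∈ 𝒜 (i + j))
    (hq : ∀ d, q d ∈ 𝒜 (deg d)) :
    (∀ t, T.treeHom q t ∈ 𝒜 (treeDegree deg t)) ∧
      ∀ F, T.forestHom q F ∈ 𝒜 (forestDegree deg F) := by
  have h : ∀ t, T.treeHom q t ∈ 𝒜 (treeDegree deg t) := by
    intro t
    refine PTree.rec (motive_1 := fun t => T.treeHom q t ∈ 𝒜 (treeDegree deg t))
      (motive_2 := fun F => T.forestHom q F ∈ 𝒜 (forestDegree deg F)) ?_ ?_ ?_ t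
    · intro d F hF
      rw [UnitalOps.treeHom, treeDegree]
      exact hprec _ _ _ (hq d) _ hF
    · rw [UnitalOps.forestHom, forestDegree]
      exact h1
    · intro t F ht hF
      rw [UnitalOps.forestHom, forestDegree]
      exact hmul _ _ _ ht _ hF
  refine ⟨h, fun F => ?_⟩
  induction F with
  | nil =>
    rw [UnitalOps.forestHom, forestDegree]
    exact h1
  | cons t F ih =>
    rw [UnitalOps.forestHom, forestDegree]
    exact hmul _ _ _ (h t) _ ih

end TreeHom

/-! ### Transport of structure -/

section Transport

variable {K : Type u} [Field K] {H : Type v} [AddCommGroup H] [Module K H]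
  {H' : Type w} [AddCommGroup H'] [Module K H']

/-- `e` is an isomorphism for all the operations. -/
structure UnitalOps.IsIso (T' : UnitalOps K H') (T : UnitalOps K H) (e : H' ≃ₗ[K] H) : Prop where
  map_mul : ∀ a b, e (T'.mul a b) = T.mul (e a) (e b)
  map_one : e T'.one = T.one
  map_prec : ∀ a b, e (T'.prec a b) = T.prec (e a) (e b)
  map_counit : ∀ a, T.counit (e a) = T'.counit a
  map_comul : ∀ a,
    T.comul (e a) = TensorProduct.map (e : H' →ₗ[K] H) (e : H' →ₗ[K] H) (T'.comul a)
  map_dprec : ∀ a,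
    T.dprec (e a) = TensorProduct.map (e : H' →ₗ[K] H) (e : H' →ₗ[K] H) (T'.dprec a)

variable {e : H' ≃ₗ[K] H}

local notation "ee" => TensorProduct.map (e : H' →ₗ[K] H) (e : H' →ₗ[K] H)

theorem map_equiv_injective : Function.Injective ee :=
  (TensorProduct.congr e e).injective

theorem map_map_equiv_injective :
    Function.Injective (TensorProduct.map (e : H' →ₗ[K] H) ee) :=
  (TensorProduct.congr e (TensorProduct.congr e e)).injective

theorem map_equiv_assoc_rTensor {f' : H' →ₗ[K] H' ⊗[K] H'} {f : H →ₗ[K] H ⊗[K] H}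
    (h : ∀ a, f (e a) = ee (f' a)) (z : H' ⊗[K] H') :
    TensorProduct.map (e : H' →ₗ[K] H) ee
      (TensorProduct.assoc K H' H' H' (f'.rTensor H' z)) =
      TensorProduct.assoc K H H H (f.rTensor H (ee z)) := by
  have nat : ∀ w : (H' ⊗[K] H') ⊗[K] H', TensorProduct.map (e : H' →ₗ[K] H) ee
      (TensorProduct.assoc K H' H' H' w) =
      TensorProduct.assoc K H H H (TensorProduct.map ee (e : H' →ₗ[K] H) w) :=
    fun w => LinearMap.congr_fun (TensorProduct.map_map_comp_assoc_eq (e : H' →ₗ[K] H)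
      (e : H' →ₗ[K] H) (e : H' →ₗ[K] H)) w
  rw [nat]
  induction z with
  | zero => simp
  | add x y hx hy => simp only [map_add, hx, hy]
  | tmul x y => simp [h]

theorem map_equiv_lTensor {f' : H' →ₗ[K] H' ⊗[K] H'} {f : H →ₗ[K] H ⊗[K] H}
    (h : ∀ a, f (e a) = ee (f' a)) (z : H' ⊗[K] H') :
    TensorProduct.map (e : H' →ₗ[K] H) ee (f'.lTensor H' z) = f.lTensor H (ee z) := by
  induction z with
  | zero => simp
  | add x y hx hy => simp only [map_add, hx, hy]
  | tmul x y => simp [h]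

theorem map_equiv_map₂ {m' f' : H' →ₗ[K] H' →ₗ[K] H'} {m f : H →ₗ[K] H →ₗ[K] H}
    (hm : ∀ a b, e (m' a b) = m (e a) (e b)) (hf : ∀ a b, e (f' a b) = f (e a) (e b))
    (x y : H' ⊗[K] H') :
    ee (TensorProduct.map₂ m' f' x y) = TensorProduct.map₂ m f (ee x) (ee y) := by
  induction x with
  | zero => simp
  | add x x' hx hx' => simp only [map_add, LinearMap.add_apply, hx, hx']
  | tmul a b =>
    induction y with
    | zero => simp
    | add y y' hy hy' => simp only [map_add, hy, hy']
    | tmul c d => simp [TensorProduct.map₂_apply_tmul, hm, hf]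

theorem rTensor_counit_equiv {c' : H' →ₗ[K] K} {c : H →ₗ[K] K} (h : ∀ a, c (e a) = c' a)
    (z : H' ⊗[K] H') : (e : H' →ₗ[K] H).lTensor K (c'.rTensor H' z) = c.rTensor H (ee z) := by
  induction z with
  | zero => simp
  | add x y hx hy => simp only [map_add, hx, hy]
  | tmul x y => simp [h]

theorem lTensor_counit_equiv {c' : H' →ₗ[K] K} {c : H →ₗ[K] K} (h : ∀ a, c (e a) = c' a)
    (z : H' ⊗[K] H') : (e : H' →ₗ[K] H).rTensor K (c'.lTensor H' z) = c.lTensor H (ee z) := by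
  induction z with
  | zero => simp
  | add x y hx hy => simp only [map_add, hx, hy]
  | tmul x y => simp [h]

variable {T' : UnitalOps K H'} {T : UnitalOps K H}

/-- The axioms are transported along isomorphisms. -/
theorem UnitalOps.IsIso.isBidendriform (he : T'.IsIso T e) (hT : T.IsBidendriform) :
    T'.IsBidendriform := by
  have inj := e.injective
  have inj2 : Function.Injective ee := map_equiv_injective
  have inj3 : Function.Injective (TensorProduct.map (e : H' →ₗ[K] H) ee) :=
    map_map_equiv_injective
  have injr : Function.Injective ((e : H' →ₗ[K] H).rTensor K) :=
    (LinearEquiv.rTensor K e).injective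
  have injl : Function.Injective ((e : H' →ₗ[K] H).lTensor K) :=
    (LinearEquiv.lTensor K e).injective
  have dsucc : ∀ a, (T.comul - T.dprec) (e a) = ee ((T'.comul - T'.dprec) a) := by
    intro a
    rw [LinearMap.sub_apply, LinearMap.sub_apply, map_sub, he.map_comul, he.map_dprec]
  refine
    { one_mul := fun a => inj ?_, mul_one := fun a => inj ?_, mul_assoc := fun a b c => inj ?_
      coassoc := fun a => inj3 ?_, rTensor_counit_comul := fun a => injl ?_
      lTensor_counit_comul := fun a => injr ?_, comul_one := inj2 ?_
      comul_mul := fun a b => inj2 ?_, counit_one := ?_, counit_mul := fun a b => ?_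
      prec_one := fun a => inj ?_, one_prec := fun a => inj ?_, counit_prec := fun a b => ?_
      prec_prec := fun a b c => inj ?_, mul_prec := fun a b c => inj ?_, dprec_one := inj2 ?_
      rTensor_counit_dprec := fun a => injl ?_, lTensor_counit_dprec := fun a => injr ?_
      dprec_dprec := fun a => inj3 ?_, dsucc_dprec := fun a => inj3 ?_
      dprec_mul := fun a b hb => inj2 ?_, comul_prec := fun a b => inj2 ?_
      dprec_prec := fun a b hb => inj2 ?_ }
  · rw [he.map_mul, he.map_one, hT.one_mul]
  · rw [he.map_mul, he.map_one, hT.mul_one]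
  · simp only [he.map_mul, hT.mul_assoc]
  · rw [map_equiv_assoc_rTensor he.map_comul, map_equiv_lTensor he.map_comul, ← he.map_comul,
      hT.coassoc]
  · rw [rTensor_counit_equiv he.map_counit, ← he.map_comul, hT.rTensor_counit_comul]
    simp
  · rw [lTensor_counit_equiv he.map_counit, ← he.map_comul, hT.lTensor_counit_comul]
    simp
  · rw [← he.map_comul, he.map_one, hT.comul_one]
    simp [he.map_one]
  · rw [← he.map_comul, he.map_mul, hT.comul_mul, map_equiv_map₂ he.map_mul he.map_mul,
      he.map_comul, he.map_comul]
  · rw [← he.map_counit, he.map_one, hT.counit_one]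
  · rw [← he.map_counit, he.map_mul, hT.counit_mul, he.map_counit, he.map_counit]
  · rw [he.map_prec, he.map_one, hT.prec_one, he.map_counit, map_sub, map_smul, he.map_one]
  · rw [he.map_prec, he.map_one, hT.one_prec, map_zero]
  · rw [← he.map_counit, he.map_prec, hT.counit_prec]
  · simp only [he.map_mul, he.map_prec, hT.prec_prec]
  · simp only [map_add, map_sub, he.map_mul, he.map_prec, hT.mul_prec]
  · rw [← he.map_dprec, he.map_one, hT.dprec_one, map_zero]
  · rw [rTensor_counit_equiv he.map_counit, ← he.map_dprec, hT.rTensor_counit_dprec, map_zero]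
  · rw [lTensor_counit_equiv he.map_counit, ← he.map_dprec, hT.lTensor_counit_dprec]
    simp [he.map_counit, he.map_one]
  · rw [map_equiv_assoc_rTensor he.map_dprec, map_equiv_lTensor he.map_comul, ← he.map_dprec,
      hT.dprec_dprec]
  · rw [map_equiv_assoc_rTensor dsucc, map_equiv_lTensor he.map_dprec, ← he.map_dprec,
      hT.dsucc_dprec, he.map_comul, he.map_dprec]
    simp only [map_sub]
  · rw [← he.map_dprec, he.map_mul, hT.dprec_mul _ _ (by rw [he.map_counit, hb]),
      map_equiv_map₂ he.map_mul he.map_mul, he.map_comul, he.map_dprec]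
  · rw [← he.map_comul, he.map_prec, hT.comul_prec, map_add,
      map_equiv_map₂ he.map_mul he.map_prec, he.map_comul, he.map_comul]
    simp [he.map_one, he.map_prec]
  · rw [← he.map_dprec, he.map_prec, hT.dprec_prec _ _ (by rw [he.map_counit, hb]), map_add,
      map_equiv_map₂ he.map_mul he.map_prec, he.map_comul, he.map_dprec]
    simp [he.map_one, he.map_prec]

variable {A : Type v} [AddCommGroup A] [Module K A] {A' : Type w} [AddCommGroup A'] [Module K A']
  {i : A →ₗ[K] H} {p : H →ₗ[K] A} {i' : A' →ₗ[K] H'} {p' : H' →ₗ[K] A'}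

/-- The restriction of an isomorphism to the augmentation ideals. -/
def UnitalOps.IsIso.restrict (he : T'.IsIso T e) (h : T.IsAugmentation i p)
    (h' : T'.IsAugmentation i' p') : A' ≃ₗ[K] A :=
  LinearEquiv.ofLinearMap (p ∘ₗ e ∘ₗ i') (p' ∘ₗ e.symm ∘ₗ i)
    (LinearMap.ext fun a => by
      have h1 : T'.counit (e.symm (i a)) = 0 := by
        rw [← he.map_counit, e.apply_symm_apply, h.counit_incl]
      simp [h'.incl_proj, h1, h.proj_incl])
    (LinearMap.ext fun a => by
      have h1 : T.counit (e (i' a)) = 0 := by rw [he.map_counit, h'.counit_incl]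
      simp [h.incl_proj, h1, h'.proj_incl])

theorem UnitalOps.IsIso.incl_restrict (he : T'.IsIso T e) (h : T.IsAugmentation i p)
    (h' : T'.IsAugmentation i' p') (a : A') : i (he.restrict h h' a) = e (i' a) := by
  change i (p (e (i' a))) = _
  rw [h.incl_proj, he.map_counit, h'.counit_incl, zero_smul, sub_zero]

theorem UnitalOps.IsIso.restrict_proj (he : T'.IsIso T e) (h : T.IsAugmentation i p)
    (h' : T'.IsAugmentation i' p') (x : H') : he.restrict h h' (p' x) = p (e x) := by
  change p (e (i' (p' x))) = _
  rw [h'.incl_proj, map_sub, map_smul, he.map_one, map_sub, map_smul, h.proj_one, smul_zero,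
    sub_zero]

theorem UnitalOps.IsIso.restrict_isGradedBidendIso (he : T'.IsIso T e) (h : T.IsAugmentation i p)
    (h' : T'.IsAugmentation i' p') {𝒜' : ℕ → Submodule K A'} {𝒜 : ℕ → Submodule K A}
    (hdeg : ∀ n, (𝒜' n).map (he.restrict h h' : A' →ₗ[K] A) = 𝒜 n) :
    IsGradedBidendIso (T'.restrict i' p') 𝒜' (T.restrict i p) 𝒜 (he.restrict h h') := by
  have hpp : ∀ z, TensorProduct.map p p (ee z) = TensorProduct.map
      (he.restrict h h' : A' →ₗ[K] A) (he.restrict h h' : A' →ₗ[K] A)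
      (TensorProduct.map p' p' z) := by
    intro z
    induction z with
    | zero => simp
    | add x y hx hy => simp only [map_add, hx, hy]
    | tmul x y => simp [he.restrict_proj h h']
  refine ⟨fun a b => ?_, fun a b => ?_, fun a => ?_, fun a => ?_, hdeg⟩
  · simp only [UnitalOps.restrict, LinearMap.compr₂_apply, LinearMap.compl₁₂_apply,
      he.restrict_proj h h', he.map_prec, he.incl_restrict h h']
  · simp only [UnitalOps.restrict_succ_apply, map_sub, he.restrict_proj h h', he.map_prec,
      he.map_mul, he.incl_restrict h h']
  · simp only [UnitalOps.restrict, LinearMap.comp_apply, he.incl_restrict h h', he.map_dprec, hpp]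
  · simp only [UnitalOps.restrict_dsucc_apply, he.incl_restrict h h', he.map_dprec, he.map_comul,
      hpp, map_sub]

theorem IsGradedBidendIso.symm {S' : BidendOps K A'} {S : BidendOps K A}
    {𝒜' : ℕ → Submodule K A'} {𝒜 : ℕ → Submodule K A} {f : A' ≃ₗ[K] A}
    (hf : IsGradedBidendIso S' 𝒜' S 𝒜 f) : IsGradedBidendIso S 𝒜 S' 𝒜' f.symm := by
  have hff : ∀ z, TensorProduct.map (f.symm : A →ₗ[K] A') (f.symm : A →ₗ[K] A')
      (TensorProduct.map (f : A' →ₗ[K] A) (f : A' →ₗ[K] A) z) = z :=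
    (TensorProduct.congr f f).symm_apply_apply
  refine ⟨fun a b => ?_, fun a b => ?_, fun a => ?_, fun a => ?_, fun n => ?_⟩
  · rw [LinearEquiv.symm_apply_eq, hf.map_prec, f.apply_symm_apply, f.apply_symm_apply]
  · rw [LinearEquiv.symm_apply_eq, hf.map_succ, f.apply_symm_apply, f.apply_symm_apply]
  · rw [← hff (S'.dprec (f.symm a)), ← hf.map_dprec, f.apply_symm_apply]
  · rw [← hff (S'.dsucc (f.symm a)), ← hf.map_dsucc, f.apply_symm_apply]
  · rw [← hf.map_degree, ← Submodule.map_comp, LinearEquiv.symm_comp, Submodule.map_id]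

theorem IsGradedHopfIso.symm {S' : HopfOps K A'} {S : HopfOps K A}
    {𝒜' : ℕ → Submodule K A'} {𝒜 : ℕ → Submodule K A} {f : A' ≃ₗ[K] A}
    (hf : IsGradedHopfIso S' 𝒜' S 𝒜 f) : IsGradedHopfIso S 𝒜 S' 𝒜' f.symm := by
  have hff : ∀ z, TensorProduct.map (f.symm : A →ₗ[K] A') (f.symm : A →ₗ[K] A')
      (TensorProduct.map (f : A' →ₗ[K] A) (f : A' →ₗ[K] A) z) = z :=
    (TensorProduct.congr f f).symm_apply_apply
  refine ⟨fun a b => ?_, ?_, fun a => ?_, fun a => ?_, fun n => ?_⟩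
  · rw [LinearEquiv.symm_apply_eq, hf.map_mul, f.apply_symm_apply, f.apply_symm_apply]
  · rw [LinearEquiv.symm_apply_eq, hf.map_one]
  · rw [← hff (S'.comul (f.symm a)), ← hf.map_comul, f.apply_symm_apply]
  · rw [← hf.map_counit, f.apply_symm_apply]
  · rw [← hf.map_degree, ← Submodule.map_comp, LinearEquiv.symm_comp, Submodule.map_id]

theorem map_equiv_eq_iff {𝒜' : ℕ → Submodule K A'} {𝒜 : ℕ → Submodule K A} {f : A' ≃ₗ[K] A}
    (hf : ∀ n, (𝒜' n).map (f : A' →ₗ[K] A) = 𝒜 n) :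
    (∀ n, ∀ a ∈ 𝒜' n, f a ∈ 𝒜 n) ∧ ∀ n, ∀ a ∈ 𝒜 n, f.symm a ∈ 𝒜' n := by
  refine ⟨fun n a ha => ?_, fun n a ha => ?_⟩
  · rw [← hf]
    exact Submodule.mem_map_of_mem ha
  · rw [← hf] at ha
    obtain ⟨b, hb, rfl⟩ := ha
    simpa using hb

theorem IsGradedBidendIso.isGradedBidendriformBialgebra {S' : BidendOps K A'} {S : BidendOps K A}
    {𝒜' : ℕ → Submodule K A'} {𝒜 : ℕ → Submodule K A} {f : A' ≃ₗ[K] A}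
    (hf : IsGradedBidendIso S' 𝒜' S 𝒜 f) (hS : S.IsGradedBidendriformBialgebra 𝒜)
    (hS' : S'.IsBidendriformBialgebra) (hint : DirectSum.IsInternal 𝒜') :
    S'.IsGradedBidendriformBialgebra 𝒜' := by
  obtain ⟨h1, h2⟩ := map_equiv_eq_iff hf.map_degree
  refine ⟨hS', hint, fun i j a ha b hb => ?_, fun i j a ha b hb => ?_, fun n a ha => ?_,
    fun n a ha => ?_⟩
  · rw [← f.symm_apply_apply (S'.prec a b), hf.map_prec]
    exact h2 _ _ (hS.prec_mem i j _ (h1 _ _ ha) _ (h1 _ _ hb))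
  · rw [← f.symm_apply_apply (S'.succ a b), hf.map_succ]
    exact h2 _ _ (hS.succ_mem i j _ (h1 _ _ ha) _ (h1 _ _ hb))
  · rw [← f.symm_apply_apply a, hf.symm.map_dprec]
    exact map_mem_tensorDegree h2 (hS.dprec_mem n _ (h1 _ _ ha))
  · rw [← f.symm_apply_apply a, hf.symm.map_dsucc]
    exact map_mem_tensorDegree h2 (hS.dsucc_mem n _ (h1 _ _ ha))

theorem IsGradedHopfIso.isConnectedGraded {S' : HopfOps K A'} {S : HopfOps K A}
    {𝒜' : ℕ → Submodule K A'} {𝒜 : ℕ → Submodule K A} {f : A' ≃ₗ[K] A}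
    (hf : IsGradedHopfIso S' 𝒜' S 𝒜 f) (hS : S.IsConnectedGraded 𝒜) :
    S'.IsConnectedGraded 𝒜' := by
  obtain ⟨h1, h2⟩ := map_equiv_eq_iff hf.map_degree
  refine ⟨?_, fun i j a ha b hb => ?_, fun n a ha => ?_, fun n hn a ha => ?_, fun a ha => ?_⟩
  · rw [← f.symm_apply_apply S'.one, hf.map_one]
    exact h2 _ _ hS.one_mem
  · rw [← f.symm_apply_apply (S'.mul a b), hf.map_mul]
    exact h2 _ _ (hS.mul_mem i j _ (h1 _ _ ha) _ (h1 _ _ hb))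
  · rw [← f.symm_apply_apply a, hf.symm.map_comul]
    exact map_mem_tensorDegree h2 (hS.comul_mem n _ (h1 _ _ ha))
  · rw [← hf.map_counit]
    exact hS.counit_eq_zero n hn _ (h1 _ _ ha)
  · apply f.injective
    rw [map_smul, hf.map_one, ← hf.map_counit]
    exact hS.eq_counit_smul _ (h1 _ _ ha)

end Transport

/-! ### Counting planar decorated forests -/

section Counting

variable {X : Type v} {Y : Type w}

/-- The generating series of the numbers of elements of each degree. -/
def countSeries (deg : X → ℕ) : PowerSeries ℚ :=
  PowerSeries.mk fun n => ({x | deg x = n}.ncard : ℚ)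

theorem finite_prod_deg {degX : X → ℕ} {degY : Y → ℕ} (hX : ∀ n, {x | degX x = n}.Finite)
    (hY : ∀ n, {y | degY y = n}.Finite) (n : ℕ) :
    {p : X × Y | degX p.1 + degY p.2 = n}.Finite := by
  refine ((Finset.HasAntidiagonal.antidiagonal n).finite_toSet.biUnion
    fun q _ => (hX q.1).prod (hY q.2)).subset fun p hp => ?_
  exact Set.mem_biUnion (x := (degX p.1, degY p.2)) (by simpa using hp) ⟨rfl, rfl⟩

theorem countSeries_prod {degX : X → ℕ} {degY : Y → ℕ} (hX : ∀ n, {x | degX x = n}.Finite)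
    (hY : ∀ n, {y | degY y = n}.Finite) :
    countSeries (fun p : X × Y => degX p.1 + degY p.2) = countSeries degX * countSeries degY := by
  classical
  ext n
  rw [PowerSeries.coeff_mul]
  simp only [countSeries, PowerSeries.coeff_mk]
  have h : {p : X × Y | degX p.1 + degY p.2 = n} =
      ((Finset.HasAntidiagonal.antidiagonal n).biUnion fun q =>
        (hX q.1).toFinset ×ˢ (hY q.2).toFinset : Finset (X × Y)) := by
    ext p
    simp only [Set.mem_ofPred_eq, Finset.coe_biUnion, Finset.mem_coe, Set.mem_iUnion,
      Finset.mem_product, Set.Finite.mem_toFinset,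
      exists_prop]
    constructor
    · exact fun hp =>
        ⟨(degX p.1, degY p.2), Finset.HasAntidiagonal.mem_antidiagonal.2 hp, rfl, rfl⟩
    · rintro ⟨q, hq, h1, h2⟩
      rw [h1, h2, Finset.HasAntidiagonal.mem_antidiagonal.1 hq]
  rw [h, Set.ncard_coe_finset, Finset.card_biUnion]
  · push_cast
    refine Finset.sum_congr rfl fun q _ => ?_
    rw [Finset.card_product, ← Set.ncard_eq_toFinset_card _ (hX q.1),
      ← Set.ncard_eq_toFinset_card _ (hY q.2)]
    push_cast
    rfl
  · intro q _ q' _ hqq'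
    rw [Function.onFun, Finset.disjoint_left]
    intro p hp hp'
    simp only [Finset.mem_product, Set.Finite.mem_toFinset, Set.mem_ofPred_eq] at hp hp'
    exact hqq' (Prod.ext (hp.1.symm.trans hp'.1) (hp.2.symm.trans hp'.2))

variable {D : Type v} {deg : D → ℕ}

/-- A nonempty forest as the decoration of the root of its first tree, the forest of the subtrees
of this tree, and the forest of the other trees. -/
def consForest (p : D × Forest D × Forest D) : Forest D := .node p.1 p.2.1 :: p.2.2

theorem consForest_injective : Function.Injective (consForest (D := D)) := by
  rintro ⟨d, F, G⟩ ⟨d', F', G'⟩ h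
  simpa [consForest, and_assoc] using h

theorem forestDegree_consForest (p : D × Forest D × Forest D) :
    forestDegree deg (consForest p) =
      deg p.1 + (forestDegree deg p.2.1 + forestDegree deg p.2.2) := by
  rw [consForest, forestDegree, treeDegree, add_assoc]

theorem forest_eq_nil_or (F : Forest D) : F = [] ∨ ∃ p, F = consForest p := by
  rcases F with _ | ⟨⟨d, F⟩, G⟩
  · exact Or.inl rfl
  · exact Or.inr ⟨(d, F, G), rfl⟩

theorem finite_forestDegree (hzero : ∀ d, deg d ≠ 0) (hfin : ∀ n, {d | deg d = n}.Finite) (n : ℕ) :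
    {F | forestDegree deg F = n}.Finite := by
  induction n using Nat.strong_induction_on with
  | _ n ih =>
    have h1 : {F | forestDegree deg F < n}.Finite :=
      ((Set.finite_Iio n).biUnion fun i hi => ih i hi).subset
        fun F (hF : forestDegree deg F < n) => Set.mem_biUnion (Set.mem_Iio.2 hF) rfl
    have h2 : {d | deg d < n + 1}.Finite :=
      ((Set.finite_Iio (n + 1)).biUnion fun i _ => hfin i).subset
        fun d (hd : deg d < n + 1) => Set.mem_biUnion (Set.mem_Iio.2 hd) rfl
    refine (((h2.prod (h1.prod h1)).image consForest).union (Set.finite_singleton [])).subset ?_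
    intro F hF
    rcases forest_eq_nil_or F with rfl | ⟨p, rfl⟩
    · exact Or.inr rfl
    · left
      have h3 : deg p.1 + (forestDegree deg p.2.1 + forestDegree deg p.2.2) = n := by
        rw [← forestDegree_consForest]
        exact hF
      have h4 := hzero p.1
      refine ⟨p, ⟨?_, ?_, ?_⟩, rfl⟩
      · change deg p.1 < n + 1
        omega
      · change forestDegree deg p.2.1 < n
        omega
      · change forestDegree deg p.2.2 < n
        omega

theorem forestDegree_eq_zero_iff (hzero : ∀ d, deg d ≠ 0) (F : Forest D) :
    forestDegree deg F = 0 ↔ F = [] := by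
  refine ⟨fun h => ?_, fun h => by rw [h, forestDegree]⟩
  rcases forest_eq_nil_or F with rfl | ⟨p, rfl⟩
  · rfl
  · rw [forestDegree_consForest] at h
    have := hzero p.1
    omega

/-- A forest is empty, or it consists of a root and of two forests. -/
theorem countSeries_forestDegree (hzero : ∀ d, deg d ≠ 0)
    (hfin : ∀ n, {d | deg d = n}.Finite) : countSeries (forestDegree deg) =
      1 + countSeries deg * countSeries (forestDegree deg) ^ 2 := by
  have hF := finite_forestDegree hzero hfin
  rw [sq, ← countSeries_prod hF hF, ← countSeries_prod hfin (finite_prod_deg hF hF)]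
  ext n
  rw [map_add, PowerSeries.coeff_one]
  simp only [countSeries, PowerSeries.coeff_mk]
  by_cases hn : n = 0
  · subst hn
    have h1 : {F | forestDegree deg F = 0} = {[]} := by
      ext F
      exact forestDegree_eq_zero_iff hzero F
    have h2 : {p : D × Forest D × Forest D |
        deg p.1 + (forestDegree deg p.2.1 + forestDegree deg p.2.2) = 0} = ∅ := by
      ext p
      have := hzero p.1
      simp only [Set.mem_ofPred_eq, Set.mem_empty_iff_false, iff_false]
      omega
    rw [h1, h2]
    simp
  · have h1 : {F | forestDegree deg F = n} = consForest '' {p : D × Forest D × Forest D |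
        deg p.1 + (forestDegree deg p.2.1 + forestDegree deg p.2.2) = n} := by
      ext F
      constructor
      · intro h
        rcases forest_eq_nil_or F with rfl | ⟨p, rfl⟩
        · exact absurd ((forestDegree_eq_zero_iff hzero _).2 rfl ▸ h : 0 = n) (Ne.symm hn)
        · exact ⟨p, (forestDegree_consForest p).symm.trans h, rfl⟩
      · rintro ⟨p, hp, rfl⟩
        exact (forestDegree_consForest p).trans hp
    rw [h1, Set.ncard_image_of_injective _ consForest_injective, if_neg hn, zero_add]

theorem constantCoeff_factSeries : PowerSeries.constantCoeff factSeries = 0 := by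
  rw [← PowerSeries.coeff_zero_eq_constantCoeff_apply, factSeries, PowerSeries.coeff_mk, if_pos rfl]

theorem pSeries_mul : pSeries * (1 + factSeries) ^ 2 = factSeries := by
  rw [pSeries, mul_assoc, PowerSeries.inv_mul_cancel, mul_one]
  simp [constantCoeff_factSeries]

theorem constantCoeff_pSeries : PowerSeries.constantCoeff pSeries = 0 := by
  rw [pSeries, map_mul, constantCoeff_factSeries, zero_mul]

/-- A series `P` without constant term determines the solution `F` of `F = 1 + P F²`. -/
theorem eq_of_eq_one_add_mul_sq {P F G : PowerSeries ℚ} (hP : PowerSeries.constantCoeff P = 0)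
    (hF : F = 1 + P * F ^ 2) (hG : G = 1 + P * G ^ 2) : F = G := by
  have h1 : (F - G) * (1 - P * (F + G)) = 0 := by
    linear_combination hF - hG
  rcases mul_eq_zero.1 h1 with h | h
  · exact sub_eq_zero.1 h
  · have := congrArg PowerSeries.constantCoeff h
    simp [hP] at this

theorem countSeries_eq_pSeries (hzero : ∀ d, deg d ≠ 0)
    (hcard : ∀ n, 1 ≤ n → ({d | deg d = n}.ncard : ℚ) = PowerSeries.coeff n pSeries) :
    countSeries deg = pSeries := by
  ext n
  rw [countSeries, PowerSeries.coeff_mk]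
  by_cases hn : n = 0
  · subst hn
    rw [PowerSeries.coeff_zero_eq_constantCoeff_apply, constantCoeff_pSeries]
    have : {d | deg d = 0} = ∅ := by
      ext d
      simp [hzero d]
    rw [this]
    simp
  · exact hcard n (by omega)

/-- There are `n!` forests of degree `n`. -/
theorem ncard_forestDegree (hzero : ∀ d, deg d ≠ 0) (hfin : ∀ n, {d | deg d = n}.Finite)
    (hcard : ∀ n, 1 ≤ n → ({d | deg d = n}.ncard : ℚ) = PowerSeries.coeff n pSeries) (n : ℕ) :
    {F | forestDegree deg F = n}.ncard = n.factorial := by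
  have h1 := countSeries_forestDegree hzero hfin
  rw [countSeries_eq_pSeries hzero hcard] at h1
  have h2 : 1 + factSeries = 1 + pSeries * (1 + factSeries) ^ 2 := by rw [pSeries_mul]
  have h3 := congrArg (PowerSeries.coeff n)
    (eq_of_eq_one_add_mul_sq constantCoeff_pSeries h1 h2)
  rw [countSeries, PowerSeries.coeff_mk, map_add, PowerSeries.coeff_one, factSeries,
    PowerSeries.coeff_mk] at h3
  by_cases hn : n = 0
  · subst hn
    simpa using h3
  · rw [if_neg hn, if_neg hn, zero_add] at h3
    exact_mod_cast h3

theorem finite_allPerm (n : ℕ) : {u : AllPerm | u.1 = n}.Finite := by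
  refine (Set.finite_range fun σ : Equiv.Perm (Fin n) => (⟨n, σ⟩ : AllPerm)).subset ?_
  rintro ⟨m, σ⟩ rfl
  exact ⟨σ, rfl⟩

theorem ncard_allPerm (n : ℕ) : {u : AllPerm | u.1 = n}.ncard = n.factorial := by
  have : {u : AllPerm | u.1 = n} =
      (fun σ : Equiv.Perm (Fin n) => (⟨n, σ⟩ : AllPerm)) '' Set.univ := by
    ext ⟨m, σ⟩
    constructor
    · rintro rfl
      exact ⟨σ, trivial, rfl⟩
    · rintro ⟨τ, -, h⟩
      exact (congrArg Sigma.fst h).symm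
  rw [this, Set.ncard_image_of_injective _ fun σ τ h => by simpa using h, Set.ncard_univ,
    Nat.card_eq_fintype_card, Fintype.card_perm, Fintype.card_fin]

theorem finite_posPerm (n : ℕ) : {u : posPerm | u.1.1 = n}.Finite :=
  (finite_allPerm n).preimage Subtype.val_injective.injOn

theorem countSeries_posPerm : countSeries (fun u : posPerm => u.1.1) = factSeries := by
  ext n
  rw [countSeries, PowerSeries.coeff_mk, factSeries, PowerSeries.coeff_mk]
  split_ifs with hn
  · subst hn
    have : {u : posPerm | u.1.1 = 0} = ∅ := by
      ext u
      have : 1 ≤ u.1.1 := u.2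
      simp only [Set.mem_ofPred_eq, Set.mem_empty_iff_false, iff_false]
      omega
    rw [this]
    simp
  · rw [← ncard_allPerm, ← Set.ncard_image_of_injective _ Subtype.val_injective]
    congr 2
    ext u
    constructor
    · rintro ⟨x, rfl, rfl⟩
      rfl
    · rintro rfl
      exact ⟨⟨u, Nat.one_le_iff_ne_zero.2 hn⟩, rfl, rfl⟩

end Counting

/-! ### Graded linear maps between spaces with finite bases in each degree -/

section GradedBijective

variable {K : Type u} [Field K] {X : Type v} {Y : Type w} {degX : X → ℕ} {degY : Y → ℕ}

theorem exists_gradedPart_add (n : ℕ) (z : Y →₀ K) : ∃ a ∈ gradedPart K degY n,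
    ∃ b ∈ Finsupp.supported K K {y | degY y ≠ n}, z = a + b := by
  classical
  refine ⟨z.filter (degY · = n), ?_, z.filter (¬ degY · = n), ?_,
    (Finsupp.filter_add_filter_not _ _).symm⟩
  · rw [gradedPart_eq_supported, Finsupp.mem_supported']
    exact fun y hy => Finsupp.filter_apply_neg _ _ hy
  · rw [Finsupp.mem_supported']
    exact fun y hy => Finsupp.filter_apply_neg _ _ hy

/-- A surjective graded linear map between spaces of the same finite dimension in each degree is
bijective, also in each degree. -/
theorem bijective_of_surjective_of_graded {φ : (Y →₀ K) →ₗ[K] (X →₀ K)}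
    (hφ : ∀ y, φ (Finsupp.single y 1) ∈ gradedPart K degX (degY y))
    (hsurj : Function.Surjective φ) (hX : ∀ n, {x | degX x = n}.Finite)
    (hY : ∀ n, {y | degY y = n}.Finite)
    (hcard : ∀ n, {x | degX x = n}.ncard = {y | degY y = n}.ncard) :
    Function.Bijective φ ∧ ∀ n, (gradedPart K degY n).map φ = gradedPart K degX n := by
  have hmem : ∀ n, ∀ z ∈ gradedPart K degY n, φ z ∈ gradedPart K degX n := fun n =>
    linearMap_mem_of_basis fun y hy => hy ▸ hφ y
  have hmem' : ∀ n, ∀ z ∈ Finsupp.supported K K {y | degY y ≠ n},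
      φ z ∈ Finsupp.supported K K {x | degX x ≠ n} := by
    intro n z hz
    rw [Finsupp.supported_eq_span_single] at hz
    refine (Submodule.span_le (p := (Finsupp.supported K K {x | degX x ≠ n}).comap φ)).2 ?_ hz
    rintro _ ⟨y, hy, rfl⟩
    have h1 := hφ y
    rw [gradedPart_eq_supported] at h1
    refine Finsupp.supported_mono ?_ h1
    rintro x hx rfl
    exact hy hx.symm
  have hdisj : ∀ n, ∀ x ∈ gradedPart K degX n, x ∈ Finsupp.supported K K {x | degX x ≠ n} →
      x = 0 := by
    intro n x hx hx'
    rw [gradedPart_eq_supported] at hx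
    refine Submodule.disjoint_def.1 (Finsupp.disjoint_supported_supported ?_) x hx hx'
    exact Set.disjoint_left.2 fun x h h' => h' h
  have hmap : ∀ n, (gradedPart K degY n).map φ = gradedPart K degX n := by
    intro n
    refine le_antisymm (Submodule.map_le_iff_le_comap.2 (hmem n)) fun x hx => ?_
    obtain ⟨z, rfl⟩ := hsurj x
    obtain ⟨a, ha, b, hb, rfl⟩ := exists_gradedPart_add (degY := degY) n z
    refine ⟨a, ha, ?_⟩
    rw [map_add] at hx ⊢
    have h1 : φ b ∈ gradedPart K degX n := by
      have := Submodule.sub_mem _ hx (hmem n a ha)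
      rwa [add_sub_cancel_left] at this
    rw [hdisj n _ h1 (hmem' n b hb), add_zero]
  have hinj : ∀ n, ∀ z ∈ gradedPart K degY n, φ z = 0 → z = 0 := by
    intro n z hz hz0
    have := finiteDimensional_gradedPart (K := K) hX n
    have := finiteDimensional_gradedPart (K := K) hY n
    let φn : gradedPart K degY n →ₗ[K] gradedPart K degX n := φ.restrict (hmem n)
    have h1 : Function.Surjective φn := by
      rintro ⟨x, hx⟩
      rw [← hmap n] at hx
      obtain ⟨a, ha, rfl⟩ := hx
      exact ⟨⟨a, ha⟩, rfl⟩
    have hrank : Module.finrank K (gradedPart K degY n) =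
        Module.finrank K (gradedPart K degX n) := by
      rw [finrank_gradedPart hX, finrank_gradedPart hY, hcard]
    have h2 : Function.Injective φn :=
      (LinearMap.injective_iff_surjective_of_finrank_eq_finrank (K := K)
        (V := gradedPart K degY n) (V₂ := gradedPart K degX n) hrank (f := φn)).2 h1
    have h3 : (⟨z, hz⟩ : gradedPart K degY n) = 0 := h2 (Subtype.ext (by simpa [φn] using hz0))
    exact congrArg Subtype.val h3
  refine ⟨⟨(injective_iff_map_eq_zero φ).2 fun z hz => ?_, hsurj⟩, hmap⟩
  ext y
  obtain ⟨a, ha, b, hb, rfl⟩ := exists_gradedPart_add (degY := degY) (degY y) z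
  rw [map_add] at hz
  have h1 : φ a = 0 := by
    refine hdisj _ _ (hmem _ a ha) ?_
    rw [eq_neg_of_add_eq_zero_left hz]
    exact Submodule.neg_mem _ (hmem' _ b hb)
  have h2 : b y = 0 := by
    by_contra h
    exact (Finsupp.mem_supported K b).1 hb (Finsupp.mem_support_iff.2 h) rfl
  rw [hinj _ a ha h1, zero_add, h2, Finsupp.zero_apply]

end GradedBijective

/-! ### The augmentation ideal of the Hopf algebra of planar decorated trees -/

section HTreeAugmentation

variable {K : Type u} [Field K] {D : Type v}

theorem htree_isAugmentation :
    (htreeUnital K D).IsAugmentation (subsetIncl K (posForest D)) (htreeProj K D) := by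
  refine isAugmentation_of_basis (x₀ := []) (fun F => Iff.rfl) rfl ?_ fun F hF => ?_
  · simp [htreeUnital, htreeHopf]
  · have : F ≠ [] := hF
    simp [htreeUnital, htreeHopf, this]

theorem sum_map_filter_not {α : Type*} {M : Type*} [AddCommGroup M] (f : α → M) (p : α → Bool)
    (l : List α) : ((l.filter fun a => !p a).map f).sum =
      (l.map f).sum - ((l.filter p).map f).sum := by
  induction l with
  | nil => simp
  | cons a l ih =>
    cases h : p a
    · simp [h, ih, add_sub_assoc]
    · simp [h, ih]

theorem atreeBidend_eq_restrict :
    atreeBidend K D = (htreeUnital K D).restrict (subsetIncl K (posForest D)) (htreeProj K D) := by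
  refine BidendOps.eq_of_eq ?_ ?_ ?_ ?_
  · refine bilin_ext fun F G => ?_
    simp only [atreeBidend, UnitalOps.restrict, LinearMap.compr₂_apply, LinearMap.compl₁₂_apply,
      subsetIncl_single, htreeUnital, bilin_single]
  · refine bilin_ext fun F G => ?_
    rw [UnitalOps.restrict_succ_apply]
    simp only [atreeBidend, subsetIncl_single, htreeUnital, htreeHopf, bilin_single, map_sub]
  · refine Finsupp.lhom_ext' fun F => LinearMap.ext_ring ?_
    simp only [LinearMap.comp_apply, Finsupp.lsingle_apply, atreeBidend, UnitalOps.restrict,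
      subsetIncl_single, htreeUnital, Finsupp.linearCombination_single, one_smul, map_list_sum,
      List.map_map]
    rfl
  · refine Finsupp.lhom_ext' fun F => LinearMap.ext_ring ?_
    rw [LinearMap.comp_apply, LinearMap.comp_apply, UnitalOps.restrict_dsucc_apply]
    simp only [Finsupp.lsingle_apply, atreeBidend, htreeHopf,
      subsetIncl_single, htreeUnital, Finsupp.linearCombination_single, one_smul, map_list_sum,
      List.map_map]
    exact sum_map_filter_not (M := ATree K D ⊗[K] ATree K D) _ _ _

end HTreeAugmentation

/-- The restriction of a graded isomorphism to the augmentation ideals is graded. -/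
theorem UnitalOps.IsIso.map_restrict_gradedPart {K : Type u} [Field K] {X : Type v} {Y : Type w}
    {T' : UnitalOps K (Y →₀ K)} {T : UnitalOps K (X →₀ K)} {e : (Y →₀ K) ≃ₗ[K] (X →₀ K)}
    (he : T'.IsIso T e) {s : Set X} {s' : Set Y}
    (h : T.IsAugmentation (subsetIncl K s) (Finsupp.lsubtypeDomain s))
    (h' : T'.IsAugmentation (subsetIncl K s') (Finsupp.lsubtypeDomain s'))
    {degX : X → ℕ} {degY : Y → ℕ} (hmap : ∀ n, (gradedPart K degY n).map
      (e : (Y →₀ K) →ₗ[K] (X →₀ K)) = gradedPart K degX n) (n : ℕ) :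
    (gradedPart K (fun y : s' => degY y.1) n).map
      (he.restrict h h' : (s' →₀ K) →ₗ[K] (s →₀ K)) = gradedPart K (fun x : s => degX x.1) n := by
  obtain ⟨h1, h2⟩ := map_equiv_eq_iff hmap
  refine le_antisymm (Submodule.map_le_iff_le_comap.2 fun a ha => ?_) fun x hx => ?_
  · rw [Submodule.mem_comap, LinearEquiv.coe_coe, ← h.proj_incl (he.restrict h h' a),
      he.incl_restrict h h']
    exact lsubtypeDomain_mem_gradedPart s (h1 n _ (subsetIncl_mem_gradedPart s' ha))
  · refine ⟨_, lsubtypeDomain_mem_gradedPart s' (h2 n _ (subsetIncl_mem_gradedPart s hx)), ?_⟩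
    rw [LinearEquiv.coe_coe, he.restrict_proj h h', e.apply_symm_apply, h.proj_incl]

/-! ### Totally primitive generators of `FQSym` -/

section Generators

variable {K : Type u} [Field K] {D : Type v} {deg : D → ℕ}

theorem posPerm_deg_ne (u : posPerm) : u.1.1 ≠ 0 :=
  Nat.one_le_iff_ne_zero.1 u.2

variable (K) in
/-- The homogeneous totally primitive elements of `FQSym` of degree `n`. -/
def fqsymPrim (n : ℕ) : Submodule K (FQSymPlus K) :=
  (fqsymBidend K).primTot ⊓ fqsymPlusDegree K n

theorem hilbertSeries_fqsymPlus : hilbertSeries (fqsymPlusDegree K) = factSeries := by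
  rw [← countSeries_posPerm]
  ext n
  rw [hilbertSeries, countSeries, PowerSeries.coeff_mk, PowerSeries.coeff_mk]
  exact congrArg _ (finrank_gradedPart (deg := fun u : posPerm => u.1.1) finite_posPerm n)

theorem hilbertSeries_fqsymPrim : hilbertSeries (fqsymPrim K) = pSeries := by
  have h := (fqsymBidend_isGraded (K := K)).hilbertSeries_primTot
    (deg := fun u : posPerm => u.1.1) posPerm_deg_ne finite_posPerm
  have h1 : hilbertSeries (gradedPart K fun u : posPerm => u.1.1) = factSeries :=
    hilbertSeries_fqsymPlus
  rw [h1, mul_comm] at h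
  have h2 : (1 + factSeries) ^ 2 ≠ 0 := by
    refine pow_ne_zero 2 fun h0 => ?_
    simpa [constantCoeff_factSeries] using congrArg PowerSeries.constantCoeff h0
  exact mul_right_cancel₀ h2 (h.symm.trans pSeries_mul.symm)

/-- There is a family of homogeneous totally primitive elements, indexed by `D`, that spans the
space of all of them. -/
theorem exists_generators (hzero : ∀ d, deg d ≠ 0) (hfin : ∀ n, {d | deg d = n}.Finite)
    (hcard : ∀ n, 1 ≤ n → ({d | deg d = n}.ncard : ℚ) = PowerSeries.coeff n pSeries) :
    ∃ v : D → FQSymPlus K, (∀ d, v d ∈ fqsymPrim K (deg d)) ∧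
      ∀ n, fqsymPrim K n ≤ Submodule.span K (Set.range v) := by
  have hrank : ∀ n, Module.finrank K (fqsymPrim K n) = Nat.card {d | deg d = n} := by
    intro n
    have h : hilbertSeries (fqsymPrim K) = countSeries deg := by
      rw [hilbertSeries_fqsymPrim, countSeries_eq_pSeries hzero hcard]
    have h1 := congrArg (PowerSeries.coeff n) h
    rw [hilbertSeries, countSeries, PowerSeries.coeff_mk, PowerSeries.coeff_mk] at h1
    exact_mod_cast h1
  have hbasis : ∀ n, Nonempty (Module.Basis {d | deg d = n} K (fqsymPrim K n)) := by
    intro n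
    have := (hfin n).fintype
    have : FiniteDimensional K (fqsymPlusDegree K n) :=
      finiteDimensional_gradedPart (K := K) (deg := fun u : posPerm => u.1.1) finite_posPerm n
    have : FiniteDimensional K (fqsymPrim K n) :=
      Submodule.finiteDimensional_of_le (inf_le_right : fqsymPrim K n ≤ fqsymPlusDegree K n)
    have := Module.Free.of_divisionRing K (fqsymPrim K n)
    exact ⟨(Module.finBasisOfFinrankEq K (fqsymPrim K n)
      ((hrank n).trans Nat.card_eq_fintype_card)).reindex (Fintype.equivFin _).symm⟩
  let b := fun n => (hbasis n).some
  refine ⟨fun d => b (deg d) ⟨d, rfl⟩, fun d => (b (deg d) ⟨d, rfl⟩).2, fun n => ?_⟩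
  have h1 : fqsymPrim K n = Submodule.map (fqsymPrim K n).subtype
      (Submodule.span K (Set.range (b n))) := by
    rw [(b n).span_eq, Submodule.map_top, Submodule.range_subtype]
  rw [h1, Submodule.map_span]
  refine Submodule.span_mono ?_
  rintro _ ⟨_, ⟨⟨d, rfl⟩, rfl⟩, rfl⟩
  exact ⟨d, rfl⟩

theorem isTotallyPrimitive_of_mem {n : ℕ} {x : FQSymPlus K} (hx : x ∈ fqsymPrim K n) :
    (fqsymUnital K).IsTotallyPrimitive (subsetIncl K posPerm x) := by
  have h1 : ((fqsymUnital K).restrict (subsetIncl K posPerm) (fqsymProj K)).dprec x = 0 := by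
    rw [← fqsymBidend_eq_restrict]
    exact hx.1.1
  have h2 : ((fqsymUnital K).restrict (subsetIncl K posPerm) (fqsymProj K)).dsucc x = 0 := by
    rw [← fqsymBidend_eq_restrict]
    exact hx.1.2
  refine ⟨fqsym_isAugmentation.counit_incl x, ?_, ?_⟩
  · rw [fqsymUnital_isBidendriform.comul_incl fqsym_isAugmentation, BidendOps.dred,
      LinearMap.add_apply, h1, h2, add_zero, map_zero, zero_add]
  · rw [fqsymUnital_isBidendriform.dprec_incl fqsym_isAugmentation, h1, map_zero, zero_add]

/-- The morphism given by generators of `FQSym` is surjective. -/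
theorem hom_surjective {v : D → FQSymPlus K}
    (hv : ∀ n, fqsymPrim K n ≤ Submodule.span K (Set.range v)) : Function.Surjective
      ((fqsymUnital K).hom fun d => subsetIncl K posPerm (v d)) := by
  set φ := (fqsymUnital K).hom fun d => subsetIncl K posPerm (v d) with hφ
  have hT := fqsymUnital_isBidendriform (K := K)
  have haug := fqsym_isAugmentation (K := K)
  have hone : (fqsymUnital K).one ∈ LinearMap.range φ := ⟨_, UnitalOps.hom_one⟩
  have hmul : ∀ x ∈ LinearMap.range φ, ∀ y ∈ LinearMap.range φ,
      (fqsymUnital K).mul x y ∈ LinearMap.range φ := by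
    rintro _ ⟨x, rfl⟩ _ ⟨y, rfl⟩
    exact ⟨_, hT.hom_mul x y⟩
  have hprec : ∀ x ∈ LinearMap.range φ, ∀ y ∈ LinearMap.range φ,
      (fqsymUnital K).prec x y ∈ LinearMap.range φ := by
    rintro _ ⟨x, rfl⟩ _ ⟨y, rfl⟩
    exact ⟨_, hT.hom_prec x y⟩
  have htop : (LinearMap.range φ).comap (subsetIncl K posPerm) = ⊤ := by
    refine (fqsymBidend_isGraded (K := K)).eq_top_of_primTot_le
      (deg := fun u : posPerm => u.1.1) posPerm_deg_ne finite_posPerm (fun n => ?_)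
      (fun a ha b hb => ?_) (fun a ha b hb => ?_)
    · refine (hv n).trans (Submodule.span_le.2 ?_)
      rintro _ ⟨d, rfl⟩
      refine ⟨Finsupp.single [.node d []] 1, ?_⟩
      rw [hφ, UnitalOps.hom_single, hT.forestHom_tree, UnitalOps.treeHom, UnitalOps.forestHom,
        hT.prec_one, haug.counit_incl, zero_smul, sub_zero]
    · rw [Submodule.mem_comap, fqsymBidend_eq_restrict, hT.incl_mul haug]
      exact hmul _ ha _ hb
    · rw [Submodule.mem_comap, fqsymBidend_eq_restrict, hT.incl_succ haug]
      exact Submodule.sub_mem _ (hmul _ ha _ hb) (hprec _ ha _ hb)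
  intro x
  have h1 : subsetIncl K posPerm (fqsymProj K x) ∈ LinearMap.range φ := by
    have : fqsymProj K x ∈ (LinearMap.range φ).comap (subsetIncl K posPerm) := htop ▸ trivial
    exact this
  have h2 := Submodule.add_mem _ h1 (Submodule.smul_mem _ ((fqsymUnital K).counit x) hone)
  rwa [haug.incl_proj, sub_add_cancel] at h2

theorem fqsymUnital_prec_mem (i j : ℕ) : ∀ a ∈ fqsymDegree K i, ∀ b ∈ fqsymDegree K j,
    (fqsymUnital K).prec a b ∈ fqsymDegree K (i + j) := by
  classical
  refine linearMap_mem_of_basis₂ (X := AllPerm) (deg := Sigma.fst) ?_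
  rintro x y rfl rfl
  simp only [fqsymUnital, bilin_single]
  refine Submodule.sum_mem _ fun ζ _ => ?_
  exact single_mem_gradedPart (K := K) (X := AllPerm) Sigma.fst (shufflePerm x y ζ)

/-- The isomorphism: the universal property of trees, applied to generators of `FQSym`. -/
theorem exists_isIso (hzero : ∀ d, deg d ≠ 0) (hfin : ∀ n, {d | deg d = n}.Finite)
    (hcard : ∀ n, 1 ≤ n → ({d | deg d = n}.ncard : ℚ) = PowerSeries.coeff n pSeries) :
    ∃ e : HTree K D ≃ₗ[K] FQSym K, (htreeUnital K D).IsIso (fqsymUnital K) e ∧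
      ∀ n, (htreeDegree K deg n).map (e : HTree K D →ₗ[K] FQSym K) = fqsymDegree K n := by
  obtain ⟨v, hv, hspan⟩ := exists_generators (K := K) hzero hfin hcard
  have hT := fqsymUnital_isBidendriform (K := K)
  set q : D → FQSym K := fun d => subsetIncl K posPerm (v d) with hq
  have hprim : ∀ d, (fqsymUnital K).IsTotallyPrimitive (q d) :=
    fun d => isTotallyPrimitive_of_mem (hv d)
  have hqdeg : ∀ d, q d ∈ fqsymDegree K (deg d) := fun d =>
    subsetIncl_mem_gradedPart (deg := (Sigma.fst : AllPerm → ℕ)) posPerm (hv d).2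
  have hdeg : ∀ F : Forest D, (fqsymUnital K).hom q (Finsupp.single F 1) ∈
      fqsymDegree K (forestDegree deg F) := by
    intro F
    rw [UnitalOps.hom_single]
    exact (UnitalOps.forestHom_mem (T := fqsymUnital K) fqsym_isConnectedGraded.one_mem
      fqsym_isConnectedGraded.mul_mem fqsymUnital_prec_mem hqdeg).2 F
  obtain ⟨hbij, hmap⟩ := bijective_of_surjective_of_graded
    (degX := (Sigma.fst : AllPerm → ℕ)) (degY := forestDegree deg) hdeg (hom_surjective hspan)
    finite_allPerm (finite_forestDegree hzero hfin)
    fun n => (ncard_allPerm n).trans (ncard_forestDegree hzero hfin hcard n).symm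
  exact ⟨LinearEquiv.ofBijective _ hbij, ⟨hT.hom_mul, UnitalOps.hom_one, hT.hom_prec,
    hT.hom_counit, hT.hom_comul hprim, hT.hom_dprec hprim⟩, hmap⟩

end Generators

end Bidend

end

theorem mainTheorem3 {K : Type*} [Field K] {D : Type*} (deg : D → ℕ)
    (hzero : ∀ d, deg d ≠ 0)
    (hfin : ∀ n, {d | deg d = n}.Finite)
    (hcard : ∀ n, 1 ≤ n →
      ({d | deg d = n}.ncard : ℚ) = PowerSeries.coeff n Bidend.pSeries) :
    ((Bidend.fqsymBidend K).IsGradedBidendriformBialgebra (Bidend.fqsymPlusDegree K) ∧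
      (Bidend.atreeBidend K D).IsGradedBidendriformBialgebra (Bidend.atreeDegree K deg) ∧
      ∃ e : Bidend.FQSymPlus K ≃ₗ[K] Bidend.ATree K D,
        Bidend.IsGradedBidendIso (Bidend.fqsymBidend K) (Bidend.fqsymPlusDegree K)
          (Bidend.atreeBidend K D) (Bidend.atreeDegree K deg) e) ∧
    ((Bidend.fqsymHopf K).IsGradedHopfAlgebra (Bidend.fqsymDegree K) ∧
      (Bidend.htreeHopf K D).IsGradedHopfAlgebra (Bidend.htreeDegree K deg) ∧
      ∃ e : Bidend.FQSym K ≃ₗ[K] Bidend.HTree K D,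
        Bidend.IsGradedHopfIso (Bidend.fqsymHopf K) (Bidend.fqsymDegree K)
          (Bidend.htreeHopf K D) (Bidend.htreeDegree K deg) e) := by
  open Bidend in
  obtain ⟨e, he, hmap⟩ := exists_isIso (K := K) hzero hfin hcard
  have hF := fqsymUnital_isBidendriform (K := K)
  have hH : (htreeUnital K D).IsBidendriform := he.isBidendriform hF
  have hHopf : IsGradedHopfIso (htreeHopf K D) (htreeDegree K deg) (fqsymHopf K)
      (fqsymDegree K) e := ⟨he.map_mul, he.map_one, he.map_comul, he.map_counit, hmap⟩
  have hBid := he.restrict_isGradedBidendIso fqsym_isAugmentation htree_isAugmentation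
    (𝒜' := atreeDegree K deg) (𝒜 := fqsymPlusDegree K)
    (he.map_restrict_gradedPart fqsym_isAugmentation htree_isAugmentation hmap)
  rw [← fqsymBidend_eq_restrict, ← atreeBidend_eq_restrict] at hBid
  refine ⟨⟨fqsymBidend_isGraded, hBid.isGradedBidendriformBialgebra fqsymBidend_isGraded ?_
    (isInternal_gradedPart fun F : posForest D => forestDegree deg F.1), _, hBid.symm⟩,
    fqsym_isGradedHopfAlgebra, ?_, _, hHopf.symm⟩
  · rw [atreeBidend_eq_restrict]
    exact hH.isBidendriformBialgebra htree_isAugmentation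
  · exact hH.toIsBialgebra.isGradedHopfAlgebra_of_connected (deg := forestDegree deg)
      (hHopf.isConnectedGraded fqsym_isConnectedGraded)
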